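/- Let $1\le p<q<\infty$. For a compact operator $T:\ell_2\to\ell_2$ ($\ell_2$ over $\mathbb R$) with singular values $\sigma_1(T)\ge\sigma_2(T)\ge\cdots$ put $\|T\|_{S_p}=\big(\sum_j\sigma_j(T)^p\big)^{1/p}$, and let $S_p$ be the space of those $T$ with $\|T\|_{S_p}<\infty$. Identify $m\times m$ real matrices with operators on $\ell_2$ supported on the top left $m\times m$ corner. For metric spaces $(\mathcal M,d_{\mathcal M})$, $(\mathcal N,d_{\mathcal N})$, let $\mathsf c_{\mathcal N}(\mathcal M)$ be the infimum of those $\alpha\in[1,\infty]$ for which there are $f:\mathcal M\to\mathcal N$ and $\lambda\in(0,\infty)$ with $\lambda d_{\mathcal N}(f(x),f(y))\le d_{\mathcal M}(x,y)\le\alpha\lambda d_{\mathcal N}(f(x),f(y))$ for all $x,y\in\mathcal M$. For a symmetric positive semidefinite matrix $M$ and $\beta\neq0$, the power $M^{\beta}$ is taken by functional calculus with the convention $0^\beta=0$, and $M^0$ is the identity. (1) Let $X\neq\{0\}$ be a finite-dimensional linear subspace of $S_p$, put $k=\dim X$, and let $D=k^{\frac1p-\frac1q}$ if $p\le 2$ and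 $D=k^{\frac p2\left(\frac1p-\frac1q\right)}$ if $p>2$. Then $\mathsf c_{S_q}(X)\le D$. Moreover, this bound is achieved, up to a factor arbitrarily close to $1$, by linear embeddings of the following form. For every $\varepsilon\in(0,1)$ there are $m\in\mathbb N$, a linear map $J:X\to \mathsf M_m(\mathbb R)$ with $(1-\varepsilon)\|B\|_{S_p}\le\|JB\|_{S_p}\le\|B\|_{S_p}$ for all $B\in X$, and a basis $T_1,\dots,T_k$ of $JX$ such that, with $M=\sum_{i=1}^kT_i^*T_i$, $$\mathrm{Tr}\Big[\tfrac12\big(T_i^*T_j+T_j^*T_i\big)M^{\frac p2-1}\Big]=\delta_{ij}\qquad(1\le i,j\le k),$$ for which the linear map $\Phi:X\to S_q$, $\Phi B=(JB)M^{\frac{p-q}{2q}}$, satisfies $$(1-\varepsilon)\|B\|_{S_p}\le k^{\frac1p-\frac1q}\,\|\Phi B\|_{S_q}\le D\,\|B\|_{S_p}\qquad\text{for all }B\in X.$$ (2) The bound is sharp when $1\le p<q\le2$: for every integer $k\ge1$ we have $\mathsf c_{S_q}(\ell_p^k)=k^{\frac1p-\frac1q}$, and there is a $k$-dimensional linear subspace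 $X$ of $S_p$ that is linearly isometric to $\ell_p^k$ and satisfies $\mathsf c_{S_q}(X)=k^{\frac1p-\frac1q}$. -/

import Mathlib

open scoped ENNReal Matrix

noncomputable section

/-- The real Hilbert space of square-summable real sequences. -/
abbrev Ell2 : Type := lp (fun _ : ℕ => ℝ) 2

section Schatten

variable {H : Type*} [NormedAddCommGroup H] [InnerProductSpace ℝ H] [CompleteSpace H]

/-- The multiplicity of `s` as a singular value of `T` (meant for `s > 0` and `T` compact):
the dimension of the eigenspace of `T* T` with eigenvalue `s ^ 2`. -/
def singularMultiplicity (T : H →L[ℝ] H) (s : ℝ) : ℕ :=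
  Module.finrank ℝ (Module.End.eigenspace
    ((ContinuousLinearMap.adjoint T ∘L T : H →L[ℝ] H) : H →ₗ[ℝ] H) (s ^ 2))

/-- Membership in the Schatten--von Neumann class of exponent `p`: the operator is compact and
its singular values, counted with multiplicity, are `p`-summable. -/
def MemSchatten (p : ℝ) (T : H →L[ℝ] H) : Prop :=
  IsCompactOperator T ∧
    Summable (fun s : Set.Ioi (0 : ℝ) => (singularMultiplicity T s : ℝ) * (s : ℝ) ^ p)

/-- The Schatten--von Neumann norm `(∑ⱼ σⱼ(T) ^ p) ^ (1 / p)`; the sum over the singular values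
is written as a sum over the distinct positive ones, weighted by their multiplicities. -/
def schattenNorm (p : ℝ) (T : H →L[ℝ] H) : ℝ :=
  (∑' s : Set.Ioi (0 : ℝ), (singularMultiplicity T s : ℝ) * (s : ℝ) ^ p) ^ (1 / p)

end Schatten

/-- The Schatten--von Neumann class `S_p` of operators on `ℓ₂`, as a type. -/
abbrev SchattenClass (p : ℝ) : Type := {T : Ell2 →L[ℝ] Ell2 // MemSchatten p T}

/-- The distance of `S_p`. -/
def schattenDist (p : ℝ) (S T : Ell2 →L[ℝ] Ell2) : ℝ := schattenNorm p (S - T)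

/-- The operator on `ℓ₂` whose matrix in the standard basis is `A` in the top left
`m × m` corner and `0` elsewhere. This identifies `S_p^m` with a subspace of `S_p`. -/
def cornerOp {m : ℕ} (A : Matrix (Fin m) (Fin m) ℝ) : Ell2 →L[ℝ] Ell2 :=
  ∑ i : Fin m, ∑ j : Fin m,
    A i j • InnerProductSpace.rankOne ℝ
      (lp.single 2 (i : ℕ) (1 : ℝ) : Ell2) (lp.single 2 (j : ℕ) (1 : ℝ) : Ell2)

/-- Real powers of a symmetric positive semidefinite matrix by functional calculus. Since
`(0 : ℝ) ^ β = 0` for `β ≠ 0`, negative powers vanish on the kernel of the matrix. -/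
def psdPow {m : ℕ} (M : Matrix (Fin m) (Fin m) ℝ) (β : ℝ) : Matrix (Fin m) (Fin m) ℝ :=
  cfc (fun x : ℝ => x ^ β) M

/-- The matrix `M = ∑ᵢ Tᵢ* Tᵢ`. -/
def gramSum {k m : ℕ} (T : Fin k → Matrix (Fin m) (Fin m) ℝ) : Matrix (Fin m) (Fin m) ℝ :=
  ∑ i, (T i)ᵀ * T i

/-- `T₁, …, T_k` is a Lewis-type basis (with exponent `p`) of the subspace `Y` of matrices. -/
def IsLewisBasis {k m : ℕ} (p : ℝ) (Y : Submodule ℝ (Matrix (Fin m) (Fin m) ℝ))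
    (T : Fin k → Matrix (Fin m) (Fin m) ℝ) : Prop :=
  LinearIndependent ℝ T ∧ Submodule.span ℝ (Set.range T) = Y ∧
    ∀ i j, Matrix.trace (((1 / 2 : ℝ) • ((T i)ᵀ * T j + (T j)ᵀ * T i)) *
      psdPow (gramSum T) (p / 2 - 1)) = if i = j then 1 else 0

/-- The bi-Lipschitz distortion of `(𝓜, dM)` in `(𝓝, dN)`: the infimum of those `α ∈ [1, ∞]` for
which there are `f : 𝓜 → 𝓝` and a scaling factor `l > 0` such that
`l * dN (f x) (f y) ≤ dM x y ≤ α * l * dN (f x) (f y)` for all `x` and `y`. -/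
def distortion {𝓜 𝓝 : Type*} (dM : 𝓜 → 𝓜 → ℝ) (dN : 𝓝 → 𝓝 → ℝ) : ℝ≥0∞ :=
  sInf {α : ℝ≥0∞ | 1 ≤ α ∧ ∃ (f : 𝓜 → 𝓝) (l : ℝ), 0 < l ∧ ∀ x y,
    l * dN (f x) (f y) ≤ dM x y ∧
      ENNReal.ofReal (dM x y) ≤ α * ENNReal.ofReal (l * dN (f x) (f y))}

/-- The distortion in `S_q` of a set `𝓜` with distance `dM`. -/
def distortionInSchatten (q : ℝ) {𝓜 : Type*} (dM : 𝓜 → 𝓜 → ℝ) : ℝ≥0∞ :=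
  distortion dM (fun S T : SchattenClass q => schattenDist q S.1 T.1)

/-- The space `ℓ_p^k`. -/
abbrev EllPK (p : ℝ) (k : ℕ) : Type := PiLp (ENNReal.ofReal p) (fun _ : Fin k => ℝ)

/-- The bound `k ^ (1/p - 1/q)` for `p ≤ 2` and `k ^ ((p/2) (1/p - 1/q))` for `p > 2`. -/
def distortionBound (p q : ℝ) (k : ℕ) : ℝ :=
  if p ≤ 2 then (k : ℝ) ^ (1 / p - 1 / q) else (k : ℝ) ^ (p / 2 * (1 / p - 1 / q))

end

/-!
The first part rests on a noncommutative change of density. Every subspace of matrices of dimension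
`k` has a Lewis basis (`exists_lewisBasis`): among the substitutions of absolute determinant at
least `1` in a fixed basis, choose one that minimises the trace of `M ^ (p / 2)`, where `M = ∑ Tᵢᵀ
Tᵢ`; after a scaling, the first-order condition at the minimum says that the matrices `Tᵢ` are
orthonormal for the bilinear form `trace (Aᵀ B M ^ (p / 2 - 1))`, in particular `trace (M ^ (p /
2)) = k`. Hölder's inequality then bounds the Schatten `p`-norm of `Z` by `k ^ (1 / p - 1 / q)`
times the `q`-norm of `Z M ^ ((p - q) / (2 q))` (`IsLewisBasis.le_changeDensity`). In the other
direction, orthonormality says that the operator norm of `Z M ^ (-1 / 2)` is at most the weighted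
Hilbert norm of `Z`, which is in turn bounded by the `p`-norm of `Z`, by interpolation if `p ≤ 2`
and by Hölder's inequality if `p > 2`. Interpolating between `Z M ^ (-1 / 2)` and `Z` gives
`IsLewisBasis.changeDensity_le`. The interpolation (`tracePow_weighted_le`) needs no complex
analysis: it is Jensen's inequality for the spectral measure of `M`, combined with Peierls'
inequality in a suitable eigenbasis.

To pass from matrices to operators on `ℓ₂`, the Schatten norm is characterised by its pairings with
Bessel families (`HasSchattenBound`). In this form the triangle inequality is Minkowski's
inequality, and the norms of the corners of an operator are seen to increase to its norm. On a
finite-dimensional space this convergence is uniform (`exists_le_seminorm`), so that some corner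
preserves the norm up to a factor close to `1`.

The second part uses that for `1 ≤ q ≤ 2` the `q`-th powers of the diagonals of a quadrilateral in
`S_q` sum up to at most those of its sides (`schattenDist_roundness`); this follows from McCarthy's
inequality. By induction on the dimension, the `q`-th powers of the long diagonals of a cube are
dominated by those of its edges (`sum_diagonal_le_sum_edge`), and the cube `{-1, 1}ᵏ` in `ℓ_p^k`
forces distortion `k ^ (1 / p - 1 / q)`. The diagonal operators form an isometric copy of `ℓ_p^k`
to which the first part applies.
-/

namespace SchattenLewis

open scoped Topology

/-! ### Jensen inequalities with substochastic weights -/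

/-- Jensen's inequality; total mass below `1` is allowed because `x ↦ x ^ t` vanishes at `0`. -/
lemma rpow_sum_weight_le {ι : Type*} (s : Finset ι) (w f : ι → ℝ) (hw : ∀ i, 0 ≤ w i)
    (hf : ∀ i, 0 ≤ f i) (h1 : ∑ i ∈ s, w i ≤ 1) {t : ℝ} (ht : 1 ≤ t) :
    (∑ i ∈ s, w i * f i) ^ t ≤ ∑ i ∈ s, w i * f i ^ t := by
  have t0 : 0 < t := by linarith
  have hS : 0 ≤ ∑ i ∈ s, w i * f i ^ t :=
    Finset.sum_nonneg fun i _ => mul_nonneg (hw i) (Real.rpow_nonneg (hf i) _)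
  have hS' : 0 ≤ ∑ i ∈ s, w i * f i :=
    Finset.sum_nonneg fun i _ => mul_nonneg (hw i) (hf i)
  have hW : 0 ≤ ∑ i ∈ s, w i := Finset.sum_nonneg fun i _ => hw i
  have h := Real.inner_le_weight_mul_Lp_of_nonneg s ht w f hw hf
  have h2 : (∑ i ∈ s, w i) ^ (1 - t⁻¹) ≤ 1 :=
    Real.rpow_le_one hW h1 (sub_nonneg.2 (inv_le_one_of_one_le₀ ht))
  have h3 : ∑ i ∈ s, w i * f i ≤ (∑ i ∈ s, w i * f i ^ t) ^ t⁻¹ :=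
    h.trans (mul_le_of_le_one_left (Real.rpow_nonneg hS _) h2)
  calc _ ≤ ((∑ i ∈ s, w i * f i ^ t) ^ t⁻¹) ^ t := Real.rpow_le_rpow hS' h3 t0.le
    _ = _ := Real.rpow_inv_rpow hS t0.ne'

/-- Comparison of power means of two exponents `a ≤ b` for weights of total mass at most `c`. -/
lemma sum_weight_rpow_le {ι : Type*} (s : Finset ι) (w f : ι → ℝ) (hw : ∀ i, 0 ≤ w i)
    (hf : ∀ i, 0 ≤ f i) {c : ℝ} (h1 : ∑ i ∈ s, w i ≤ c) {a b : ℝ} (ha : 0 < a) (hab : a ≤ b) :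
    ∑ i ∈ s, w i * f i ^ a ≤ c ^ (1 - a / b) * (∑ i ∈ s, w i * f i ^ b) ^ (a / b) := by
  have b0 : 0 < b := ha.trans_le hab
  have hW : 0 ≤ ∑ i ∈ s, w i := Finset.sum_nonneg fun i _ => hw i
  have h := Real.inner_le_weight_mul_Lp_of_nonneg s (p := b / a) ((one_le_div ha).2 hab) w
    (fun i => f i ^ a) hw (fun i => Real.rpow_nonneg (hf i) _)
  have e : ∀ i, (f i ^ a) ^ (b / a) = f i ^ b := fun i => by
    rw [← Real.rpow_mul (hf i), mul_div_cancel₀ _ ha.ne']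
  simp only [e, inv_div] at h
  refine h.trans ?_
  gcongr
  · exact Real.rpow_nonneg
      (Finset.sum_nonneg fun i _ => mul_nonneg (hw i) (Real.rpow_nonneg (hf i) _)) _
  · exact sub_nonneg.2 ((div_le_one b0).2 hab)

/-- Averaging `f` with doubly substochastic weights decreases the sum of the `t`-th powers. -/
lemma sum_rpow_sum_weight_le {ι κ : Type*} (s : Finset ι) (u : Finset κ) (w : ι → κ → ℝ)
    (f : κ → ℝ) (hw : ∀ i j, 0 ≤ w i j) (hf : ∀ j, 0 ≤ f j) (hrow : ∀ i, ∑ j ∈ u, w i j ≤ 1)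
    (hcol : ∀ j, ∑ i ∈ s, w i j ≤ 1) {t : ℝ} (ht : 1 ≤ t) :
    ∑ i ∈ s, (∑ j ∈ u, w i j * f j) ^ t ≤ ∑ j ∈ u, f j ^ t :=
  calc _ ≤ ∑ i ∈ s, ∑ j ∈ u, w i j * f j ^ t :=
        Finset.sum_le_sum fun i _ => rpow_sum_weight_le u _ f (hw i) hf (hrow i) ht
    _ = ∑ j ∈ u, (∑ i ∈ s, w i j) * f j ^ t := by
        rw [Finset.sum_comm]; simp_rw [Finset.sum_mul]
    _ ≤ ∑ j ∈ u, f j ^ t := Finset.sum_le_sum fun j _ =>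
        mul_le_of_le_one_left (Real.rpow_nonneg (hf j) _) (hcol j)

/-- The concave counterpart of `sum_rpow_sum_weight_le`; the column sums must now be exactly `1`. -/
lemma sum_le_sum_rpow_sum_weight {ι κ : Type*} (s : Finset ι) (u : Finset κ) (w : ι → κ → ℝ)
    (f : κ → ℝ) (hw : ∀ i j, 0 ≤ w i j) (hf : ∀ j, 0 ≤ f j) (hrow : ∀ i, ∑ j ∈ u, w i j ≤ 1)
    (hcol : ∀ j, ∑ i ∈ s, w i j = 1) {t : ℝ} (ht0 : 0 < t) (ht : t ≤ 1) :
    ∑ j ∈ u, f j ^ t ≤ ∑ i ∈ s, (∑ j ∈ u, w i j * f j) ^ t :=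
  calc ∑ j ∈ u, f j ^ t = ∑ j ∈ u, (∑ i ∈ s, w i j) * f j ^ t := by simp [hcol]
    _ = ∑ i ∈ s, ∑ j ∈ u, w i j * f j ^ t := by
        simp_rw [Finset.sum_mul]; rw [Finset.sum_comm]
    _ ≤ _ := Finset.sum_le_sum fun i _ => by
        simpa using sum_weight_rpow_le u _ f (hw i) hf (hrow i) ht0 ht

/-! ### Powers of positive semidefinite matrices -/

section Matrices

variable {m : ℕ}

local notation "Mat" => Matrix (Fin m) (Fin m) ℝ

lemma cfc_eq_aeval {M : Mat} (hM : M.IsHermitian) (f : ℝ → ℝ) (P : Polynomial ℝ)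
    (h : ∀ x ∈ spectrum ℝ M, f x = P.eval x) : cfc f M = Polynomial.aeval M P := by
  rw [← cfc_polynomial P M hM.isSelfAdjoint]
  exact cfc_congr h

/-- The functional calculus of a symmetric matrix, in a basis of eigenvectors. -/
lemma exists_diag {M : Mat} (hM : M.PosSemidef) :
    ∃ (U : Mat) (d : Fin m → ℝ), Uᵀ * U = 1 ∧ U * Uᵀ = 1 ∧ (∀ i, 0 ≤ d i) ∧
      M = U * Matrix.diagonal d * Uᵀ ∧
      ∀ f : ℝ → ℝ, cfc f M = U * Matrix.diagonal (fun i => f (d i)) * Uᵀ := by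
  have hH := hM.isHermitian
  have key : ∀ f : ℝ → ℝ, cfc f M = (hH.eigenvectorUnitary : Mat) *
      Matrix.diagonal (fun i => f (hH.eigenvalues i)) * (hH.eigenvectorUnitary : Mat)ᵀ := by
    intro f
    rw [hH.cfc_eq, Matrix.IsHermitian.cfc, Unitary.conjStarAlgAut_apply]
    rfl
  refine ⟨hH.eigenvectorUnitary, hH.eigenvalues, ?_, ?_, hM.eigenvalues_nonneg, ?_, key⟩
  · exact Unitary.coe_star_mul_self hH.eigenvectorUnitary
  · exact Unitary.coe_mul_star_self hH.eigenvectorUnitary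
  · conv_lhs => rw [← cfc_id' ℝ M hH.isSelfAdjoint]
    exact key _

/-- The trace of the power `C ^ t`; for `C = XᵀX` and `t = p / 2` it is the `p`-th power of the
Schatten `p`-norm of `X`. -/
noncomputable def tracePow (t : ℝ) (C : Mat) : ℝ := (psdPow C t).trace

lemma trace_conj {U : Mat} (hU : U * Uᵀ = 1) (A : Mat) : (Uᵀ * A * U).trace = A.trace := by
  rw [Matrix.trace_mul_comm, ← Matrix.mul_assoc, hU, Matrix.one_mul]

lemma trace_conj' {U : Mat} (hU : Uᵀ * U = 1) (A : Mat) : (U * A * Uᵀ).trace = A.trace := by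
  rw [Matrix.trace_mul_comm, ← Matrix.mul_assoc, hU, Matrix.one_mul]

lemma conj_diagonal_apply (V U : Mat) (d : Fin m → ℝ) (j : Fin m) :
    (Vᵀ * (U * Matrix.diagonal d * Uᵀ) * V) j j = ∑ i, ((Uᵀ * V) i j) ^ 2 * d i := by
  have : Vᵀ * (U * Matrix.diagonal d * Uᵀ) * V = (Uᵀ * V)ᵀ * Matrix.diagonal d * (Uᵀ * V) := by
    simp [Matrix.mul_assoc]
  rw [this, Matrix.mul_apply]
  simp only [Matrix.mul_diagonal, Matrix.transpose_apply]
  exact Finset.sum_congr rfl fun i _ => by ring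

lemma psdPow_one {M : Mat} (hM : M.PosSemidef) : psdPow M 1 = M := by
  simpa [psdPow] using cfc_id' ℝ M hM.isHermitian.isSelfAdjoint

lemma psdPow_zero {M : Mat} (hM : M.PosSemidef) : psdPow M 0 = 1 := by
  obtain ⟨U, d, -, hU, -, -, hf⟩ := exists_diag hM
  rw [psdPow, hf]; simp [hU]

lemma psdPow_posSemidef {M : Mat} (hM : M.PosSemidef) (β : ℝ) : (psdPow M β).PosSemidef := by
  obtain ⟨U, d, -, -, hd, -, hf⟩ := exists_diag hM
  rw [psdPow, hf]
  exact (Matrix.PosSemidef.diagonal fun i => Real.rpow_nonneg (hd i) _).mul_mul_conjTranspose_same U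

lemma psdPow_transpose {M : Mat} (hM : M.PosSemidef) (β : ℝ) : (psdPow M β)ᵀ = psdPow M β :=
  (psdPow_posSemidef hM β).isHermitian

lemma psdPow_mul {M : Mat} (hM : M.PosSemidef) {a b : ℝ} (hab : a + b ≠ 0) :
    psdPow M a * psdPow M b = psdPow M (a + b) := by
  obtain ⟨U, d, hU, -, hd, -, hf⟩ := exists_diag hM
  simp only [psdPow, hf]
  calc _ = U * Matrix.diagonal (fun i => d i ^ a) * (Uᵀ * U) *
        Matrix.diagonal (fun i => d i ^ b) * Uᵀ := by simp only [Matrix.mul_assoc]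
    _ = U * (Matrix.diagonal (fun i => d i ^ a) * Matrix.diagonal (fun i => d i ^ b)) * Uᵀ := by
        rw [hU]; simp only [Matrix.mul_assoc, Matrix.one_mul]
    _ = _ := by
        rw [Matrix.diagonal_mul_diagonal]
        simp only [Real.rpow_add' (hd _) hab]

lemma mul_psdPow_sub_one {M : Mat} (hM : M.PosSemidef) {t : ℝ} (ht : t ≠ 0) :
    M * psdPow M (t - 1) = psdPow M t := by
  have := psdPow_mul hM (a := 1) (b := t - 1) (by simpa using ht)
  rwa [psdPow_one hM, add_sub_cancel] at this

lemma psdPow_psdPow {M : Mat} (hM : M.PosSemidef) (a b : ℝ) :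
    psdPow (psdPow M a) b = psdPow M (a * b) := by
  have hfin := M.finite_real_spectrum
  have := cfc_comp' (fun x : ℝ => x ^ b) (fun x : ℝ => x ^ a) M
    ((hfin.image _).continuousOn _) (hfin.continuousOn _) hM.isHermitian.isSelfAdjoint
  rw [psdPow, psdPow, psdPow, ← this]
  refine cfc_congr fun x hx => ?_
  have hx0 : 0 ≤ x := by
    rw [hM.isHermitian.spectrum_real_eq_range_eigenvalues] at hx
    obtain ⟨i, rfl⟩ := hx
    exact hM.eigenvalues_nonneg i
  simp only [Real.rpow_mul hx0]

lemma tracePow_nonneg {C : Mat} (hC : C.PosSemidef) (t : ℝ) : 0 ≤ tracePow t C :=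
  (psdPow_posSemidef hC t).trace_nonneg

lemma tracePow_one {C : Mat} (hC : C.PosSemidef) : tracePow 1 C = C.trace := by
  rw [tracePow, psdPow_one hC]

lemma mul_cfc_transpose_mul_self (X : Mat) (f : ℝ → ℝ) :
    X * cfc f (Xᵀ * X) = cfc f (X * Xᵀ) * X := by
  have h1 : (Xᵀ * X).IsHermitian := Matrix.isHermitian_conjTranspose_mul_self X
  have h2 : (X * Xᵀ).IsHermitian := Matrix.isHermitian_mul_conjTranspose_self X
  classical
  -- on the two finite spectra `f` agrees with a polynomial
  let s : Finset ℝ := (Xᵀ * X).finite_real_spectrum.toFinset ∪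
    (X * Xᵀ).finite_real_spectrum.toFinset
  let P := Lagrange.interpolate s id f
  have hP : ∀ x ∈ s, f x = P.eval x := fun x hx =>
    (Lagrange.eval_interpolate_at_node f Function.injective_id.injOn hx).symm
  rw [cfc_eq_aeval h1 f P fun x hx => hP x (by simp [s, hx]),
    cfc_eq_aeval h2 f P fun x hx => hP x (by simp [s, hx])]
  induction P using Polynomial.induction_on' with
  | add p q hp hq => simp [Matrix.mul_add, Matrix.add_mul, hp, hq]
  | monomial n a =>
    have : X * (Xᵀ * X) ^ n = (X * Xᵀ) ^ n * X := by
      induction n with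
      | zero => simp
      | succ n ih => rw [pow_succ, pow_succ, ← Matrix.mul_assoc, ih]; simp [Matrix.mul_assoc]
    simp [Polynomial.aeval_monomial, ← Algebra.smul_def, this]

lemma posSemidef_transpose_mul_self (X : Mat) : (Xᵀ * X).PosSemidef :=
  Matrix.posSemidef_conjTranspose_mul_self X

lemma posSemidef_mul_transpose_self (X : Mat) : (X * Xᵀ).PosSemidef :=
  Matrix.posSemidef_self_mul_conjTranspose X

lemma tracePow_mul_transpose_comm (X : Mat) {t : ℝ} (ht : 0 < t) :
    tracePow t (X * Xᵀ) = tracePow t (Xᵀ * X) := by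
  have h1 := posSemidef_transpose_mul_self X
  have h2 := posSemidef_mul_transpose_self X
  rw [tracePow, tracePow, ← mul_psdPow_sub_one h1 ht.ne', ← mul_psdPow_sub_one h2 ht.ne',
    Matrix.mul_assoc Xᵀ, psdPow, psdPow,
    mul_cfc_transpose_mul_self, Matrix.trace_mul_comm Xᵀ, Matrix.mul_assoc _ X,
    Matrix.trace_mul_comm (X * Xᵀ)]

/-- `V` does not increase Euclidean lengths; its columns then form a Bessel sequence. -/
def IsContraction (V : Mat) : Prop := ∀ x : Fin m → ℝ, (V *ᵥ x) ⬝ᵥ (V *ᵥ x) ≤ x ⬝ᵥ x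

lemma mulVec_dotProduct_mulVec (A B : Mat) (x y : Fin m → ℝ) :
    (A *ᵥ x) ⬝ᵥ (B *ᵥ y) = x ⬝ᵥ ((Aᵀ * B) *ᵥ y) := by
  rw [← Matrix.mulVec_mulVec, Matrix.dotProduct_mulVec x, ← Matrix.mulVec_transpose,
    Matrix.transpose_transpose]

lemma dotProduct_self_nonneg' (x : Fin m → ℝ) : 0 ≤ x ⬝ᵥ x :=
  Finset.sum_nonneg fun _ _ => mul_self_nonneg _

lemma dotProduct_sq_le (x y : Fin m → ℝ) : (x ⬝ᵥ y) ^ 2 ≤ (x ⬝ᵥ x) * (y ⬝ᵥ y) := by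
  simpa [dotProduct, sq] using Finset.sum_mul_sq_le_sq_mul_sq Finset.univ x y

lemma IsContraction.transpose {V : Mat} (hV : IsContraction V) : IsContraction Vᵀ := by
  intro x
  set y := Vᵀ *ᵥ x
  have e : y ⬝ᵥ y = x ⬝ᵥ (V *ᵥ y) := by
    rw [mulVec_dotProduct_mulVec, Matrix.transpose_transpose, ← Matrix.mulVec_mulVec]
  have cs := dotProduct_sq_le x (V *ᵥ y)
  have h0 := dotProduct_self_nonneg' x
  have h1 := dotProduct_self_nonneg' y
  rw [← e] at cs
  by_contra! h
  nlinarith [hV y, mul_le_mul_of_nonneg_left (hV y) h0]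

lemma IsContraction.mul {V W : Mat} (hV : IsContraction V) (hW : IsContraction W) :
    IsContraction (V * W) := fun x => by
  rw [← Matrix.mulVec_mulVec]
  exact (hV _).trans (hW x)

lemma isContraction_of_transpose_mul_self {V : Mat} (hV : Vᵀ * V = 1) : IsContraction V :=
  fun x => by rw [mulVec_dotProduct_mulVec, hV, Matrix.one_mulVec]

lemma IsContraction.sum_sq_le {V : Mat} (hV : IsContraction V) (j : Fin m) :
    ∑ i, V i j ^ 2 ≤ 1 := by
  simpa [dotProduct, Matrix.mulVec_single, Pi.single_apply, sq] using hV (Pi.single j 1)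

lemma sum_sq_eq_one {V : Mat} (hV : Vᵀ * V = 1) (j : Fin m) : ∑ i, V i j ^ 2 = 1 := by
  simpa [Matrix.mul_apply, sq] using congrFun (congrFun hV j) j

/-- Convex case of Peierls' inequality. -/
lemma sum_diag_rpow_le_tracePow {C V : Mat} (hC : C.PosSemidef) (hV : IsContraction V) {t : ℝ}
    (ht : 1 ≤ t) : ∑ j, ((Vᵀ * C * V) j j) ^ t ≤ tracePow t C := by
  obtain ⟨U, d, hU, hU', hd, hC', hf⟩ := exists_diag hC
  have hW : IsContraction (Uᵀ * V) :=
    (isContraction_of_transpose_mul_self (by simpa using hU')).mul hV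
  rw [tracePow, psdPow, hf, trace_conj' hU, Matrix.trace_diagonal]
  conv_lhs => rw [hC']
  simp only [conj_diagonal_apply]
  exact sum_rpow_sum_weight_le _ _ (fun j i => (Uᵀ * V) i j ^ 2) d (fun _ _ => sq_nonneg _) hd
    hW.sum_sq_le (fun i => by simpa using hW.transpose.sum_sq_le i) ht

/-- Concave case of Peierls' inequality. -/
lemma tracePow_le_sum_diag_rpow {C V : Mat} (hC : C.PosSemidef) (hV : Vᵀ * V = 1) {t : ℝ}
    (ht0 : 0 < t) (ht : t ≤ 1) : tracePow t C ≤ ∑ j, ((Vᵀ * C * V) j j) ^ t := by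
  obtain ⟨U, d, hU, hU', hd, hC', hf⟩ := exists_diag hC
  have hV' : V * Vᵀ = 1 := mul_eq_one_comm.1 hV
  have hW : (Uᵀ * V)ᵀ * (Uᵀ * V) = 1 := by
    rw [Matrix.transpose_mul, Matrix.transpose_transpose, Matrix.mul_assoc, ← Matrix.mul_assoc U,
      hU', Matrix.one_mul, hV]
  have hW' : (Uᵀ * V)ᵀᵀ * (Uᵀ * V)ᵀ = 1 := by
    rw [Matrix.transpose_transpose]; exact mul_eq_one_comm.1 hW
  rw [tracePow, psdPow, hf, trace_conj' hU, Matrix.trace_diagonal]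
  conv_rhs => rw [hC']
  simp only [conj_diagonal_apply]
  exact sum_le_sum_rpow_sum_weight _ _ (fun j i => (Uᵀ * V) i j ^ 2) d (fun _ _ => sq_nonneg _) hd
    (fun j => (sum_sq_eq_one hW j).le) (fun i => by simpa using sum_sq_eq_one hW' i) ht0 ht

/-- In a basis of eigenvectors of `C` Peierls' inequality is an equality. -/
lemma exists_diag_tracePow {C : Mat} (hC : C.PosSemidef) :
    ∃ V : Mat, Vᵀ * V = 1 ∧ (∀ j, 0 ≤ (Vᵀ * C * V) j j) ∧
      (∀ t, tracePow t C = ∑ j, ((Vᵀ * C * V) j j) ^ t) ∧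
      (∀ t, Vᵀ * psdPow C t * V = Matrix.diagonal fun j => ((Vᵀ * C * V) j j) ^ t) := by
  obtain ⟨U, d, hU, hU', hd, hC', hf⟩ := exists_diag hC
  have e : ∀ D : Mat, Uᵀ * (U * D * Uᵀ) * U = D := fun D => by
    calc _ = (Uᵀ * U) * D * (Uᵀ * U) := by simp only [Matrix.mul_assoc]
      _ = D := by simp [hU]
  have hd' : ∀ j, (Uᵀ * C * U) j j = d j := fun j => by
    rw [hC', e, Matrix.diagonal_apply_eq]
  refine ⟨U, hU, fun j => (hd' j).symm ▸ hd j, fun t => ?_, fun t => ?_⟩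
  · simp only [hd']
    rw [tracePow, psdPow, hf, trace_conj' hU, Matrix.trace_diagonal]
  · simp only [hd']
    rw [psdPow, hf, e]

lemma posSemidef_transpose_mul_mul {C : Mat} (hC : C.PosSemidef) (V : Mat) :
    (Vᵀ * C * V).PosSemidef := hC.conjTranspose_mul_mul_same V

lemma diag_nonneg {C : Mat} (hC : C.PosSemidef) (j : Fin m) : 0 ≤ C j j :=
  hC.diag_nonneg

lemma trace_mul_psdPow {A C : Mat} {V : Mat} (hV : Vᵀ * V = 1) {t : ℝ} {μ : Fin m → ℝ}
    (h : Vᵀ * psdPow C t * V = Matrix.diagonal fun j => μ j ^ t) :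
    (A * psdPow C t).trace = ∑ j, (Vᵀ * A * V) j j * μ j ^ t := by
  have hV' : V * Vᵀ = 1 := mul_eq_one_comm.1 hV
  have : Vᵀ * (A * psdPow C t) * V = (Vᵀ * A * V) * Matrix.diagonal fun j => μ j ^ t := by
    rw [← h]
    calc _ = Vᵀ * A * 1 * psdPow C t * V := by simp only [Matrix.mul_assoc, Matrix.one_mul]
      _ = _ := by rw [← hV']; simp only [Matrix.mul_assoc]
  rw [← trace_conj hV', this, Matrix.trace]
  simp [Matrix.mul_diagonal]

end Matrices

section Matrices

variable {m : ℕ}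

local notation "Mat" => Matrix (Fin m) (Fin m) ℝ

/-! ### Trace inequalities -/

/-- A pointwise comparison of quadratic forms gives a comparison of traces of powers, by Peierls'
inequality in an eigenbasis of `B` (if `y ≤ 1`) or of `A` (if `1 ≤ y * θ`). -/
lemma tracePow_le_of_diag_le {A B : Mat} (hA : A.PosSemidef) (hB : B.PosSemidef) {K θ y : ℝ}
    (hK : 0 ≤ K) (hy : 0 < y) (hyθ : y ≤ 1 ∨ 1 ≤ y * θ)
    (h : ∀ V : Mat, Vᵀ * V = 1 → ∀ j, (Vᵀ * A * V) j j ≤ K * ((Vᵀ * B * V) j j) ^ θ) :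
    tracePow y A ≤ K ^ y * tracePow (y * θ) B := by
  have key : ∀ V : Mat, Vᵀ * V = 1 → ∑ j, ((Vᵀ * A * V) j j) ^ y ≤
      K ^ y * ∑ j, ((Vᵀ * B * V) j j) ^ (y * θ) := fun V hV => by
    rw [Finset.mul_sum]
    refine Finset.sum_le_sum fun j _ => ?_
    have h1 := diag_nonneg (posSemidef_transpose_mul_mul hA V) j
    have h2 := diag_nonneg (posSemidef_transpose_mul_mul hB V) j
    calc _ ≤ (K * ((Vᵀ * B * V) j j) ^ θ) ^ y := Real.rpow_le_rpow h1 (h V hV j) hy.le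
      _ = _ := by
        rw [Real.mul_rpow hK (Real.rpow_nonneg h2 _), ← Real.rpow_mul h2, mul_comm θ]
  rcases hyθ with h1 | h1
  · obtain ⟨V, hV, -, hT, -⟩ := exists_diag_tracePow hB
    rw [hT]
    exact (tracePow_le_sum_diag_rpow hA hV hy h1).trans (key V hV)
  · obtain ⟨V, hV, -, hT, -⟩ := exists_diag_tracePow hA
    rw [hT]
    refine (key V hV).trans ?_
    gcongr
    exact sum_diag_rpow_le_tracePow hB (isContraction_of_transpose_mul_self hV) h1

/-- The interpolating family `Z M ^ (a - 1) Zᵀ`. -/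
noncomputable def weighted (Z M : Mat) (a : ℝ) : Mat := Z * psdPow M (a - 1) * Zᵀ

lemma weighted_posSemidef (Z : Mat) {M : Mat} (hM : M.PosSemidef) (a : ℝ) :
    (weighted Z M a).PosSemidef :=
  (psdPow_posSemidef hM _).mul_mul_conjTranspose_same Z

lemma weighted_one (Z : Mat) {M : Mat} (hM : M.PosSemidef) : weighted Z M 1 = Z * Zᵀ := by
  simp [weighted, psdPow_zero hM]

/-- Jensen's inequality for the spectral measure of `M`; the hypothesis says that `Z M ^ (-1/2)`
has operator norm at most `√c`. -/
lemma weighted_diag_le {Z M : Mat} (hM : M.PosSemidef) {c : ℝ} (hc : 0 ≤ c)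
    (h : ∀ v : Fin m → ℝ, (Z *ᵥ v) ⬝ᵥ (Z *ᵥ v) ≤ c * (v ⬝ᵥ (M *ᵥ v)))
    {a b : ℝ} (ha : 0 < a) (hab : a ≤ b) {V : Mat} (hV : Vᵀ * V = 1) (j : Fin m) :
    (Vᵀ * weighted Z M a * V) j j ≤
      c ^ (1 - a / b) * ((Vᵀ * weighted Z M b * V) j j) ^ (a / b) := by
  obtain ⟨U, d, hU, hU', hd, hM', hf⟩ := exists_diag hM
  set g : Fin m → ℝ := fun i => (Uᵀ * (Zᵀ * V)) i j with hg
  have e : ∀ s, (Vᵀ * weighted Z M s * V) j j = ∑ i, g i ^ 2 * d i ^ (s - 1) := fun s => by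
    rw [← conj_diagonal_apply, weighted, psdPow, hf]
    simp only [Matrix.transpose_mul, Matrix.transpose_transpose, Matrix.mul_assoc]
  have hB : ∀ x : Fin m → ℝ, (∑ i, g i * x i) ^ 2 ≤ c * ∑ i, d i * x i ^ 2 := fun x => by
    have h1 := h (U *ᵥ x)
    have h2 : (U *ᵥ x) ⬝ᵥ (M *ᵥ (U *ᵥ x)) = ∑ i, d i * x i ^ 2 := by
      rw [Matrix.mulVec_mulVec, mulVec_dotProduct_mulVec, ← Matrix.mul_assoc, hM']
      have : Uᵀ * (U * Matrix.diagonal d * Uᵀ) * U = Matrix.diagonal d := by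
        calc _ = (Uᵀ * U) * Matrix.diagonal d * (Uᵀ * U) := by simp only [Matrix.mul_assoc]
          _ = _ := by simp [hU]
      rw [this]
      simp only [dotProduct, Matrix.mulVec_diagonal]
      exact Finset.sum_congr rfl fun i _ => by ring
    rw [h2] at h1
    refine le_trans ?_ h1
    have h3 : ∑ i, g i * x i = V.col j ⬝ᵥ (Z *ᵥ (U *ᵥ x)) := by
      rw [Matrix.mulVec_mulVec, Matrix.dotProduct_mulVec, ← Matrix.mulVec_transpose]
      simp only [dotProduct, hg, Matrix.transpose_mul, ← Matrix.mul_assoc]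
      rfl
    have h4 : V.col j ⬝ᵥ V.col j = 1 := by
      simpa [Matrix.mul_apply, dotProduct] using congrFun (congrFun hV j) j
    rw [h3]
    simpa [h4] using dotProduct_sq_le (V.col j) (Z *ᵥ (U *ᵥ x))
  have hg0 : ∀ i, d i = 0 → g i = 0 := fun i hi => by
    have := hB (Pi.single i 1)
    simp only [Pi.single_apply, mul_ite, mul_one, mul_zero, Finset.sum_ite_eq', Finset.mem_univ,
      if_true, ite_pow, one_pow, ne_eq, OfNat.ofNat_ne_zero, not_false_eq_true, zero_pow, hi] at this
    exact pow_eq_zero_iff two_ne_zero |>.1 (le_antisymm this (sq_nonneg _))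
  have hw : ∑ i, g i ^ 2 / d i ≤ c := by
    have h1 := hB fun i => g i / d i
    have h2 : ∑ i, g i * (g i / d i) = ∑ i, g i ^ 2 / d i :=
      Finset.sum_congr rfl fun i _ => by ring
    have h3 : ∑ i, d i * (g i / d i) ^ 2 = ∑ i, g i ^ 2 / d i :=
      Finset.sum_congr rfl fun i _ => by
        by_cases hi : d i = 0
        · simp [hi]
        · field_simp
    rw [h2, h3] at h1
    have h4 : 0 ≤ ∑ i, g i ^ 2 / d i :=
      Finset.sum_nonneg fun i _ => div_nonneg (sq_nonneg _) (hd i)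
    by_contra! h5
    nlinarith
  have e' : ∀ s, 0 < s → (Vᵀ * weighted Z M s * V) j j = ∑ i, g i ^ 2 / d i * d i ^ s :=
    fun s hs => by
      rw [e]
      refine Finset.sum_congr rfl fun i _ => ?_
      rcases (hd i).eq_or_lt with hi | hi
      · simp [hg0 i hi.symm]
      · rw [Real.rpow_sub_one hi.ne']; ring
  rw [e' a ha, e' b (ha.trans_le hab)]
  exact sum_weight_rpow_le _ _ d (fun i => div_nonneg (sq_nonneg _) (hd i)) hd hw ha hab

lemma tracePow_weighted_le_aux {Z M : Mat} (hM : M.PosSemidef) {c : ℝ} (hc : 0 ≤ c)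
    (h : ∀ v : Fin m → ℝ, (Z *ᵥ v) ⬝ᵥ (Z *ᵥ v) ≤ c * (v ⬝ᵥ (M *ᵥ v)))
    {a b x : ℝ} (ha : 0 < a) (hab : a ≤ b) (hx : 0 < x) (hx' : x ≤ a ∨ b ≤ x) :
    tracePow (x / a) (weighted Z M a) ≤
      c ^ (x * (1 / a - 1 / b)) * tracePow (x / b) (weighted Z M b) := by
  have hb := ha.trans_le hab
  have := tracePow_le_of_diag_le (weighted_posSemidef Z hM a) (weighted_posSemidef Z hM b)
    (K := c ^ (1 - a / b)) (θ := a / b) (y := x / a) (by positivity)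
    (by positivity) (by
      rw [div_mul_div_cancel₀ ha.ne', div_le_one ha, one_le_div hb]; exact hx')
    fun V hV j => weighted_diag_le hM hc h ha hab hV j
  rw [div_mul_div_cancel₀ ha.ne', ← Real.rpow_mul hc] at this
  convert this using 3
  field_simp

/-- The interpolation inequality between `Z` and `Z M ^ (-1/2)`: in terms of Schatten norms,
`‖Z M ^ ((a - 1) / 2)‖` with exponent `2 x / a` is at most `‖Z‖ ^ a * ‖Z M ^ (-1/2)‖_∞ ^ (1 - a)`,
with exponent `2 x` on the right. -/
lemma tracePow_weighted_le {Z M : Mat} (hM : M.PosSemidef) {c : ℝ} (hc : 0 ≤ c)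
    (h : ∀ v : Fin m → ℝ, (Z *ᵥ v) ⬝ᵥ (Z *ᵥ v) ≤ c * (v ⬝ᵥ (M *ᵥ v)))
    {a x : ℝ} (ha : 0 < a) (ha1 : a ≤ 1) (hx : 0 < x) :
    tracePow (x / a) (weighted Z M a) ≤ c ^ (x * (1 / a - 1)) * tracePow x (Z * Zᵀ) := by
  rw [← weighted_one Z hM]
  by_cases h1 : x ≤ a ∨ 1 ≤ x
  · simpa using tracePow_weighted_le_aux hM hc h ha ha1 hx h1
  -- otherwise pass through the exponent `x` at which the trace itself appears
  · push Not at h1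
    have s1 := tracePow_weighted_le_aux hM hc h ha h1.1.le hx (Or.inr le_rfl)
    have s2 := tracePow_weighted_le_aux hM hc h hx h1.2.le hx (Or.inl le_rfl)
    rw [div_one, div_one] at s2
    calc _ ≤ _ := s1
      _ ≤ c ^ (x * (1 / a - 1 / x)) * (c ^ (x * (1 / x - 1)) * tracePow x (weighted Z M 1)) := by
        gcongr
      _ = _ := by
        rw [← mul_assoc, ← Real.rpow_add_of_nonneg hc]
        · ring_nf
        · exact mul_nonneg hx.le (sub_nonneg.2 (one_div_le_one_div_of_le ha h1.1.le))
        · exact mul_nonneg hx.le (sub_nonneg.2 ((one_le_div hx).2 h1.2.le))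

lemma trace_weighted (Z M : Mat) (a : ℝ) :
    (weighted Z M a).trace = (Zᵀ * Z * psdPow M (a - 1)).trace := by
  rw [weighted, Matrix.trace_mul_comm, Matrix.mul_assoc]

/-! ### McCarthy's inequality -/

lemma mulVec_dotProduct_self (A : Mat) (v : Fin m → ℝ) :
    (A *ᵥ v) ⬝ᵥ (A *ᵥ v) = v ⬝ᵥ ((Aᵀ * A) *ᵥ v) := mulVec_dotProduct_mulVec A A v v

/-- Subadditivity of the trace of a concave power: for `S = Aᵀ A + Bᵀ B`, split `trace (S ^ t)` as
`trace (Aᵀ A S ^ (t - 1)) + trace (Bᵀ B S ^ (t - 1))` and apply `tracePow_weighted_le` to both. -/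
lemma tracePow_add_le (A B : Mat) {t : ℝ} (ht0 : 0 < t) (ht : t ≤ 1) :
    tracePow t (Aᵀ * A + Bᵀ * B) ≤ tracePow t (Aᵀ * A) + tracePow t (Bᵀ * B) := by
  have hS : (Aᵀ * A + Bᵀ * B).PosSemidef :=
    (posSemidef_transpose_mul_self A).add (posSemidef_transpose_mul_self B)
  set S := Aᵀ * A + Bᵀ * B with hSdef
  have hA : ∀ v : Fin m → ℝ, (A *ᵥ v) ⬝ᵥ (A *ᵥ v) ≤ 1 * (v ⬝ᵥ (S *ᵥ v)) := fun v => by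
    rw [one_mul, hSdef, Matrix.add_mulVec, dotProduct_add, ← mulVec_dotProduct_self,
      ← mulVec_dotProduct_self]
    linarith [dotProduct_self_nonneg' (B *ᵥ v)]
  have hB : ∀ v : Fin m → ℝ, (B *ᵥ v) ⬝ᵥ (B *ᵥ v) ≤ 1 * (v ⬝ᵥ (S *ᵥ v)) := fun v => by
    rw [one_mul, hSdef, Matrix.add_mulVec, dotProduct_add, ← mulVec_dotProduct_self,
      ← mulVec_dotProduct_self]
    linarith [dotProduct_self_nonneg' (A *ᵥ v)]
  have h1 := tracePow_weighted_le hS zero_le_one hA ht0 ht ht0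
  have h2 := tracePow_weighted_le hS zero_le_one hB ht0 ht ht0
  rw [div_self ht0.ne', Real.one_rpow, one_mul, tracePow_one (weighted_posSemidef _ hS _),
    trace_weighted, tracePow_mul_transpose_comm _ ht0] at h1 h2
  have h3 : tracePow t S = (S * psdPow S (t - 1)).trace := by
    rw [tracePow, mul_psdPow_sub_one hS ht0.ne']
  have h4 : (S * psdPow S (t - 1)).trace =
      (Aᵀ * A * psdPow S (t - 1)).trace + (Bᵀ * B * psdPow S (t - 1)).trace := by
    rw [← Matrix.trace_add, ← Matrix.add_mul]
  linarith

/-- McCarthy's inequality, the noncommutative Clarkson inequality for exponents at most `2`. -/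
lemma tracePow_add_sub_le (A B : Mat) {t : ℝ} (ht0 : 0 < t) (ht : t ≤ 1) :
    tracePow t ((A + B)ᵀ * (A + B)) + tracePow t ((A - B)ᵀ * (A - B)) ≤
      2 * (tracePow t (Aᵀ * A) + tracePow t (Bᵀ * B)) := by
  have hS : (Aᵀ * A + Bᵀ * B).PosSemidef :=
    (posSemidef_transpose_mul_self A).add (posSemidef_transpose_mul_self B)
  have hP := posSemidef_transpose_mul_self (A + B)
  have hQ := posSemidef_transpose_mul_self (A - B)
  refine le_trans ?_ (mul_le_mul_of_nonneg_left (tracePow_add_le A B ht0 ht) zero_le_two)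
  obtain ⟨V, hV, -, hT, -⟩ := exists_diag_tracePow hS
  refine (add_le_add (tracePow_le_sum_diag_rpow hP hV ht0 ht)
    (tracePow_le_sum_diag_rpow hQ hV ht0 ht)).trans ?_
  rw [hT, ← Finset.sum_add_distrib, Finset.mul_sum]
  refine Finset.sum_le_sum fun j _ => ?_
  have h1 := diag_nonneg (posSemidef_transpose_mul_mul hP V) j
  have h2 := diag_nonneg (posSemidef_transpose_mul_mul hQ V) j
  have h3 : (Vᵀ * ((A + B)ᵀ * (A + B)) * V) j j + (Vᵀ * ((A - B)ᵀ * (A - B)) * V) j j =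
      2 * (Vᵀ * (Aᵀ * A + Bᵀ * B) * V) j j := by
    rw [← Matrix.add_apply, ← Matrix.add_mul, ← Matrix.mul_add]
    have : (A + B)ᵀ * (A + B) + (A - B)ᵀ * (A - B) = (2 : ℝ) • (Aᵀ * A + Bᵀ * B) := by
      simp only [Matrix.transpose_add, Matrix.transpose_sub, Matrix.add_mul, Matrix.mul_add,
        Matrix.sub_mul, Matrix.mul_sub]
      module
    rw [this, Matrix.mul_smul, Matrix.smul_mul, Matrix.smul_apply, smul_eq_mul]
  have h4 := (Real.concaveOn_rpow ht0.le ht).right h1 h2 (show (0 : ℝ) ≤ 1 / 2 by norm_num)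
    (show (0 : ℝ) ≤ 1 / 2 by norm_num) (by norm_num)
  simp only [smul_eq_mul] at h4
  have h5 : 1 / 2 * (Vᵀ * ((A + B)ᵀ * (A + B)) * V) j j +
      1 / 2 * (Vᵀ * ((A - B)ᵀ * (A - B)) * V) j j = (Vᵀ * (Aᵀ * A + Bᵀ * B) * V) j j := by
    linarith
  rw [h5] at h4
  linarith

/-! ### Tangent inequalities for the trace of a power -/

/-- Concavity of the trace of a power: the tangent at `M` lies above. Since `t - 1` may be negative,
`M ^ (t - 1)` sees nothing of the kernel of `M`, whence the hypothesis `hker`. -/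
lemma tracePow_tangent_of_le_one {M N : Mat} (hM : M.PosSemidef) (hN : N.PosSemidef)
    (hker : ∀ v, M *ᵥ v = 0 → N *ᵥ v = 0) {t : ℝ} (ht0 : 0 < t) (ht : t ≤ 1) :
    tracePow t N ≤ tracePow t M + t * ((N - M) * psdPow M (t - 1)).trace := by
  obtain ⟨V, hV, h0, hT, hD⟩ := exists_diag_tracePow hM
  refine (tracePow_le_sum_diag_rpow hN hV ht0 ht).trans ?_
  rw [hT, trace_mul_psdPow hV (hD _), Finset.mul_sum, ← Finset.sum_add_distrib]
  refine Finset.sum_le_sum fun j _ => ?_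
  have h1 := diag_nonneg (posSemidef_transpose_mul_mul hN V) j
  have e : (Vᵀ * (N - M) * V) j j = (Vᵀ * N * V) j j - (Vᵀ * M * V) j j := by
    rw [Matrix.mul_sub, Matrix.sub_mul, Matrix.sub_apply]
  rw [e]
  set μ := (Vᵀ * M * V) j j
  set ν := (Vᵀ * N * V) j j with hν
  rcases (h0 j).eq_or_lt with hμ | hμ
  · -- the eigenvector lies in the common kernel
    have h2 : Vᵀ * M * V = Matrix.diagonal fun j => (Vᵀ * M * V) j j := by
      have := hD 1
      simpa only [psdPow_one hM, Real.rpow_one] using this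
    have h3 : M *ᵥ (V.col j) = 0 := by
      have hVV : V * Vᵀ = 1 := mul_eq_one_comm.1 hV
      have h4 : M * V = V * (Vᵀ * M * V) := by
        rw [← Matrix.mul_assoc, ← Matrix.mul_assoc, hVV, Matrix.one_mul]
      have h5 : (M * V).col j = 0 := by
        rw [h4, h2]
        ext i
        simp [Matrix.col, Matrix.mul_diagonal, ← hμ]
      ext i
      simpa [Matrix.col, Matrix.mul_apply, Matrix.mulVec, dotProduct] using congrFun h5 i
    have h6 := hker _ h3
    have h7 : ν = 0 := by
      have : (N * V).col j = 0 := by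
        ext i
        simpa [Matrix.col, Matrix.mul_apply, Matrix.mulVec, dotProduct] using congrFun h6 i
      rw [hν, Matrix.mul_assoc, Matrix.mul_apply]
      refine Finset.sum_eq_zero fun i _ => ?_
      have := congrFun this i
      simp only [Matrix.col, Matrix.transpose_apply, Pi.zero_apply] at this
      simp [this]
    have hμ0 : μ = 0 := hμ.symm
    rw [h7, hμ0]; simp
  · replace hμ : 0 < μ := hμ
    have hb := rpow_one_add_le_one_add_mul_self (s := ν / μ - 1)
      (by linarith [div_nonneg h1 hμ.le]) ht0.le ht
    rw [add_sub_cancel, Real.div_rpow h1 hμ.le, div_le_iff₀ (by positivity)] at hb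
    refine hb.trans_eq ?_
    rw [Real.rpow_sub_one hμ.ne']
    field_simp

/-- Convexity of the trace of a power, with the tangent taken at `N`: it bounds the increment from
`M` to `N` from above, as in `tracePow_tangent_of_le_one`. -/
lemma tracePow_tangent_of_one_le {M N : Mat} (hM : M.PosSemidef) (hN : N.PosSemidef)
    {t : ℝ} (ht : 1 < t) :
    tracePow t N ≤ tracePow t M + t * ((N - M) * psdPow N (t - 1)).trace := by
  obtain ⟨V, hV, h0, hT, hD⟩ := exists_diag_tracePow hN
  have hp := sum_diag_rpow_le_tracePow hM (isContraction_of_transpose_mul_self hV) ht.le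
  refine le_trans ?_ (add_le_add_left hp _)
  rw [hT, trace_mul_psdPow hV (hD _), Finset.mul_sum, ← Finset.sum_add_distrib]
  refine Finset.sum_le_sum fun j _ => ?_
  have h1 := diag_nonneg (posSemidef_transpose_mul_mul hM V) j
  have e : (Vᵀ * (N - M) * V) j j = (Vᵀ * N * V) j j - (Vᵀ * M * V) j j := by
    rw [Matrix.mul_sub, Matrix.sub_mul, Matrix.sub_apply]
  rw [e]
  have h2 := h0 j
  set μ := (Vᵀ * M * V) j j
  set ν := (Vᵀ * N * V) j j with hν
  rcases h2.eq_or_lt with hμ | hμ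
  · rw [← hμ, Real.zero_rpow (by linarith), Real.zero_rpow (by linarith)]
    simpa using Real.rpow_nonneg h1 t
  · have hb := one_add_mul_self_le_rpow_one_add (s := μ / ν - 1)
      (by linarith [div_nonneg h1 hμ.le]) ht.le
    rw [add_sub_cancel, Real.div_rpow h1 hμ.le, le_div_iff₀ (by positivity)] at hb
    rw [Real.rpow_sub_one hμ.ne']
    have : t * ((ν - μ) * (ν ^ t / ν)) = ν ^ t - (1 + t * (μ / ν - 1)) * ν ^ t := by
      field_simp; ring
    rw [this]
    linarith

end Matrices

section Matrices

variable {m : ℕ}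

local notation "Mat" => Matrix (Fin m) (Fin m) ℝ

/-! ### Singular value decomposition and Hölder's inequality -/

/-- Singular value decomposition; the columns of `F` that belong to the singular value `0` are set
to `0`, so that `F` is only a contraction. -/
lemma exists_svd (X : Mat) : ∃ (F E : Mat) (s : Fin m → ℝ), Eᵀ * E = 1 ∧ IsContraction F ∧
    (∀ j, 0 ≤ s j) ∧ X = F * Matrix.diagonal s * Eᵀ ∧ Fᵀ * X * E = Matrix.diagonal s ∧
    ∀ t, tracePow t (Xᵀ * X) = ∑ j, (s j ^ 2) ^ t := by
  have hX := posSemidef_transpose_mul_self X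
  obtain ⟨E, hE, h0, hT, hD⟩ := exists_diag_tracePow hX
  set r : Fin m → ℝ := fun j => (Eᵀ * (Xᵀ * X) * E) j j with hr
  set s : Fin m → ℝ := fun j => Real.sqrt (r j) with hs
  have hs2 : ∀ j, s j * s j = r j := fun j => Real.mul_self_sqrt (h0 j)
  have hD1 : Eᵀ * (Xᵀ * X) * E = Matrix.diagonal r := by
    have := hD 1
    simpa only [psdPow_one hX, Real.rpow_one] using this
  have hE' : E * Eᵀ = 1 := mul_eq_one_comm.1 hE
  set F : Mat := X * E * Matrix.diagonal fun j => (s j)⁻¹ with hF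
  have hFF : Fᵀ * F = Matrix.diagonal fun j => (s j)⁻¹ * r j * (s j)⁻¹ := by
    calc Fᵀ * F = Matrix.diagonal (fun j => (s j)⁻¹) * (Eᵀ * (Xᵀ * X) * E) *
          Matrix.diagonal (fun j => (s j)⁻¹) := by
          simp only [hF, Matrix.transpose_mul, Matrix.diagonal_transpose, Matrix.mul_assoc]
      _ = _ := by rw [hD1, Matrix.diagonal_mul_diagonal, Matrix.diagonal_mul_diagonal]
  have hXE : F * Matrix.diagonal s = X * E := by
    rw [hF, Matrix.mul_assoc, Matrix.diagonal_mul_diagonal]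
    ext i j
    rw [Matrix.mul_diagonal]
    by_cases hj : s j = 0
    · have h1 : ((X * E)ᵀ * (X * E)) j j = 0 := by
        have : (X * E)ᵀ * (X * E) = Matrix.diagonal r := by
          rw [← hD1]; simp only [Matrix.transpose_mul, Matrix.mul_assoc]
        rw [this, Matrix.diagonal_apply_eq, ← hs2, hj, mul_zero]
      rw [Matrix.mul_apply] at h1
      have := (Finset.sum_eq_zero_iff_of_nonneg fun i _ => by
        simpa using mul_self_nonneg _).1 h1 i (Finset.mem_univ _)
      have h2 : (X * E) i j = 0 := by simpa using this
      rw [h2, zero_mul]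
    · rw [inv_mul_cancel₀ hj, mul_one]
  refine ⟨F, E, s, hE, fun x => ?_, fun j => Real.sqrt_nonneg _, ?_, ?_, fun t => ?_⟩
  · rw [mulVec_dotProduct_self, hFF]
    simp only [dotProduct, Matrix.mulVec_diagonal]
    refine Finset.sum_le_sum fun j _ => ?_
    have : (s j)⁻¹ * r j * (s j)⁻¹ ≤ 1 := by
      rw [← hs2]
      by_cases hj : s j = 0
      · simp [hj]
      · field_simp; rfl
    nlinarith [mul_self_nonneg (x j)]
  · rw [hXE, Matrix.mul_assoc, hE', Matrix.mul_one]
  · rw [hF, Matrix.transpose_mul, Matrix.transpose_mul, Matrix.diagonal_transpose]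
    calc _ = Matrix.diagonal (fun j => (s j)⁻¹) * (Eᵀ * (Xᵀ * X) * E) := by
          simp only [Matrix.mul_assoc]
      _ = _ := by
          rw [hD1, Matrix.diagonal_mul_diagonal]
          congr 1
          ext j
          rw [← hs2]
          by_cases hj : s j = 0
          · simp [hj]
          · field_simp
  · rw [hT]
    exact Finset.sum_congr rfl fun j _ => by rw [sq, hs2]

lemma diag_transpose_mul_sq_le (P Q : Mat) (j : Fin m) :
    ((Pᵀ * Q) j j) ^ 2 ≤ (Pᵀ * P) j j * (Qᵀ * Q) j j := by
  simpa [Matrix.mul_apply, dotProduct] using dotProduct_sq_le (P.col j) (Q.col j)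

/-- Hölder's inequality for Schatten norms of exponents `2 a` and `2 b` that are at least `2`. -/
lemma tracePow_mul_le_of_one_le (X Y : Mat) {a b t : ℝ} (ha : 1 ≤ a) (hb : 1 ≤ b)
    (h : a.HolderTriple b t) :
    tracePow t ((X * Y)ᵀ * (X * Y)) ≤
      tracePow a (X * Xᵀ) ^ (t / a) * tracePow b (Yᵀ * Y) ^ (t / b) := by
  obtain ⟨F, E, s, hE, hF, hs, -, hd, hT⟩ := exists_svd (X * Y)
  have hX := posSemidef_mul_transpose_self X
  have hY := posSemidef_transpose_mul_self Y
  have h1 : ∀ j, s j ^ 2 ≤ (Fᵀ * (X * Xᵀ) * F) j j * (Eᵀ * (Yᵀ * Y) * E) j j := fun j => by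
    have := diag_transpose_mul_sq_le (Xᵀ * F) (Y * E) j
    have e : (Xᵀ * F)ᵀ * (Y * E) = Matrix.diagonal s := by
      rw [← hd]; simp only [Matrix.transpose_mul, Matrix.transpose_transpose, Matrix.mul_assoc]
    rw [e, Matrix.diagonal_apply_eq] at this
    simpa only [Matrix.transpose_mul, Matrix.transpose_transpose, Matrix.mul_assoc] using this
  have n1 := fun j => diag_nonneg (posSemidef_transpose_mul_mul hX F) j
  have n2 := fun j => diag_nonneg (posSemidef_transpose_mul_mul hY E) j
  have t0 := h.pos'
  rw [hT]
  calc _ ≤ ∑ j, ((Fᵀ * (X * Xᵀ) * F) j j * (Eᵀ * (Yᵀ * Y) * E) j j) ^ t :=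
        Finset.sum_le_sum fun j _ => Real.rpow_le_rpow (sq_nonneg _) (h1 j) t0.le
    _ ≤ _ := Real.Lr_rpow_le_Lp_mul_Lq_of_nonneg _ h (fun j _ => n1 j) fun j _ => n2 j
    _ ≤ _ := by
      have n1' := Finset.sum_nonneg fun j (_ : j ∈ Finset.univ) => Real.rpow_nonneg (n1 j) a
      have n2' := Finset.sum_nonneg fun j (_ : j ∈ Finset.univ) => Real.rpow_nonneg (n2 j) b
      gcongr
      · exact Real.rpow_nonneg (tracePow_nonneg hX _) _
      · exact sum_diag_rpow_le_tracePow hX hF ha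
      · exact sum_diag_rpow_le_tracePow hY (isContraction_of_transpose_mul_self hE) hb

lemma psdPow_half_mul_self {R : Mat} (hR : R.PosSemidef) :
    psdPow R (1 / 2) * psdPow R (1 / 2) = R := by
  rw [psdPow_mul hR (by norm_num), add_halves, psdPow_one hR]

lemma sandwich_posSemidef {R B : Mat} (hR : R.PosSemidef) (hB : B.PosSemidef) (a : ℝ) :
    (psdPow R a * B * psdPow R a).PosSemidef := by
  have := posSemidef_transpose_mul_mul hB (psdPow R a)
  rwa [psdPow_transpose hR] at this

lemma tracePow_sandwich_comm {R B : Mat} (hR : R.PosSemidef) (hB : B.PosSemidef) {t : ℝ}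
    (ht : 0 < t) : tracePow t (psdPow R (1 / 2) * B * psdPow R (1 / 2)) =
      tracePow t (psdPow B (1 / 2) * R * psdPow B (1 / 2)) := by
  have := tracePow_mul_transpose_comm (psdPow R (1 / 2) * psdPow B (1 / 2)) ht
  rw [Matrix.transpose_mul, psdPow_transpose hR, psdPow_transpose hB] at this
  have e : ∀ P Q : Mat, P * Q * (Q * P) = P * (Q * Q) * P := fun P Q => by
    simp only [Matrix.mul_assoc]
  rwa [e, e, psdPow_half_mul_self hB, psdPow_half_mul_self hR] at this

/-- For `t ≤ 1` Hölder's inequality is the scalar one in an eigenbasis of `R`, by Peierls'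
inequality. -/
lemma tracePow_sandwich_le_of_le_one {R B : Mat} (hR : R.PosSemidef) (hB : B.PosSemidef)
    {a b t : ℝ} (ht : t ≤ 1) (hb : 1 ≤ b) (h : a.HolderTriple b t) :
    tracePow t (psdPow R (1 / 2) * B * psdPow R (1 / 2)) ≤
      tracePow a R ^ (t / a) * tracePow b B ^ (t / b) := by
  obtain ⟨V, hV, h0, hT, hD⟩ := exists_diag_tracePow hR
  have hV' : V * Vᵀ = 1 := mul_eq_one_comm.1 hV
  refine (tracePow_le_sum_diag_rpow (sandwich_posSemidef hR hB _) hV h.pos' ht).trans ?_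
  have e : ∀ j, (Vᵀ * (psdPow R (1 / 2) * B * psdPow R (1 / 2)) * V) j j =
      (Vᵀ * R * V) j j * (Vᵀ * B * V) j j := fun j => by
    have : Vᵀ * (psdPow R (1 / 2) * B * psdPow R (1 / 2)) * V =
        (Vᵀ * psdPow R (1 / 2) * V) * (Vᵀ * B * V) * (Vᵀ * psdPow R (1 / 2) * V) := by
      calc _ = Vᵀ * psdPow R (1 / 2) * 1 * B * 1 * psdPow R (1 / 2) * V := by
            simp only [Matrix.mul_assoc, Matrix.one_mul]
        _ = _ := by rw [← hV']; simp only [Matrix.mul_assoc]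
    rw [this, hD, Matrix.mul_diagonal, Matrix.diagonal_mul, mul_right_comm,
      ← Real.rpow_add_of_nonneg (h0 j) (by norm_num) (by norm_num), add_halves, Real.rpow_one]
  have n2 := fun j => diag_nonneg (posSemidef_transpose_mul_mul hB V) j
  simp only [e]
  refine (Real.Lr_rpow_le_Lp_mul_Lq_of_nonneg _ h (fun j _ => h0 j) fun j _ => n2 j).trans ?_
  have n1' := Finset.sum_nonneg fun j (_ : j ∈ Finset.univ) => Real.rpow_nonneg (h0 j) a
  have n2' := Finset.sum_nonneg fun j (_ : j ∈ Finset.univ) => Real.rpow_nonneg (n2 j) b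
  have t0 := h.pos'
  have b0 : 0 < b := by linarith
  rw [hT]
  gcongr
  exact sum_diag_rpow_le_tracePow hB (isContraction_of_transpose_mul_self hV) hb

/-- Hölder's inequality for Schatten norms, in the form `‖Y R ^ (1 / 2)‖` with `B = Yᵀ Y`. For
`1 / 2 ≤ t` at most one of `a` and `b` is below `1`, and `t ≤ 1` if one of them is. -/
lemma tracePow_sandwich_le {R B : Mat} (hR : R.PosSemidef) (hB : B.PosSemidef)
    {a b t : ℝ} (ht : 1 / 2 ≤ t) (h : a.HolderTriple b t) :
    tracePow t (psdPow R (1 / 2) * B * psdPow R (1 / 2)) ≤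
      tracePow a R ^ (t / a) * tracePow b B ^ (t / b) := by
  have t0 := h.pos'
  have hinv : t⁻¹ ≤ 2 := by
    rw [inv_le_comm₀ t0 two_pos]; linarith
  have ha0 := h.pos
  have hb0 := h.symm.pos
  have hsum := h.inv_add_inv_eq_inv
  by_cases ha : 1 ≤ a
  · by_cases hb : 1 ≤ b
    · have := tracePow_mul_le_of_one_le (psdPow B (1 / 2)) (psdPow R (1 / 2)) hb ha h.symm
      rw [psdPow_transpose hB, psdPow_half_mul_self hB, Matrix.transpose_mul,
        psdPow_transpose hR, psdPow_transpose hB, psdPow_half_mul_self hR, Matrix.mul_assoc,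
        ← Matrix.mul_assoc (psdPow B _), psdPow_half_mul_self hB, ← Matrix.mul_assoc,
        mul_comm] at this
      exact this
    · push Not at hb
      have h1 : 1 ≤ b⁻¹ := (one_le_inv₀ hb0).2 hb.le
      have h2 : t ≤ 1 := by
        rw [← inv_inv t]
        exact inv_le_one_of_one_le₀ (by rw [← hsum]; linarith [inv_pos.2 ha0])
      rw [tracePow_sandwich_comm hR hB t0, mul_comm]
      exact tracePow_sandwich_le_of_le_one hB hR h2 ha h.symm
  · push Not at ha
    have h1 : 1 ≤ a⁻¹ := (one_le_inv₀ ha0).2 ha.le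
    have h2 : t ≤ 1 := by
      rw [← inv_inv t]
      exact inv_le_one_of_one_le₀ (by rw [← hsum]; linarith [inv_pos.2 hb0])
    have h3 : 1 ≤ b := by
      rw [← inv_inv b]
      exact (one_le_inv₀ (inv_pos.2 hb0)).2 (by linarith)
    exact tracePow_sandwich_le_of_le_one hR hB h2 h3 h

/-- Hölder's inequality for `trace (C M ^ (t - 1))`. -/
lemma trace_mul_psdPow_le {C M : Mat} (hC : C.PosSemidef) (hM : M.PosSemidef) {t : ℝ}
    (ht : 1 < t) : (C * psdPow M (t - 1)).trace ≤
      tracePow t C ^ (1 / t) * tracePow t M ^ (1 - 1 / t) := by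
  obtain ⟨V, hV, h0, hT, hD⟩ := exists_diag_tracePow hM
  rw [trace_mul_psdPow hV (hD _), hT]
  have hpq : t.HolderConjugate (t / (t - 1)) := Real.HolderConjugate.conjExponent ht
  have n := fun j => diag_nonneg (posSemidef_transpose_mul_mul hC V) j
  have t0 : 0 < t := by linarith
  have t1 : 0 < t - 1 := by linarith
  refine (Real.inner_le_Lp_mul_Lq_of_nonneg _ hpq (fun j _ => n j)
    fun j _ => Real.rpow_nonneg (h0 j) _).trans ?_
  have e : ∀ j, (((Vᵀ * M * V) j j) ^ (t - 1)) ^ (t / (t - 1)) = ((Vᵀ * M * V) j j) ^ t :=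
    fun j => by rw [← Real.rpow_mul (h0 j), mul_div_cancel₀ _ t1.ne']
  simp only [e]
  have e2 : 1 / (t / (t - 1)) = 1 - 1 / t := by field_simp
  rw [e2]
  have n1 := Finset.sum_nonneg fun j (_ : j ∈ Finset.univ) => Real.rpow_nonneg (n j) t
  have n2 := Finset.sum_nonneg fun j (_ : j ∈ Finset.univ) => Real.rpow_nonneg (h0 j) t
  gcongr
  exact sum_diag_rpow_le_tracePow hC (isContraction_of_transpose_mul_self hV) ht.le

end Matrices

section Matrices

variable {m : ℕ}

local notation "Mat" => Matrix (Fin m) (Fin m) ℝ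

/-! ### Continuity and homogeneity of the functional calculus -/

lemma abs_entry_le_one {U : Mat} (hU : Uᵀ * U = 1) (i j : Fin m) : |U i j| ≤ 1 := by
  rw [← sq_le_one_iff_abs_le_one, ← sum_sq_eq_one hU j]
  exact Finset.single_le_sum (f := fun i => U i j ^ 2) (fun _ _ => sq_nonneg _) (Finset.mem_univ i)

/-- The functional calculus by a continuous function on `[0, ∞)` is continuous on positive
semidefinite matrices: the eigenvalues stay locally bounded, and there `g` is a uniform limit of
polynomials. -/
lemma continuous_cfc {X : Type*} [TopologicalSpace X] {N : X → Mat} (hN : Continuous N)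
    (hpsd : ∀ x, (N x).PosSemidef) {g : ℝ → ℝ} (hg : ContinuousOn g (Set.Ici 0)) :
    Continuous fun x => cfc g (N x) := by
  refine continuous_matrix fun i j => continuous_iff_continuousAt.2 fun x₀ => ?_
  refine continuousAt_of_locally_uniform_approx_of_continuousAt fun u hu => ?_
  obtain ⟨ε, hε, hu⟩ := Metric.mem_uniformity_dist.1 hu
  -- approximate `g` by a polynomial on an interval that contains all nearby eigenvalues
  set R := (N x₀).trace + 1
  obtain ⟨P, hP⟩ := exists_polynomial_near_of_continuousOn 0 R g
    (hg.mono Set.Icc_subset_Ici_self) (ε / (m + 1)) (by positivity)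
  have htr : Continuous fun x => (N x).trace := hN.matrix_trace
  refine ⟨{x | (N x).trace < R}, (isOpen_lt htr continuous_const).mem_nhds (by simp [R]),
    fun x => (Polynomial.aeval (N x) P) i j, ?_, fun x hx => hu ?_⟩
  · have : Continuous fun x => Polynomial.aeval (N x) P := by
      simp only [Polynomial.aeval_eq_sum_range]
      fun_prop
    exact (this.matrix_elem i j).continuousAt
  · change dist (cfc g (N x) i j) ((Polynomial.aeval (N x) P : Mat) i j) < ε
    obtain ⟨U, d, hU, hU', hd, hN', hf⟩ := exists_diag (hpsd x)
    have hdR : ∀ l, d l ≤ R := fun l => by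
      have : (N x).trace = ∑ l, d l := by
        conv_lhs => rw [hN', trace_conj' hU, Matrix.trace_diagonal]
      refine (Finset.single_le_sum (fun l _ => hd l) (Finset.mem_univ l)).trans ?_
      rw [← this]
      exact le_of_lt hx
    rw [← cfc_polynomial P (N x) (hpsd x).isHermitian.isSelfAdjoint, hf, hf, Real.dist_eq]
    have e : ∀ f : ℝ → ℝ, (U * Matrix.diagonal (fun i => f (d i)) * Uᵀ) i j =
        ∑ l, U i l * U j l * f (d l) := fun f => by
      rw [Matrix.mul_apply]
      simp only [Matrix.mul_diagonal, Matrix.transpose_apply]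
      exact Finset.sum_congr rfl fun l _ => by ring
    rw [e, e fun y => P.eval y, ← Finset.sum_sub_distrib]
    have hle : |∑ l, (U i l * U j l * g (d l) - U i l * U j l * P.eval (d l))| ≤
        ∑ _l : Fin m, ε / (m + 1) := by
      refine (Finset.abs_sum_le_sum_abs _ _).trans (Finset.sum_le_sum fun l _ => ?_)
      rw [← mul_sub, abs_mul, abs_mul, abs_sub_comm]
      have h1 := abs_entry_le_one hU i l
      have h2 := abs_entry_le_one hU j l
      have h3 := (hP (d l) ⟨hd l, hdR l⟩).le
      calc _ ≤ 1 * 1 * (ε / (m + 1)) := by gcongr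
        _ = _ := by ring
    refine hle.trans_lt ?_
    rw [Finset.sum_const, Finset.card_univ, Fintype.card_fin, nsmul_eq_mul, ← mul_div_assoc,
      div_lt_iff₀ (by positivity)]
    nlinarith

lemma continuous_psdPow {X : Type*} [TopologicalSpace X] {N : X → Mat} (hN : Continuous N)
    (hpsd : ∀ x, (N x).PosSemidef) {t : ℝ} (ht : 0 ≤ t) :
    Continuous fun x => psdPow (N x) t :=
  continuous_cfc hN hpsd (Real.continuous_rpow_const ht).continuousOn

lemma tracePow_smul {M : Mat} (hM : M.PosSemidef) {c : ℝ} (hc : 0 ≤ c) (t : ℝ) :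
    tracePow t (c • M) = c ^ t * tracePow t M := by
  have hfin := M.finite_real_spectrum
  have h1 := cfc_comp_smul c (fun x : ℝ => x ^ t) M ((hfin.image _).continuousOn _)
    hM.isHermitian.isSelfAdjoint
  have h2 : cfc (fun x : ℝ => (c • x) ^ t) M = cfc (fun x : ℝ => c ^ t * x ^ t) M := by
    refine cfc_congr fun x hx => ?_
    rw [hM.isHermitian.spectrum_real_eq_range_eigenvalues] at hx
    obtain ⟨i, rfl⟩ := hx
    simp only [smul_eq_mul, Real.mul_rpow hc (hM.eigenvalues_nonneg i)]
  rw [tracePow, tracePow, psdPow, psdPow, ← h1, h2, cfc_const_mul _ _ _ (hfin.continuousOn _),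
    Matrix.trace_smul, smul_eq_mul]

lemma tracePow_pos {M : Mat} (hM : M.PosSemidef) (h0 : M ≠ 0) (t : ℝ) : 0 < tracePow t M := by
  obtain ⟨V, hV, h0', hT, hD⟩ := exists_diag_tracePow hM
  rw [hT]
  refine Finset.sum_pos' (fun j _ => Real.rpow_nonneg (h0' j) _) ?_
  by_contra! h
  apply h0
  have hV' : V * Vᵀ = 1 := mul_eq_one_comm.1 hV
  have h1 : Vᵀ * M * V = 0 := by
    have := hD 1
    simp only [psdPow_one hM, Real.rpow_one] at this
    rw [this]
    ext i j
    rw [Matrix.diagonal_apply]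
    split_ifs
    · by_contra h2
      exact (h i (Finset.mem_univ _)).not_gt
        (Real.rpow_pos_of_pos ((h0' i).lt_of_ne (Ne.symm h2)) _)
    · rfl
  calc M = (V * Vᵀ) * M * (V * Vᵀ) := by simp [hV']
    _ = V * (Vᵀ * M * V) * Vᵀ := by simp only [Matrix.mul_assoc]
    _ = 0 := by simp [h1]

/-! ### Existence of a Lewis basis -/

variable {k : ℕ}

/-- The tuple obtained from `T` by the linear substitution with coefficient matrix `A`. -/
def comb (A : Matrix (Fin k) (Fin k) ℝ) (T : Fin k → Mat) : Fin k → Mat :=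
  fun i => ∑ j, A i j • T j

lemma comb_one (T : Fin k → Mat) : comb 1 T = T := by
  ext i : 1
  simp [comb, Matrix.one_apply]

lemma comb_mul (A B : Matrix (Fin k) (Fin k) ℝ) (T : Fin k → Mat) :
    comb (A * B) T = comb A (comb B T) := by
  ext i : 1
  simp only [comb, Matrix.mul_apply, Finset.sum_smul, Finset.smul_sum, smul_smul]
  rw [Finset.sum_comm]

lemma comb_mem_span (A : Matrix (Fin k) (Fin k) ℝ) (T : Fin k → Mat) (i : Fin k) :
    comb A T i ∈ Submodule.span ℝ (Set.range T) :=
  Submodule.sum_mem _ fun j _ => Submodule.smul_mem _ _ (Submodule.subset_span ⟨j, rfl⟩)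

lemma span_comb {A : Matrix (Fin k) (Fin k) ℝ} (hA : A.det ≠ 0) (T : Fin k → Mat) :
    Submodule.span ℝ (Set.range (comb A T)) = Submodule.span ℝ (Set.range T) := by
  refine le_antisymm (Submodule.span_le.2 ?_) (Submodule.span_le.2 ?_)
  · rintro _ ⟨i, rfl⟩
    exact comb_mem_span A T i
  · rintro _ ⟨i, rfl⟩
    have h : comb A⁻¹ (comb A T) = T := by
      rw [← comb_mul, Matrix.nonsing_inv_mul A (isUnit_iff_ne_zero.2 hA), comb_one]
    have h' := comb_mem_span A⁻¹ (comb A T) i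
    rwa [h] at h'

lemma linearIndependent_of_span_eq {S T : Fin k → Mat} (hS : LinearIndependent ℝ S)
    (h : Submodule.span ℝ (Set.range T) = Submodule.span ℝ (Set.range S)) :
    LinearIndependent ℝ T := by
  rw [linearIndependent_iff_card_eq_finrank_span, Set.finrank, h]
  exact linearIndependent_iff_card_eq_finrank_span.1 hS

/-- The matrix `∑ X j l • (T j)ᵀ (T l)`, which is `gramSum (comb B T)` for `X = Bᵀ B`. -/
def gramForm (T : Fin k → Mat) (X : Matrix (Fin k) (Fin k) ℝ) : Mat :=
  ∑ j, ∑ l, X j l • ((T j)ᵀ * T l)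

lemma gramSum_comb (B : Matrix (Fin k) (Fin k) ℝ) (T : Fin k → Mat) :
    gramSum (comb B T) = gramForm T (Bᵀ * B) := by
  simp only [gramSum, gramForm, comb, Matrix.transpose_sum, Matrix.transpose_smul, Matrix.sum_mul,
    Matrix.mul_sum, Matrix.smul_mul, Matrix.mul_smul, Matrix.mul_apply, Finset.sum_smul,
    Matrix.transpose_apply, Finset.smul_sum, smul_smul]
  rw [Finset.sum_comm]
  conv_rhs => rw [Finset.sum_comm]
  refine Finset.sum_congr rfl fun l _ => ?_
  rw [Finset.sum_comm]
  exact Finset.sum_congr rfl fun j _ => Finset.sum_congr rfl fun i _ => by rw [mul_comm]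

lemma gramForm_add (T : Fin k → Mat) (X Y : Matrix (Fin k) (Fin k) ℝ) :
    gramForm T (X + Y) = gramForm T X + gramForm T Y := by
  simp [gramForm, add_smul, Finset.sum_add_distrib]

lemma gramForm_smul (T : Fin k → Mat) (c : ℝ) (X : Matrix (Fin k) (Fin k) ℝ) :
    gramForm T (c • X) = c • gramForm T X := by
  simp [gramForm, Finset.smul_sum, smul_smul]

lemma gramForm_one (T : Fin k → Mat) : gramForm T 1 = gramSum T := by
  rw [← comb_one T, gramSum_comb, comb_one]; simp

lemma gramSum_posSemidef (T : Fin k → Mat) : (gramSum T).PosSemidef :=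
  Matrix.posSemidef_sum _ fun i _ => posSemidef_transpose_mul_self (T i)

lemma gramSum_quadratic (T : Fin k → Mat) (v : Fin m → ℝ) :
    v ⬝ᵥ (gramSum T *ᵥ v) = ∑ i, (T i *ᵥ v) ⬝ᵥ (T i *ᵥ v) := by
  simp only [gramSum, Matrix.sum_mulVec, dotProduct_sum, mulVec_dotProduct_self]

lemma mulVec_eq_zero_of_gramSum {T : Fin k → Mat} {v : Fin m → ℝ} (h : gramSum T *ᵥ v = 0)
    (i : Fin k) : T i *ᵥ v = 0 := by
  have h1 := gramSum_quadratic T v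
  rw [h, dotProduct_zero] at h1
  have := (Finset.sum_eq_zero_iff_of_nonneg fun i _ => dotProduct_self_nonneg' (T i *ᵥ v)).1
    h1.symm i (Finset.mem_univ _)
  exact dotProduct_self_eq_zero.1 this

lemma gramSum_ne_zero {T : Fin k → Mat} {i : Fin k} (h : T i ≠ 0) : gramSum T ≠ 0 := by
  intro h0
  apply h
  have h1 : ∀ v, T i *ᵥ v = 0 := fun v => mulVec_eq_zero_of_gramSum (by rw [h0]; simp) i
  ext a b
  simpa [Matrix.mulVec_single] using congrFun (h1 (Pi.single b 1)) a

lemma gramSum_smul (T : Fin k → Mat) (c : ℝ) :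
    gramSum (fun i => c • T i) = c ^ 2 • gramSum T := by
  simp only [gramSum, Matrix.transpose_smul, Matrix.smul_mul, Matrix.mul_smul, smul_smul,
    Finset.smul_sum, sq]

lemma comb_smul (A : Matrix (Fin k) (Fin k) ℝ) (T : Fin k → Mat) (c : ℝ) :
    comb (c • A) T = fun i => c • comb A T i := by
  ext i : 1
  simp [comb, Finset.smul_sum, smul_smul]

lemma comb_smul_right (A : Matrix (Fin k) (Fin k) ℝ) (T : Fin k → Mat) (c : ℝ) :
    comb A (fun i => c • T i) = fun i => c • comb A T i := by
  ext i : 1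
  simp only [comb, Finset.smul_sum]
  exact Finset.sum_congr rfl fun j _ => smul_comm _ _ _

lemma continuous_gramSum_comb (T : Fin k → Mat) :
    Continuous fun A : Matrix (Fin k) (Fin k) ℝ => gramSum (comb A T) := by
  unfold gramSum comb
  fun_prop

/-- The extremal problem: up to scaling, `comb A S` minimises the trace of a power of its Gram sum
for a given determinant of `A`. The quotient `|det A| ^ (2 t / k) / trace (gramSum (comb A S) ^ t)`
is homogeneous of degree `0`, so it has a maximum, attained on the unit sphere. -/
lemma exists_extremal [NeZero k] {S : Fin k → Mat} (hS : LinearIndependent ℝ S) {t : ℝ}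
    (ht : 0 < t) : ∃ A : Matrix (Fin k) (Fin k) ℝ, A.det ≠ 0 ∧
      ∀ B : Matrix (Fin k) (Fin k) ℝ, 1 ≤ |B.det| →
        tracePow t (gramSum (comb A S)) ≤ tracePow t (gramSum (comb (B * A) S)) := by
  have k0 : (k : ℝ) ≠ 0 := Nat.cast_ne_zero.2 (NeZero.ne k)
  have kpos : (0 : ℝ) < k := lt_of_le_of_ne k.cast_nonneg k0.symm
  set τ : (Fin k → Fin k → ℝ) → ℝ := fun A => tracePow t (gramSum (comb (Matrix.of A) S)) with hτ
  set δ : (Fin k → Fin k → ℝ) → ℝ := fun A => |(Matrix.of A).det| ^ (2 * t / k) with hδ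
  have hτc : Continuous τ :=
    (continuous_psdPow (continuous_gramSum_comb S) (fun A => gramSum_posSemidef _) ht.le).matrix_trace
  have hδc : Continuous δ := by
    have : Continuous fun A : Fin k → Fin k → ℝ => (Matrix.of A).det :=
      Continuous.matrix_det continuous_id
    exact (continuous_abs.comp this).rpow_const fun _ => Or.inr (by positivity)
  have hτpos : ∀ A, A ≠ 0 → 0 < τ A := fun A hA => by
    obtain ⟨i, hi⟩ : ∃ i, A i ≠ 0 := by
      by_contra! h; exact hA (funext h)
    refine tracePow_pos (gramSum_posSemidef _) (gramSum_ne_zero (i := i) fun h => hi ?_) t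
    ext j
    exact (Fintype.linearIndependent_iff.1 hS) (A i) h j
  have hτs : ∀ (c : ℝ) A, τ (c • A) = (c ^ 2) ^ t * τ A := fun c A => by
    have h1 : Matrix.of (c • A) = c • Matrix.of A := rfl
    simp only [hτ]
    rw [h1, comb_smul, gramSum_smul, tracePow_smul (gramSum_posSemidef _) (sq_nonneg _)]
  have hδs : ∀ (c : ℝ), 0 ≤ c → ∀ A, δ (c • A) = (c ^ 2) ^ t * δ A := fun c hc A => by
    have h1 : Matrix.of (c • A) = c • Matrix.of A := rfl
    simp only [hδ]
    rw [h1, Matrix.det_smul, abs_mul, Real.mul_rpow (abs_nonneg _) (abs_nonneg _),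
      Fintype.card_fin, abs_pow, abs_of_nonneg hc, ← Real.rpow_natCast, ← Real.rpow_natCast,
      ← Real.rpow_mul hc, ← Real.rpow_mul hc]
    congr 2
    field_simp
    norm_num
  obtain ⟨A₀, hA₀, hmax⟩ := (isCompact_sphere (0 : Fin k → Fin k → ℝ) 1).exists_isMaxOn
    (NormedSpace.sphere_nonempty.2 zero_le_one) (f := fun A => δ A / τ A)
    (hδc.continuousOn.div hτc.continuousOn fun A hA =>
      (hτpos A (ne_zero_of_mem_unit_sphere (⟨A, hA⟩ : Metric.sphere _ _))).ne')
  have hA₀0 : A₀ ≠ 0 := ne_zero_of_mem_unit_sphere (⟨A₀, hA₀⟩ : Metric.sphere _ _)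
  have hglob : ∀ A, A ≠ 0 → δ A * τ A₀ ≤ δ A₀ * τ A := fun A hA => by
    have hn : 0 < ‖A‖ := norm_pos_iff.2 hA
    have h1 := hmax (show ‖A‖⁻¹ • A ∈ Metric.sphere (0 : Fin k → Fin k → ℝ) 1 by
      simp [norm_smul, hn.ne'])
    have hc : 0 < ((‖A‖⁻¹ ^ 2) ^ t) := by positivity
    simp only [Set.mem_ofPred_eq] at h1
    rw [hτs, hδs _ (by positivity), mul_div_mul_left _ _ hc.ne',
      div_le_div_iff₀ (hτpos A hA) (hτpos _ hA₀0)] at h1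
    exact h1
  have hdet : (Matrix.of A₀).det ≠ 0 := by
    intro h0
    have h1 : ((1 : Matrix (Fin k) (Fin k) ℝ) : Fin k → Fin k → ℝ) ≠ 0 :=
      one_ne_zero (α := Matrix (Fin k) (Fin k) ℝ)
    have h2 := hglob (1 : Matrix (Fin k) (Fin k) ℝ) h1
    have h3 : δ (1 : Matrix (Fin k) (Fin k) ℝ) = 1 := by
      have : Matrix.of ((1 : Matrix (Fin k) (Fin k) ℝ) : Fin k → Fin k → ℝ) = 1 := rfl
      simp only [hδ, this, Matrix.det_one, abs_one, Real.one_rpow]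
    have h4 : δ A₀ = 0 := by
      simp only [hδ, h0, abs_zero]
      exact Real.zero_rpow (by positivity)
    rw [h3, h4, zero_mul, one_mul] at h2
    exact h2.not_gt (hτpos _ hA₀0)
  refine ⟨Matrix.of A₀, hdet, fun B hB => ?_⟩
  have hBA : ((B * Matrix.of A₀ : Matrix (Fin k) (Fin k) ℝ) : Fin k → Fin k → ℝ) ≠ 0 := by
    intro h
    have h1 : (B * Matrix.of A₀) = 0 := h
    have h2 : B.det * (Matrix.of A₀).det = 0 := by
      rw [← Matrix.det_mul, h1, Matrix.det_zero]
    rcases mul_eq_zero.1 h2 with h3 | h3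
    · rw [h3] at hB; norm_num at hB
    · exact hdet h3
  have h1 := hglob _ hBA
  have h2 : δ A₀ ≤ δ (B * Matrix.of A₀ : Matrix (Fin k) (Fin k) ℝ) := by
    simp only [hδ]
    refine Real.rpow_le_rpow (abs_nonneg _) ?_ (by positivity)
    change _ ≤ |(B * Matrix.of A₀).det|
    rw [Matrix.det_mul, abs_mul]
    exact le_mul_of_one_le_left (abs_nonneg _) hB
  have h3 : 0 < δ A₀ := Real.rpow_pos_of_pos (abs_pos.2 hdet) _
  have h4 : δ A₀ * τ A₀ ≤ δ A₀ * τ (B * Matrix.of A₀ : Matrix (Fin k) (Fin k) ℝ) :=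
    (mul_le_mul_of_nonneg_right h2 (hτpos _ hA₀0).le).trans h1
  exact le_of_mul_le_mul_left h4 h3

end Matrices

section Matrices

variable {m k : ℕ}

local notation "Mat" => Matrix (Fin m) (Fin m) ℝ

/-- The Gram matrix of `T` for the bilinear form with weight `M ^ (t - 1)`, `M = gramSum T`. -/
noncomputable def lewisGram (t : ℝ) (T : Fin k → Mat) : Matrix (Fin k) (Fin k) ℝ :=
  Matrix.of fun j l => ((T j)ᵀ * T l * psdPow (gramSum T) (t - 1)).trace

lemma lewisGram_symm (t : ℝ) (T : Fin k → Mat) (j l : Fin k) :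
    lewisGram t T j l = lewisGram t T l j := by
  simp only [lewisGram, Matrix.of_apply]
  rw [← Matrix.trace_transpose, Matrix.transpose_mul, Matrix.transpose_mul,
    Matrix.transpose_transpose, psdPow_transpose (gramSum_posSemidef T), Matrix.trace_mul_comm]

lemma trace_gramForm_mul (t : ℝ) (T : Fin k → Mat) (X : Matrix (Fin k) (Fin k) ℝ) :
    (gramForm T X * psdPow (gramSum T) (t - 1)).trace = ∑ j, ∑ l, X j l * lewisGram t T j l := by
  simp [gramForm, lewisGram, Matrix.sum_mul, Matrix.trace_sum, Matrix.trace_smul]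

lemma sum_lewisGram_diag {t : ℝ} (ht : t ≠ 0) (T : Fin k → Mat) :
    ∑ j, lewisGram t T j j = tracePow t (gramSum T) := by
  have h := trace_gramForm_mul t T 1
  rw [gramForm_one] at h
  rw [tracePow, ← mul_psdPow_sub_one (gramSum_posSemidef T) ht, h]
  simp [Matrix.one_apply]

/-- First-order upper bound for the trace of a power of the Gram sum along `1 + ε • E`. It comes
from the tangent inequalities, so no differentiability of the functional calculus is needed. -/
lemma exists_first_order {t : ℝ} (ht : 0 < t) (T : Fin k → Mat) {E : Matrix (Fin k) (Fin k) ℝ}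
    (hE : Eᵀ = E) : ∃ φ : ℝ → ℝ, Continuous φ ∧
      φ 0 = 2 * ∑ j, ∑ l, E j l * lewisGram t T j l ∧
      ∀ ε, tracePow t (gramSum (comb (1 + ε • E) T)) ≤
        tracePow t (gramSum T) + t * (ε * φ ε) := by
  have hM := gramSum_posSemidef T
  set H : ℝ → Mat := fun ε => gramForm T ((2 : ℝ) • E + ε • (E * E)) with hH
  have hHc : Continuous H := by
    have : H = fun ε : ℝ => gramForm T ((2 : ℝ) • E) + ε • gramForm T (E * E) := by
      ext1 ε
      rw [hH, ← gramForm_smul, ← gramForm_add]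
    rw [this]
    fun_prop
  have hN : ∀ ε : ℝ, gramSum (comb (1 + ε • E) T) - gramSum T = ε • H ε := fun ε => by
    have : (1 + ε • E)ᵀ * (1 + ε • E) = 1 + ε • ((2 : ℝ) • E + ε • (E * E)) := by
      rw [Matrix.transpose_add, Matrix.transpose_smul, hE, Matrix.transpose_one, Matrix.add_mul,
        Matrix.mul_add, Matrix.mul_add, Matrix.one_mul, Matrix.one_mul, Matrix.mul_one,
        Matrix.smul_mul, Matrix.mul_smul]
      module
    rw [gramSum_comb, this, gramForm_add, gramForm_one, add_sub_cancel_left, gramForm_smul]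
  have h0 : (H 0 * psdPow (gramSum T) (t - 1)).trace =
      2 * ∑ j, ∑ l, E j l * lewisGram t T j l := by
    simp only [hH]
    rw [zero_smul, add_zero, gramForm_smul, Matrix.smul_mul, Matrix.trace_smul,
      trace_gramForm_mul, smul_eq_mul]
  rcases le_or_gt t 1 with ht1 | ht1
  · refine ⟨fun ε => (H ε * psdPow (gramSum T) (t - 1)).trace, ?_, h0, fun ε => ?_⟩
    · exact (hHc.matrix_mul continuous_const).matrix_trace
    · have hker : ∀ v, gramSum T *ᵥ v = 0 → gramSum (comb (1 + ε • E) T) *ᵥ v = 0 :=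
        fun v hv => by
          have h1 := mulVec_eq_zero_of_gramSum hv
          have h2 : ∀ i, comb (1 + ε • E) T i *ᵥ v = 0 := fun i => by
            simp [comb, Matrix.sum_mulVec, Matrix.smul_mulVec, h1]
          simp only [gramSum, Matrix.sum_mulVec, ← Matrix.mulVec_mulVec, h2, Matrix.mulVec_zero,
            Finset.sum_const_zero]
      have := tracePow_tangent_of_le_one hM (gramSum_posSemidef (comb (1 + ε • E) T)) hker ht ht1
      rwa [hN, Matrix.smul_mul, Matrix.trace_smul, smul_eq_mul] at this
  · have hNc : Continuous fun ε : ℝ => gramSum (comb (1 + ε • E) T) :=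
      (continuous_gramSum_comb T).comp (by fun_prop)
    refine ⟨fun ε => (H ε * psdPow (gramSum (comb (1 + ε • E) T)) (t - 1)).trace, ?_, ?_,
      fun ε => ?_⟩
    · exact (hHc.matrix_mul (continuous_psdPow hNc (fun _ => gramSum_posSemidef _)
        (by linarith))).matrix_trace
    · rw [← h0]; simp [comb_one]
    · have := tracePow_tangent_of_one_le hM (gramSum_posSemidef (comb (1 + ε • E) T)) ht1
      rwa [hN, Matrix.smul_mul, Matrix.trace_smul, smul_eq_mul] at this

lemma eventually_one_le_det {E : Matrix (Fin k) (Fin k) ℝ} (hE : 0 < E.trace) :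
    ∀ᶠ ε in 𝓝[>] (0 : ℝ), 1 ≤ (1 + ε • E).det := by
  set q : Polynomial ℝ :=
    (Matrix.det (1 + (Polynomial.X : Polynomial ℝ) • E.map Polynomial.C)).divX.divX
  have hc : Continuous fun ε : ℝ => E.trace + q.eval ε * ε := by fun_prop
  have h1 : ∀ᶠ ε in 𝓝 (0 : ℝ), 0 < E.trace + q.eval ε * ε :=
    hc.continuousAt.eventually (lt_mem_nhds (by simpa using hE))
  filter_upwards [nhdsWithin_le_nhds h1, self_mem_nhdsWithin] with ε h2 h3
  rw [Matrix.det_one_add_smul]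
  nlinarith [mul_pos (Set.mem_Ioi.1 h3) h2]

/-- First-order condition at the extremum. -/
lemma sum_mul_lewisGram_nonneg {t : ℝ} (ht : 0 < t) {T : Fin k → Mat}
    (hT : ∀ B : Matrix (Fin k) (Fin k) ℝ, 1 ≤ |B.det| →
      tracePow t (gramSum T) ≤ tracePow t (gramSum (comb B T)))
    {E : Matrix (Fin k) (Fin k) ℝ} (hE : Eᵀ = E) (htr : 0 < E.trace) :
    0 ≤ ∑ j, ∑ l, E j l * lewisGram t T j l := by
  by_contra! hneg
  obtain ⟨φ, hφ, hφ0, hle⟩ := exists_first_order ht T hE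
  have h1 : ∀ᶠ ε in 𝓝[>] (0 : ℝ), φ ε < 0 := nhdsWithin_le_nhds
    (hφ.continuousAt.eventually (gt_mem_nhds (by rw [hφ0]; linarith)))
  obtain ⟨ε, h2, h3, h4⟩ := ((eventually_one_le_det htr).and
    (h1.and self_mem_nhdsWithin)).exists
  have h5 := hT _ (h2.trans (le_abs_self _))
  nlinarith [hle ε, mul_pos ht (mul_pos (Set.mem_Ioi.1 h4) (neg_pos.2 h3))]

/-- The first-order condition determines the Gram matrix: otherwise the direction `1 - G` would
violate it. -/
lemma eq_one_of_first_order {G : Matrix (Fin k) (Fin k) ℝ} (hsymm : ∀ j l, G j l = G l j)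
    (htr : ∑ j, G j j = k)
    (h : ∀ E : Matrix (Fin k) (Fin k) ℝ, Eᵀ = E → 0 < E.trace → 0 ≤ ∑ j, ∑ l, E j l * G j l) :
    G = 1 := by
  have hsq : ∑ j, ∑ l, (G j l - (1 : Matrix (Fin k) (Fin k) ℝ) j l) ^ 2 =
      ∑ j, ∑ l, G j l ^ 2 - k := by
    have e : ∀ j, ∑ l, (G j l - (1 : Matrix (Fin k) (Fin k) ℝ) j l) ^ 2 =
        ∑ l, G j l ^ 2 - 2 * G j j + 1 := fun j => by
      have : ∀ l, (G j l - (1 : Matrix (Fin k) (Fin k) ℝ) j l) ^ 2 =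
          G j l ^ 2 - (if j = l then 2 * G j l - 1 else 0) := fun l => by
        rw [Matrix.one_apply]; split_ifs <;> ring
      simp only [this, Finset.sum_sub_distrib, Finset.sum_ite_eq, Finset.mem_univ, if_true]
      ring
    simp only [e, Finset.sum_add_distrib, Finset.sum_sub_distrib, ← Finset.mul_sum, htr]
    simp; ring
  by_contra hG
  have hpos : 0 < ∑ j, ∑ l, (G j l - (1 : Matrix (Fin k) (Fin k) ℝ) j l) ^ 2 := by
    by_contra! h0
    apply hG
    ext j l
    have h1 := (Finset.sum_eq_zero_iff_of_nonneg fun j _ => Finset.sum_nonneg fun l _ =>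
      sq_nonneg (G j l - (1 : Matrix (Fin k) (Fin k) ℝ) j l)).1 (le_antisymm h0
        (Finset.sum_nonneg fun j _ => Finset.sum_nonneg fun l _ => sq_nonneg _)) j
          (Finset.mem_univ _)
    have h2 := (Finset.sum_eq_zero_iff_of_nonneg fun l _ =>
      sq_nonneg (G j l - (1 : Matrix (Fin k) (Fin k) ℝ) j l)).1 h1 l (Finset.mem_univ _)
    linarith [pow_eq_zero_iff two_ne_zero |>.1 h2]
  have hk : (0 : ℝ) < k := by
    rcases Nat.eq_zero_or_pos k with rfl | hk
    · simp at hpos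
    · exact_mod_cast hk
  set s := ∑ j, ∑ l, G j l ^ 2
  -- the direction `1 - G`, tilted slightly towards the identity
  set δ : ℝ := (s - k) / (2 * k) with hδ
  have hs : 0 < s - k := by rw [← hsq]; exact hpos
  have hδ0 : 0 < δ := by positivity
  have hδk : δ * k = (s - k) / 2 := by rw [hδ]; field_simp
  have h1 := h ((1 + δ) • 1 - G) (by
      ext j l; simp [Matrix.one_apply, hsymm l j, eq_comm]) (by
      have : G.trace = k := htr
      rw [Matrix.trace_sub, Matrix.trace_smul, Matrix.trace_one, this, Fintype.card_fin,
        smul_eq_mul]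
      nlinarith)
  have h2 : ∑ j, ∑ l, ((1 + δ) • (1 : Matrix (Fin k) (Fin k) ℝ) - G) j l * G j l =
      (1 + δ) * k - s := by
    have e : ∀ j, ∑ l, ((1 + δ) • (1 : Matrix (Fin k) (Fin k) ℝ) - G) j l * G j l =
        (1 + δ) * G j j - ∑ l, G j l ^ 2 := fun j => by
      simp only [Matrix.sub_apply, Matrix.smul_apply, Matrix.one_apply, smul_eq_mul, sub_mul,
        Finset.sum_sub_distrib, mul_ite, mul_one, mul_zero, ite_mul, zero_mul,
        Finset.sum_ite_eq, Finset.mem_univ, if_true, sq]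
    simp only [e, Finset.sum_sub_distrib, ← Finset.mul_sum, htr, s]
  rw [h2] at h1
  nlinarith

/-- Existence of a Lewis basis: an extremal substitution satisfies the first-order condition, which
forces its Gram matrix to be the identity once the trace of the power is scaled to `k`. -/
lemma exists_lewisBasis {p : ℝ} (hp : 1 ≤ p) (hk : k ≠ 0)
    (Y : Submodule ℝ Mat) (hY : Module.finrank ℝ Y = k) :
    ∃ T : Fin k → Mat, IsLewisBasis p Y T := by
  have : NeZero k := ⟨hk⟩
  have ht : 0 < p / 2 := by linarith
  have k0 : (0 : ℝ) < k := by exact_mod_cast Nat.pos_of_ne_zero hk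
  let b := Module.finBasisOfFinrankEq ℝ Y hY
  set S : Fin k → Mat := fun i => (b i : Mat) with hSdef
  have hS : LinearIndependent ℝ S := b.linearIndependent.map' Y.subtype (Submodule.ker_subtype Y)
  have hspan : Submodule.span ℝ (Set.range S) = Y := by
    have h1 : Set.range S = Y.subtype '' Set.range b := by
      rw [← Set.range_comp]; rfl
    rw [h1, ← Submodule.map_span, b.span_eq, Submodule.map_top, Submodule.range_subtype]
  obtain ⟨A, hA, hopt⟩ := exists_extremal hS ht
  set T₀ := comb A S with hT₀
  have hspan₀ : Submodule.span ℝ (Set.range T₀) = Y := (span_comb hA S).trans hspan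
  have hind₀ : LinearIndependent ℝ T₀ := linearIndependent_of_span_eq hS (hspan₀.trans hspan.symm)
  have hτ : 0 < tracePow (p / 2) (gramSum T₀) :=
    tracePow_pos (gramSum_posSemidef _) (gramSum_ne_zero (i := 0) (hind₀.ne_zero 0)) _
  -- rescale so that the trace of the power becomes `k`
  set c : ℝ := (k / tracePow (p / 2) (gramSum T₀)) ^ (1 / p) with hc
  have c0 : 0 < c := by positivity
  have hcp : (c ^ 2) ^ (p / 2) = k / tracePow (p / 2) (gramSum T₀) := by
    rw [← Real.rpow_natCast, ← Real.rpow_mul c0.le, hc, ← Real.rpow_mul (by positivity)]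
    convert Real.rpow_one _ using 2
    push_cast
    field_simp
  set T : Fin k → Mat := fun i => c • T₀ i with hT
  have hTc : T = comb (c • 1) T₀ := by rw [comb_smul, comb_one]
  have hspanT : Submodule.span ℝ (Set.range T) = Y := by
    rw [hTc, span_comb (by rw [Matrix.det_smul, Matrix.det_one]; positivity), hspan₀]
  have htrT : tracePow (p / 2) (gramSum T) = k := by
    rw [hT, gramSum_smul, tracePow_smul (gramSum_posSemidef _) (sq_nonneg _), hcp,
      div_mul_cancel₀ _ hτ.ne']
  have hG : lewisGram (p / 2) T = 1 := by
    refine eq_one_of_first_order (lewisGram_symm _ T) ?_ fun E hE htr =>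
      sum_mul_lewisGram_nonneg ht ?_ hE htr
    · rw [sum_lewisGram_diag ht.ne', htrT]
    · intro B hB
      rw [hT, comb_smul_right, gramSum_smul, gramSum_smul,
        tracePow_smul (gramSum_posSemidef _) (sq_nonneg _),
        tracePow_smul (gramSum_posSemidef _) (sq_nonneg _), hT₀, ← comb_mul]
      exact mul_le_mul_of_nonneg_left (hopt B hB) (by positivity)
  refine ⟨T, linearIndependent_of_span_eq hS (hspanT.trans hspan.symm), hspanT, fun i j => ?_⟩
  have h1 := congrFun (congrFun hG i) j
  have h2 := congrFun (congrFun hG j) i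
  simp only [lewisGram, Matrix.of_apply, Matrix.one_apply] at h1 h2
  rw [Matrix.smul_mul, Matrix.trace_smul, Matrix.add_mul, Matrix.trace_add, h1, h2, smul_eq_mul]
  by_cases hij : i = j
  · subst hij; simp; norm_num
  · simp [hij, Ne.symm hij]

lemma _root_.IsLewisBasis.lewisGram_eq_one {p : ℝ} {Y : Submodule ℝ Mat} {T : Fin k → Mat}
    (h : IsLewisBasis p Y T) : lewisGram (p / 2) T = 1 := by
  ext i j
  have h1 := h.2.2 i j
  rw [Matrix.smul_mul, Matrix.trace_smul, Matrix.add_mul, Matrix.trace_add, smul_eq_mul] at h1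
  have h2 := lewisGram_symm (p / 2) T i j
  simp only [lewisGram, Matrix.of_apply] at h2 ⊢
  rw [Matrix.one_apply]
  linarith

end Matrices

section Matrices

variable {m k : ℕ}

local notation "Mat" => Matrix (Fin m) (Fin m) ℝ

/-! ### Change of density along a Lewis basis -/

/-- The Schatten norm of a matrix, in terms of the trace of a power of `Zᵀ Z`. -/
noncomputable def matSchatten (p : ℝ) (Z : Mat) : ℝ := tracePow (p / 2) (Zᵀ * Z) ^ (1 / p)

lemma matSchatten_nonneg (p : ℝ) (Z : Mat) : 0 ≤ matSchatten p Z :=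
  Real.rpow_nonneg (tracePow_nonneg (posSemidef_transpose_mul_self Z) _) _

lemma matSchatten_rpow {p : ℝ} (hp : p ≠ 0) (Z : Mat) :
    matSchatten p Z ^ p = tracePow (p / 2) (Zᵀ * Z) := by
  rw [matSchatten, ← Real.rpow_mul (tracePow_nonneg (posSemidef_transpose_mul_self Z) _),
    one_div_mul_cancel hp, Real.rpow_one]

/-- On the orthogonal complement of the kernel of `M`, the powers of exponents `-s` and `s` are
inverse to each other; the kernel is harmless if it is contained in that of `Z`. -/
lemma mul_psdPow_neg_mul_psdPow {M Z : Mat} (hM : M.PosSemidef)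
    (hker : ∀ v, M *ᵥ v = 0 → Z *ᵥ v = 0) (s : ℝ) :
    Z * psdPow M (-s) * psdPow M s = Z := by
  obtain ⟨U, d, hU, hU', hd, hM', hf⟩ := exists_diag hM
  have e : psdPow M (-s) * psdPow M s =
      U * Matrix.diagonal (fun i => d i ^ (-s) * d i ^ s) * Uᵀ := by
    rw [psdPow, psdPow, hf, hf, ← Matrix.diagonal_mul_diagonal]
    calc _ = U * Matrix.diagonal (fun i => d i ^ (-s)) * (Uᵀ * U) *
          Matrix.diagonal (fun i => d i ^ s) * Uᵀ := by simp only [Matrix.mul_assoc]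
      _ = _ := by rw [hU]; simp only [Matrix.mul_assoc, Matrix.one_mul]
  have h1 : Z * U * Matrix.diagonal (fun i => d i ^ (-s) * d i ^ s) = Z * U := by
    ext i j
    rw [Matrix.mul_diagonal]
    rcases (hd j).eq_or_lt with hj | hj
    · have h2 : M *ᵥ (U *ᵥ Pi.single j 1) = 0 := by
        have h3 : M * U = U * Matrix.diagonal d := by
          conv_lhs => rw [hM']
          rw [Matrix.mul_assoc, hU, Matrix.mul_one]
        rw [Matrix.mulVec_mulVec, h3, ← Matrix.mulVec_mulVec]
        have : Matrix.diagonal d *ᵥ Pi.single j 1 = 0 := by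
          ext l
          simp only [Matrix.mulVec_diagonal, Pi.single_apply, Pi.zero_apply]
          split_ifs with hl
          · rw [hl, ← hj]; simp
          · simp
        rw [this, Matrix.mulVec_zero]
      have h4 := congrFun (hker _ h2) i
      rw [Matrix.mulVec_mulVec, Matrix.mulVec_single_one] at h4
      have h5 : (Z * U) i j = 0 := h4
      rw [h5, zero_mul]
    · rw [← Real.rpow_add hj, neg_add_cancel, Real.rpow_zero, mul_one]
  rw [Matrix.mul_assoc, e, ← Matrix.mul_assoc, ← Matrix.mul_assoc, h1, Matrix.mul_assoc, hU',
    Matrix.mul_one]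

/-- The image of `Z` under the change of density from `p` to `q` given by `T`. -/
noncomputable def changeDensity (p q : ℝ) (T : Fin k → Mat) (Z : Mat) : Mat :=
  Z * psdPow (gramSum T) ((p - q) / (2 * q))

variable {p q : ℝ} {Y : Submodule ℝ (Matrix (Fin m) (Fin m) ℝ)}
  {T : Fin k → Matrix (Fin m) (Fin m) ℝ} {Z : Matrix (Fin m) (Fin m) ℝ}

lemma _root_.IsLewisBasis.tracePow_gramSum (hp : 1 ≤ p) (h : IsLewisBasis p Y T) :
    tracePow (p / 2) (gramSum T) = k := by
  rw [← sum_lewisGram_diag (by linarith) T, h.lewisGram_eq_one]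
  simp

lemma _root_.IsLewisBasis.exists_coeff (h : IsLewisBasis p Y T) (hZ : Z ∈ Y) :
    ∃ z : Fin k → ℝ, Z = ∑ i, z i • T i := by
  rw [← h.2.1, Submodule.mem_span_range_iff_exists_fun] at hZ
  obtain ⟨z, hz⟩ := hZ
  exact ⟨z, hz.symm⟩

lemma _root_.IsLewisBasis.ker (h : IsLewisBasis p Y T) (hZ : Z ∈ Y) (v : Fin m → ℝ)
    (hv : gramSum T *ᵥ v = 0) : Z *ᵥ v = 0 := by
  obtain ⟨z, rfl⟩ := h.exists_coeff hZ
  simp [Matrix.sum_mulVec, Matrix.smul_mulVec, mulVec_eq_zero_of_gramSum hv]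

/-- Lower bound for the change of density, from Hölder's inequality. -/
lemma _root_.IsLewisBasis.le_changeDensity (hp : 1 ≤ p) (hpq : p < q) (h : IsLewisBasis p Y T)
    (hZ : Z ∈ Y) :
    matSchatten p Z ≤ (k : ℝ) ^ (1 / p - 1 / q) * matSchatten q (changeDensity p q T Z) := by
  have p0 : 0 < p := by linarith
  have q0 : 0 < q := by linarith
  have hd : 0 < q - p := by linarith
  have hM := gramSum_posSemidef T
  set W := changeDensity p q T Z with hW
  set R := psdPow (gramSum T) ((q - p) / q) with hR
  have hRpsd : R.PosSemidef := psdPow_posSemidef hM _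
  have hR2 : psdPow R (1 / 2) = psdPow (gramSum T) ((q - p) / (2 * q)) := by
    rw [hR, psdPow_psdPow hM]; congr 1; field_simp
  have hZW : Z = W * psdPow R (1 / 2) := by
    have := mul_psdPow_neg_mul_psdPow hM (h.ker hZ) ((q - p) / (2 * q))
    rw [hR2, hW, changeDensity, ← neg_sub q p, neg_div, this]
  have hZZ : Zᵀ * Z = psdPow R (1 / 2) * (Wᵀ * W) * psdPow R (1 / 2) := by
    conv_lhs => rw [hZW]
    rw [Matrix.transpose_mul, psdPow_transpose hRpsd]
    simp only [Matrix.mul_assoc]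
  have hH : (p * q / (q - p) / 2).HolderTriple (q / 2) (p / 2) :=
    ⟨by field_simp; ring, by positivity, by positivity⟩
  have key := tracePow_sandwich_le hRpsd (posSemidef_transpose_mul_self W) (by linarith) hH
  have hRk : tracePow (p * q / (q - p) / 2) R = k := by
    rw [← h.tracePow_gramSum hp, tracePow, hR, psdPow_psdPow hM, tracePow]
    congr 2; field_simp
  rw [← hZZ, hRk] at key
  have hWn := tracePow_nonneg (posSemidef_transpose_mul_self W) (q / 2)
  have hZn := tracePow_nonneg (posSemidef_transpose_mul_self Z) (p / 2)
  calc matSchatten p Z ≤ ((k : ℝ) ^ (p / 2 / (p * q / (q - p) / 2)) *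
        tracePow (q / 2) (Wᵀ * W) ^ (p / 2 / (q / 2))) ^ (1 / p) :=
        Real.rpow_le_rpow hZn key (by positivity)
    _ = _ := by
      rw [Real.mul_rpow (by positivity) (by positivity), ← Real.rpow_mul (by positivity),
        ← Real.rpow_mul hWn, matSchatten]
      congr 2 <;> field_simp

/-- The number `c` is the square of the Euclidean norm of the coefficients of `Z` in the Lewis
basis, and `Z M ^ (-1/2)` has operator norm at most `√c`, by the Cauchy-Schwarz inequality. -/
lemma _root_.IsLewisBasis.exists_sq_norm (h : IsLewisBasis p Y T) (hZ : Z ∈ Y) :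
    ∃ c : ℝ, 0 ≤ c ∧ c = (Zᵀ * Z * psdPow (gramSum T) (p / 2 - 1)).trace ∧
      ∀ v : Fin m → ℝ, (Z *ᵥ v) ⬝ᵥ (Z *ᵥ v) ≤ c * (v ⬝ᵥ (gramSum T *ᵥ v)) := by
  obtain ⟨z, hz⟩ := h.exists_coeff hZ
  refine ⟨∑ i, z i ^ 2, Finset.sum_nonneg fun _ _ => sq_nonneg _, ?_, fun v => ?_⟩
  · have h1 : Zᵀ * Z = gramForm T (Matrix.of fun j l => z j * z l) := by
      rw [hz]
      simp only [gramForm, Matrix.transpose_sum, Matrix.transpose_smul, Matrix.sum_mul,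
        Matrix.mul_sum, Matrix.smul_mul, Matrix.mul_smul, Matrix.of_apply, Finset.smul_sum, smul_smul]
      rw [Finset.sum_comm]
      exact Finset.sum_congr rfl fun j _ => Finset.sum_congr rfl fun l _ => by rw [mul_comm]
    rw [h1, trace_gramForm_mul, h.lewisGram_eq_one]
    simp [Matrix.one_apply, sq]
  · rw [gramSum_quadratic, hz]
    simp only [Matrix.sum_mulVec, Matrix.smul_mulVec, dotProduct]
    rw [Finset.sum_comm (s := Finset.univ (α := Fin k)), Finset.mul_sum]
    refine Finset.sum_le_sum fun a _ => ?_
    simp only [Finset.sum_apply, Pi.smul_apply, smul_eq_mul, ← sq]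
    exact Finset.sum_mul_sq_le_sq_mul_sq _ _ _

/-- The interpolation estimate behind the upper bound for the change of density. -/
lemma matSchatten_changeDensity_rpow_le (hp : 1 ≤ p) (hpq : p < q) {c : ℝ} (hc : 0 ≤ c)
    (h : ∀ v : Fin m → ℝ, (Z *ᵥ v) ⬝ᵥ (Z *ᵥ v) ≤ c * (v ⬝ᵥ (gramSum T *ᵥ v))) :
    matSchatten q (changeDensity p q T Z) ^ q ≤ c ^ ((q - p) / 2) * matSchatten p Z ^ p := by
  have p0 : 0 < p := by linarith
  have q0 : 0 < q := by linarith
  have hM := gramSum_posSemidef T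
  rw [matSchatten_rpow p0.ne', matSchatten_rpow q0.ne',
    ← tracePow_mul_transpose_comm _ (by positivity),
    ← tracePow_mul_transpose_comm _ (by positivity)]
  have key := tracePow_weighted_le hM hc h (a := p / q) (x := p / 2) (by positivity)
    ((div_le_one q0).2 hpq.le) (by positivity)
  have e1 : p / 2 / (p / q) = q / 2 := by field_simp
  have e2 : p / 2 * (1 / (p / q) - 1) = (q - p) / 2 := by field_simp
  have e3 : changeDensity p q T Z * (changeDensity p q T Z)ᵀ = weighted Z (gramSum T) (p / q) := by
    rw [changeDensity, Matrix.transpose_mul, psdPow_transpose hM, weighted]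
    have : psdPow (gramSum T) (p / q - 1) = psdPow (gramSum T) ((p - q) / (2 * q)) *
        psdPow (gramSum T) ((p - q) / (2 * q)) := by
      rw [psdPow_mul hM]
      · congr 1; field_simp; ring
      · have : (p - q) / (2 * q) < 0 := div_neg_of_neg_of_pos (by linarith) (by positivity)
        linarith
    rw [this]
    simp only [Matrix.mul_assoc]
  rw [e1, e2] at key
  rwa [e3]

lemma _root_.IsLewisBasis.changeDensity_le_of_le_two (hp : 1 ≤ p) (hp2 : p ≤ 2) (hpq : p < q)
    (h : IsLewisBasis p Y T) (hZ : Z ∈ Y) :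
    matSchatten q (changeDensity p q T Z) ≤ matSchatten p Z := by
  have p0 : 0 < p := by linarith
  have q0 : 0 < q := by linarith
  have hM := gramSum_posSemidef T
  obtain ⟨c, hc, hc', hcv⟩ := h.exists_sq_norm hZ
  have key := matSchatten_changeDensity_rpow_le hp hpq hc hcv
  have hN := matSchatten_nonneg p Z
  -- interpolation towards the exponent `2` bounds the weighted Hilbert norm of `Z`
  have hcN : c ^ (p / 2) ≤ matSchatten p Z ^ p := by
    rcases hc.eq_or_lt with h0 | h0
    · rw [← h0, Real.zero_rpow (by positivity)]
      exact Real.rpow_nonneg hN _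
    · have h1 := tracePow_weighted_le hM hc hcv (a := p / 2) (x := p / 2) (by positivity)
        (by linarith) (by positivity)
      rw [div_self (by positivity), tracePow_one (weighted_posSemidef Z hM _), trace_weighted,
        ← hc', tracePow_mul_transpose_comm _ (by positivity), ← matSchatten_rpow p0.ne'] at h1
      have e : c = c ^ (p / 2 * (1 / (p / 2) - 1)) * c ^ (p / 2) := by
        rw [← Real.rpow_add h0]
        conv_lhs => rw [← Real.rpow_one c]
        congr 1; field_simp; ring
      exact le_of_mul_le_mul_left (e.symm.trans_le h1) (Real.rpow_pos_of_pos h0 _)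
  have h2 : c ^ ((q - p) / 2) ≤ matSchatten p Z ^ (q - p) := by
    have := Real.rpow_le_rpow (Real.rpow_nonneg hc _) hcN (z := (q - p) / p)
      (div_nonneg (by linarith) p0.le)
    rw [← Real.rpow_mul hc, ← Real.rpow_mul hN] at this
    convert this using 2 <;> field_simp
  have h3 : matSchatten q (changeDensity p q T Z) ^ q ≤ matSchatten p Z ^ q := by
    refine key.trans ((mul_le_mul_of_nonneg_right h2 (Real.rpow_nonneg hN _)).trans_eq ?_)
    rw [← Real.rpow_add_of_nonneg hN (by linarith) p0.le, sub_add_cancel]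
  exact (Real.rpow_le_rpow_iff (matSchatten_nonneg _ _) hN q0).1 h3

lemma _root_.IsLewisBasis.changeDensity_le_of_two_lt (hp2 : 2 < p) (hpq : p < q)
    (h : IsLewisBasis p Y T) (hZ : Z ∈ Y) :
    matSchatten q (changeDensity p q T Z) ≤
      (k : ℝ) ^ ((p / 2 - 1) * (1 / p - 1 / q)) * matSchatten p Z := by
  have p0 : 0 < p := by linarith
  have q0 : 0 < q := by linarith
  have hM := gramSum_posSemidef T
  obtain ⟨c, hc, hc', hcv⟩ := h.exists_sq_norm hZ
  have key := matSchatten_changeDensity_rpow_le (by linarith) hpq hc hcv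
  have hN := matSchatten_nonneg p Z
  have hcN : c ≤ matSchatten p Z ^ (2 : ℝ) * (k : ℝ) ^ (1 - 2 / p) := by
    have h1 := trace_mul_psdPow_le (posSemidef_transpose_mul_self Z) hM (t := p / 2) (by linarith)
    rw [← hc', h.tracePow_gramSum (by linarith), ← matSchatten_rpow p0.ne', ← Real.rpow_mul hN,
      one_div_div, mul_div_cancel₀ _ p0.ne'] at h1
    exact h1
  have h2 := Real.rpow_le_rpow hc hcN (z := (q - p) / 2) (by linarith)
  have h3 : matSchatten q (changeDensity p q T Z) ^ q ≤
      ((k : ℝ) ^ ((p / 2 - 1) * (1 / p - 1 / q)) * matSchatten p Z) ^ q := by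
    refine key.trans ((mul_le_mul_of_nonneg_right h2 (Real.rpow_nonneg hN _)).trans_eq ?_)
    rw [Real.mul_rpow (by positivity) (by positivity), Real.mul_rpow (by positivity) hN,
      ← Real.rpow_mul hN, ← Real.rpow_mul (by positivity), ← Real.rpow_mul (by positivity),
      mul_right_comm, ← Real.rpow_add_of_nonneg hN (by linarith) p0.le, mul_comm]
    congr 2 <;> field_simp
    ring
  exact (Real.rpow_le_rpow_iff (matSchatten_nonneg _ _) (by positivity) q0).1 h3

lemma _root_.IsLewisBasis.changeDensity_le (hp : 1 ≤ p) (hpq : p < q) (hk : k ≠ 0)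
    (h : IsLewisBasis p Y T) (hZ : Z ∈ Y) :
    (k : ℝ) ^ (1 / p - 1 / q) * matSchatten q (changeDensity p q T Z) ≤
      distortionBound p q k * matSchatten p Z := by
  have k0 : (0 : ℝ) < k := by exact_mod_cast Nat.pos_of_ne_zero hk
  rw [distortionBound]
  split_ifs with hp2
  · exact mul_le_mul_of_nonneg_left (h.changeDensity_le_of_le_two hp hp2 hpq hZ) (by positivity)
  · refine (mul_le_mul_of_nonneg_left (h.changeDensity_le_of_two_lt (not_le.1 hp2) hpq hZ)
      (by positivity)).trans_eq ?_
    rw [← mul_assoc, ← Real.rpow_add k0]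
    congr 2; ring

end Matrices

/-! ### Schatten norms of operators and Bessel sequences -/

section Operators

universe u

variable {H : Type u} [NormedAddCommGroup H] [InnerProductSpace ℝ H]

/-- A family satisfying Bessel's inequality with constant `1`. -/
def IsBessel {ι : Type*} (x : ι → H) : Prop :=
  ∀ (s : Finset ι) (v : H), ∑ i ∈ s, inner ℝ (x i) v ^ 2 ≤ ‖v‖ ^ 2

lemma IsBessel.norm_sq_le_one {ι : Type*} {x : ι → H} (hx : IsBessel x) (i : ι) :
    ‖x i‖ ^ 2 ≤ 1 := by
  have h := hx {i} (x i)
  rw [Finset.sum_singleton, real_inner_self_eq_norm_sq] at h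
  by_contra! h1
  nlinarith

lemma isBessel_of_orthogonal {ι : Type*} {x : ι → H} (h1 : ∀ i, ‖x i‖ ≤ 1)
    (h2 : ∀ i j, i ≠ j → inner ℝ (x i) (x j) = 0) : IsBessel x := by
  classical
  intro s v
  have h3 : ‖∑ i ∈ s, inner ℝ (x i) v • x i‖ ^ 2 ≤ ∑ i ∈ s, inner ℝ (x i) v ^ 2 := by
    rw [← real_inner_self_eq_norm_sq, sum_inner]
    refine Finset.sum_le_sum fun i hi => ?_
    rw [inner_sum, Finset.sum_eq_single_of_mem i hi fun j _ hj => by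
      rw [inner_smul_left, inner_smul_right, h2 i j hj.symm]; simp]
    rw [inner_smul_left, inner_smul_right, real_inner_self_eq_norm_sq]
    have h4 : ‖x i‖ ^ 2 ≤ 1 := pow_le_one₀ (norm_nonneg _) (h1 i)
    simp only [conj_trivial]
    nlinarith [sq_nonneg (inner ℝ (x i) v)]
  have h4 : inner ℝ v (∑ i ∈ s, inner ℝ (x i) v • x i) = ∑ i ∈ s, inner ℝ (x i) v ^ 2 := by
    rw [inner_sum]
    exact Finset.sum_congr rfl fun i _ => by rw [inner_smul_right, real_inner_comm, sq]
  have h5 := norm_sub_sq_real v (∑ i ∈ s, inner ℝ (x i) v • x i)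
  rw [h4] at h5
  nlinarith [sq_nonneg ‖v - ∑ i ∈ s, inner ℝ (x i) v • x i‖]

lemma _root_.Orthonormal.isBessel {ι : Type*} {x : ι → H} (hx : Orthonormal ℝ x) : IsBessel x :=
  isBessel_of_orthogonal (fun i => (hx.1 i).le) fun _ _ hij => hx.2 hij

lemma isBessel_normalize {κ : Type*} {z : κ → H} (h : ∀ i j, i ≠ j → inner ℝ (z i) (z j) = 0) :
    IsBessel fun i => ‖z i‖⁻¹ • z i := by
  refine isBessel_of_orthogonal (fun i => ?_) fun i j hij => ?_
  · rw [norm_smul, norm_inv, norm_norm]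
    exact inv_mul_le_one
  · rw [inner_smul_left, inner_smul_right, h i j hij, mul_zero, mul_zero]

/-- For an operator in singular value form, each pairing is bounded by an average of the singular
values with substochastic weights. -/
lemma sum_abs_pairing_rpow_le {ι κ : Type*} {x y : ι → H} {e f : κ → H} (hx : IsBessel x)
    (hy : IsBessel y) (he : IsBessel e) (hf : IsBessel f) {σ : κ → ℝ} (hσ : ∀ j, 0 ≤ σ j)
    {p : ℝ} (hp : 1 ≤ p) (s : Finset ι) (u : Finset κ) :
    ∑ i ∈ s, |∑ j ∈ u, σ j * (inner ℝ (e j) (y i) * inner ℝ (f j) (x i))| ^ p ≤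
      ∑ j ∈ u, σ j ^ p := by
  set w : ι → κ → ℝ := fun i j => (inner ℝ (e j) (y i) ^ 2 + inner ℝ (f j) (x i) ^ 2) / 2 with hw
  refine le_trans (Finset.sum_le_sum fun i _ => ?_) (sum_rpow_sum_weight_le s u w σ
    (fun i j => by positivity) hσ (fun i => ?_) (fun j => ?_) hp)
  · refine Real.rpow_le_rpow (abs_nonneg _) ?_ (by linarith)
    refine (Finset.abs_sum_le_sum_abs _ _).trans (Finset.sum_le_sum fun j _ => ?_)
    rw [abs_mul, abs_of_nonneg (hσ j), mul_comm]
    refine mul_le_mul_of_nonneg_right ?_ (hσ j)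
    rw [hw, abs_le]
    constructor
    · nlinarith [sq_nonneg (inner ℝ (e j) (y i) + inner ℝ (f j) (x i))]
    · nlinarith [sq_nonneg (inner ℝ (e j) (y i) - inner ℝ (f j) (x i))]
  · rw [← Finset.sum_div, Finset.sum_add_distrib]
    linarith [he u (y i), hf u (x i), hx.norm_sq_le_one i, hy.norm_sq_le_one i]
  · rw [← Finset.sum_div, Finset.sum_add_distrib]
    simp only [real_inner_comm _ (e j), real_inner_comm _ (f j)]
    linarith [hy s (e j), hx s (f j), he.norm_sq_le_one j, hf.norm_sq_le_one j]

/-- The variational form of the statement that the `p`-th power of the Schatten norm of `T` is at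
most `C`: the pairings of `T` with two Bessel families are bounded in `ℓ_p`. The triangle
inequality, compressions and weak limits are easy to treat in this form. -/
def HasSchattenBound (p C : ℝ) (T : H →L[ℝ] H) : Prop :=
  ∀ (ι : Type u) (s : Finset ι) (x y : ι → H), IsBessel x → IsBessel y →
    ∑ i ∈ s, |inner ℝ (x i) (T (y i))| ^ p ≤ C

variable [CompleteSpace H]

/-- A compact operator has a Hilbert basis of eigenvectors of `T* T`; the norms of the images of its
members are the singular values, with the right multiplicities. -/
lemma exists_hilbertBasis_singular {T : H →L[ℝ] H} (hT : IsCompactOperator T) {p : ℝ}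
    (hp : 0 < p) : ∃ (κ : Type u) (b : HilbertBasis κ ℝ H),
      (∀ i j, i ≠ j → inner ℝ (T (b i)) (T (b j)) = 0) ∧
      ∑' s : Set.Ioi (0 : ℝ), ENNReal.ofReal ((singularMultiplicity T s : ℝ) * (s : ℝ) ^ p) =
        ∑' i, ENNReal.ofReal (‖T (b i)‖ ^ p) := by
  set A : H →L[ℝ] H := ContinuousLinearMap.adjoint T ∘L T with hA
  have hAc : IsCompactOperator A := hT.clm_comp (ContinuousLinearMap.adjoint T)
  have hAs : (A : H →ₗ[ℝ] H).IsSymmetric :=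
    (ContinuousLinearMap.isPositive_adjoint_comp_self T).isSymmetric
  have hAi : ∀ x y, inner ℝ (A x) y = inner ℝ (T x) (T y) := fun x y => by
    rw [hA, ContinuousLinearMap.comp_apply, ContinuousLinearMap.adjoint_inner_left]
  have hclosed : ∀ μ : ℝ, IsClosed (Module.End.eigenspace (A : H →ₗ[ℝ] H) μ : Set H) := fun μ => by
    have : (Module.End.eigenspace (A : H →ₗ[ℝ] H) μ : Set H) = {x | A x = μ • x} := by
      ext x; simp
    rw [this]
    exact isClosed_eq A.continuous (continuous_const_smul μ)
  have hcomp : ∀ μ : ℝ, CompleteSpace (Module.End.eigenspace (A : H →ₗ[ℝ] H) μ) := fun μ =>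
    (hclosed μ).completeSpace_coe
  choose w b hb using fun μ : ℝ =>
    exists_hilbertBasis ℝ (Module.End.eigenspace (A : H →ₗ[ℝ] H) μ)
  set v : (Σ μ, w μ) → H := fun a => ((b a.1 a.2 : Module.End.eigenspace (A : H →ₗ[ℝ] H) a.1) : H)
    with hv
  have hvo : Orthonormal ℝ v :=
    hAs.orthogonalFamily_eigenspaces.orthonormal_sigma_orthonormal fun μ => (b μ).orthonormal
  have hspan : (Submodule.span ℝ (Set.range v))ᗮ = ⊥ := by
    rw [eq_bot_iff, ← ContinuousLinearMap.orthogonalComplement_iSup_eigenspaces_eq_bot hAc hAs]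
    intro x hx
    rw [← Submodule.iInf_orthogonal, Submodule.mem_iInf]
    intro μ
    rw [Submodule.mem_orthogonal]
    intro z hz
    have h1 := ((b μ).hasSum_repr ⟨z, hz⟩).mapL
      ((innerSL ℝ x).comp (Module.End.eigenspace (A : H →ₗ[ℝ] H) μ).subtypeL)
    have h2 : ∀ i, ((innerSL ℝ x).comp (Module.End.eigenspace (A : H →ₗ[ℝ] H) μ).subtypeL)
        ((b μ).repr ⟨z, hz⟩ i • b μ i) = 0 := fun i => by
      have h3 := (Submodule.mem_orthogonal _ _).1 hx (v ⟨μ, i⟩) (Submodule.subset_span ⟨_, rfl⟩)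
      rw [real_inner_comm] at h3
      rw [map_smul]
      simp only [ContinuousLinearMap.comp_apply, innerSL_apply_apply, Submodule.subtypeL_apply]
      rw [h3, smul_zero]
    simp only [h2] at h1
    have h3 := h1.unique hasSum_zero
    simp only [ContinuousLinearMap.comp_apply, innerSL_apply_apply, Submodule.subtypeL_apply] at h3
    rw [real_inner_comm]
    exact h3
  have heig : ∀ a : Σ μ, w μ, A (v a) = a.1 • v a := fun a =>
    Module.End.mem_eigenspace_iff.1 (b a.1 a.2).2
  have hnorm : ∀ a : Σ μ, w μ, ‖T (v a)‖ ^ 2 = a.1 := fun a => by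
    rw [← real_inner_self_eq_norm_sq, ← hAi, heig, inner_smul_left, real_inner_self_eq_norm_sq,
      hvo.1 a]
    simp
  refine ⟨Σ μ, w μ, HilbertBasis.mkOfOrthogonalEqBot hvo hspan, fun i j hij => ?_, ?_⟩
  · rw [HilbertBasis.coe_mkOfOrthogonalEqBot, ← hAi, heig, inner_smul_left, hvo.2 hij, mul_zero]
  · rw [HilbertBasis.coe_mkOfOrthogonalEqBot, ENNReal.tsum_sigma']
    set G : ℝ → ℝ≥0∞ := fun μ => ∑' a : w μ, ENNReal.ofReal (‖T (v ⟨μ, a⟩)‖ ^ p) with hG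
    have hinj : Function.Injective fun s : Set.Ioi (0 : ℝ) => (s : ℝ) ^ 2 := fun s t hst =>
      Subtype.ext ((sq_eq_sq₀ (le_of_lt s.2) (le_of_lt t.2)).1 hst)
    have hsupp : Function.support G ⊆ Set.range fun s : Set.Ioi (0 : ℝ) => (s : ℝ) ^ 2 := by
      intro μ hμ
      have h0 : 0 < μ := by
        by_contra! h0
        apply hμ
        rw [hG, ENNReal.tsum_eq_zero]
        intro a
        have h1 := hnorm ⟨μ, a⟩
        have h2 : ‖T (v ⟨μ, a⟩)‖ = 0 := by
          have : ‖T (v ⟨μ, a⟩)‖ ^ 2 ≤ 0 := h1.trans_le h0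
          nlinarith [norm_nonneg (T (v ⟨μ, a⟩))]
        rw [h2, Real.zero_rpow hp.ne', ENNReal.ofReal_zero]
      exact ⟨⟨Real.sqrt μ, Real.sqrt_pos.2 h0⟩, Real.sq_sqrt h0.le⟩
    rw [← hinj.tsum_eq hsupp]
    refine tsum_congr fun s => ?_
    have hs : (0 : ℝ) < s := s.2
    have h1 : ∀ a : w ((s : ℝ) ^ 2), ‖T (v ⟨(s : ℝ) ^ 2, a⟩)‖ = s := fun a =>
      (sq_eq_sq₀ (norm_nonneg _) hs.le).1 (hnorm ⟨(s : ℝ) ^ 2, a⟩)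
    have hfd := ContinuousLinearMap.finite_dimensional_eigenspace hAc ((s : ℝ) ^ 2) (by positivity)
    have hfin : Finite (w ((s : ℝ) ^ 2)) := (b _).orthonormal.linearIndependent.finite
    have := Fintype.ofFinite (w ((s : ℝ) ^ 2))
    have hcard : singularMultiplicity T s = Fintype.card (w ((s : ℝ) ^ 2)) :=
      Module.finrank_eq_card_basis (b ((s : ℝ) ^ 2)).toOrthonormalBasis.toBasis
    simp only [hG, h1]
    rw [tsum_fintype, Finset.sum_const, hcard, ENNReal.ofReal_mul (Nat.cast_nonneg _),
      ENNReal.ofReal_natCast, Finset.card_univ, nsmul_eq_mul]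

/-- Summability and value of the Schatten sum over a Hilbert basis. -/
lemma exists_hilbertBasis_schatten {T : H →L[ℝ] H} (hT : IsCompactOperator T) {p : ℝ}
    (hp : 0 < p) : ∃ (κ : Type u) (b : HilbertBasis κ ℝ H),
      (∀ i j, i ≠ j → inner ℝ (T (b i)) (T (b j)) = 0) ∧
      (MemSchatten p T ↔ Summable fun i => ‖T (b i)‖ ^ p) ∧
      schattenNorm p T ^ p = ∑' i, ‖T (b i)‖ ^ p := by
  obtain ⟨κ, b, h1, h2⟩ := exists_hilbertBasis_singular hT hp
  have n1 : ∀ s : Set.Ioi (0 : ℝ), 0 ≤ (singularMultiplicity T s : ℝ) * (s : ℝ) ^ p := fun s =>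
    mul_nonneg (Nat.cast_nonneg _) (Real.rpow_nonneg (le_of_lt s.2) _)
  have n2 : ∀ i, 0 ≤ ‖T (b i)‖ ^ p := fun i => Real.rpow_nonneg (norm_nonneg _) _
  have e1 : ∑' s : Set.Ioi (0 : ℝ), (singularMultiplicity T s : ℝ) * (s : ℝ) ^ p =
      ∑' i, ‖T (b i)‖ ^ p := by
    have := congrArg ENNReal.toReal h2
    rw [ENNReal.tsum_toReal_eq fun _ => ENNReal.ofReal_ne_top,
      ENNReal.tsum_toReal_eq fun _ => ENNReal.ofReal_ne_top] at this
    simpa only [ENNReal.toReal_ofReal (n1 _), ENNReal.toReal_ofReal (n2 _)] using this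
  refine ⟨κ, b, h1, ⟨fun h => ?_, fun h => ⟨hT, ?_⟩⟩, ?_⟩
  · have h3 := h.2.tsum_ofReal_ne_top
    rw [h2] at h3
    simpa only [ENNReal.toReal_ofReal (n2 _)] using ENNReal.summable_toReal h3
  · have h3 := h.tsum_ofReal_ne_top
    rw [← h2] at h3
    simpa only [ENNReal.toReal_ofReal (n1 _)] using ENNReal.summable_toReal h3
  · rw [schattenNorm, ← Real.rpow_mul (tsum_nonneg n1), one_div_mul_cancel hp.ne', Real.rpow_one, e1]

lemma schattenNorm_nonneg (p : ℝ) (T : H →L[ℝ] H) : 0 ≤ schattenNorm p T :=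
  Real.rpow_nonneg (tsum_nonneg fun s =>
    mul_nonneg (Nat.cast_nonneg _) (Real.rpow_nonneg (le_of_lt s.2) _)) _

/-- The Schatten norm dominates the variational sums: expand `T` along a Hilbert basis with
orthogonal images and apply `sum_abs_pairing_rpow_le` to the partial sums. -/
lemma _root_.MemSchatten.hasSchattenBound {p : ℝ} (hp : 1 ≤ p) {T : H →L[ℝ] H}
    (hT : MemSchatten p T) : HasSchattenBound p (schattenNorm p T ^ p) T := by
  intro ι s x y hx hy
  obtain ⟨κ, b, h1, h2, h3⟩ := exists_hilbertBasis_schatten hT.1 (p := p) (by linarith)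
  have hsum := h2.1 hT
  rw [h3]
  have hlim : ∀ i, HasSum (fun j => ‖T (b j)‖ *
      (inner ℝ (b j) (y i) * inner ℝ (‖T (b j)‖⁻¹ • T (b j)) (x i))) (inner ℝ (x i) (T (y i))) :=
    fun i => by
      have := ((b.hasSum_repr (y i)).mapL T).mapL (innerSL ℝ (x i))
      have e : ∀ j, innerSL ℝ (x i) (T (b.repr (y i) j • b j)) = ‖T (b j)‖ *
          (inner ℝ (b j) (y i) * inner ℝ (‖T (b j)‖⁻¹ • T (b j)) (x i)) := fun j => by
        rw [map_smul, map_smul, innerSL_apply_apply, b.repr_apply_apply, smul_eq_mul,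
          inner_smul_left, real_inner_comm (x i)]
        simp only [conj_trivial]
        by_cases hj : ‖T (b j)‖ = 0
        · rw [norm_eq_zero.1 hj]; simp
        · field_simp
      simpa only [e, innerSL_apply_apply] using this
  have hlim2 : Filter.Tendsto (fun u : Finset κ => ∑ i ∈ s, |∑ j ∈ u, ‖T (b j)‖ *
      (inner ℝ (b j) (y i) * inner ℝ (‖T (b j)‖⁻¹ • T (b j)) (x i))| ^ p) Filter.atTop
      (nhds (∑ i ∈ s, |inner ℝ (x i) (T (y i))| ^ p)) :=
    tendsto_finsetSum _ fun i _ => by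
      have h4 := hlim i
      rw [HasSum, SummationFilter.unconditional_filter] at h4
      exact h4.abs.rpow_const (Or.inr (by linarith))
  refine le_of_tendsto hlim2 (Filter.Eventually.of_forall fun u => ?_)
  exact (sum_abs_pairing_rpow_le hx hy b.orthonormal.isBessel (isBessel_normalize h1)
    (fun j => norm_nonneg _) hp s u).trans
      (hsum.sum_le_tsum u fun j _ => Real.rpow_nonneg (norm_nonneg _) _)

/-- Conversely, the basis of eigenvectors of `T* T` and its normalized images attain the Schatten
norm. -/
lemma HasSchattenBound.memSchatten {p C : ℝ} (hp : 1 ≤ p) {T : H →L[ℝ] H}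
    (hT : IsCompactOperator T) (h : HasSchattenBound p C T) :
    MemSchatten p T ∧ schattenNorm p T ^ p ≤ C := by
  obtain ⟨κ, b, h1, h2, h3⟩ := exists_hilbertBasis_schatten hT (p := p) (by linarith)
  have hle : ∀ u : Finset κ, ∑ j ∈ u, ‖T (b j)‖ ^ p ≤ C := fun u => by
    refine le_trans (le_of_eq (Finset.sum_congr rfl fun j _ => ?_))
      (h κ u _ _ (isBessel_normalize h1) b.orthonormal.isBessel)
    rw [inner_smul_left, real_inner_self_eq_norm_sq]
    congr 1
    simp only [conj_trivial]
    by_cases hj : ‖T (b j)‖ = 0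
    · simp [hj]
    · rw [sq, inv_mul_cancel_left₀ hj, abs_of_nonneg (norm_nonneg _)]
  have n2 : ∀ i, 0 ≤ ‖T (b i)‖ ^ p := fun i => Real.rpow_nonneg (norm_nonneg _) _
  have hs : Summable fun i => ‖T (b i)‖ ^ p := summable_of_sum_le n2 hle
  exact ⟨h2.2 hs, h3.trans_le (hs.tsum_le_of_sum_le hle)⟩

end Operators

/-! ### The Schatten norm is a norm -/

section Operators

universe u

variable {H : Type u} [NormedAddCommGroup H] [InnerProductSpace ℝ H]

lemma HasSchattenBound.mono {p C C' : ℝ} {T : H →L[ℝ] H} (h : HasSchattenBound p C T)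
    (hC : C ≤ C') : HasSchattenBound p C' T :=
  fun ι s x y hx hy => (h ι s x y hx hy).trans hC

lemma HasSchattenBound.add {p a b : ℝ} (hp : 1 ≤ p) (ha : 0 ≤ a) (hb : 0 ≤ b) {S T : H →L[ℝ] H}
    (hS : HasSchattenBound p (a ^ p) S) (hT : HasSchattenBound p (b ^ p) T) :
    HasSchattenBound p ((a + b) ^ p) (S + T) := by
  intro ι s x y hx hy
  have p0 : 0 < p := by linarith
  have h := Real.Lp_add_le s (fun i => inner ℝ (x i) (S (y i))) (fun i => inner ℝ (x i) (T (y i))) hp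
  have e : ∀ {C : ℝ}, 0 ≤ C → ∀ f : ι → ℝ, ∑ i ∈ s, |f i| ^ p ≤ C ^ p →
      (∑ i ∈ s, |f i| ^ p) ^ (1 / p) ≤ C := fun {C} hC f hf => by
    rw [one_div, Real.rpow_inv_le_iff_of_pos (Finset.sum_nonneg fun i _ =>
      Real.rpow_nonneg (abs_nonneg _) _) hC p0]
    exact hf
  have h2 := h.trans (add_le_add (e ha _ (hS ι s x y hx hy)) (e hb _ (hT ι s x y hx hy)))
  rw [one_div, Real.rpow_inv_le_iff_of_pos (Finset.sum_nonneg fun i _ =>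
      Real.rpow_nonneg (abs_nonneg _) _) (add_nonneg ha hb) p0] at h2
  simpa [inner_add_right] using h2

lemma HasSchattenBound.smul {p C : ℝ} {T : H →L[ℝ] H} (h : HasSchattenBound p C T) (c : ℝ) :
    HasSchattenBound p (|c| ^ p * C) (c • T) := by
  intro ι s x y hx hy
  have e : ∀ i, |inner ℝ (x i) ((c • T) (y i))| ^ p = |c| ^ p * |inner ℝ (x i) (T (y i))| ^ p :=
    fun i => by
      rw [smul_apply, inner_smul_right, abs_mul,
        Real.mul_rpow (abs_nonneg _) (abs_nonneg _)]
  simp only [e]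
  rw [← Finset.mul_sum]
  exact mul_le_mul_of_nonneg_left (h ι s x y hx hy) (Real.rpow_nonneg (abs_nonneg _) _)

/-- Bounds for the variational sums pass through self-adjoint contractions. -/
lemma HasSchattenBound.compress {p C : ℝ} {S T : H →L[ℝ] H} (h : HasSchattenBound p C T)
    {P : H → H} (hP : ∀ x y, inner ℝ (P x) y = inner ℝ x (P y)) (hP1 : ∀ x, ‖P x‖ ≤ ‖x‖)
    (hS : ∀ x y, inner ℝ x (S y) = inner ℝ (P x) (T (P y))) : HasSchattenBound p C S := by
  have hB : ∀ {ι : Type u} {x : ι → H}, IsBessel x → IsBessel fun i => P (x i) :=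
    fun {ι x} hx s v => by
      simp only [hP]
      exact (hx s (P v)).trans (pow_le_pow_left₀ (norm_nonneg _) (hP1 v) 2)
  intro ι s x y hx hy
  simpa only [hS] using h ι s _ _ (hB hx) (hB hy)

/-- Lower semicontinuity of the Schatten norm for weak convergence. -/
lemma HasSchattenBound.of_tendsto {p C : ℝ} (hp : 0 ≤ p) {S : ℕ → H →L[ℝ] H} {T : H →L[ℝ] H}
    (h : ∀ n, HasSchattenBound p C (S n))
    (hT : ∀ x y, Filter.Tendsto (fun n => inner ℝ x (S n y)) Filter.atTop
      (nhds (inner ℝ x (T y)))) : HasSchattenBound p C T := by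
  intro ι s x y hx hy
  have hlim : Filter.Tendsto (fun n => ∑ i ∈ s, |inner ℝ (x i) (S n (y i))| ^ p) Filter.atTop
      (nhds (∑ i ∈ s, |inner ℝ (x i) (T (y i))| ^ p)) :=
    tendsto_finsetSum _ fun i _ => (hT (x i) (y i)).abs.rpow_const (Or.inr hp)
  exact le_of_tendsto hlim (Filter.Eventually.of_forall fun n => h n ι s x y hx hy)

variable [CompleteSpace H]

lemma schattenNorm_le_of_hasSchattenBound {p a : ℝ} (hp : 1 ≤ p) (ha : 0 ≤ a) {T : H →L[ℝ] H}
    (hT : IsCompactOperator T) (h : HasSchattenBound p (a ^ p) T) :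
    MemSchatten p T ∧ schattenNorm p T ≤ a := by
  have h1 := h.memSchatten hp hT
  exact ⟨h1.1, (Real.rpow_le_rpow_iff (schattenNorm_nonneg _ _) ha (by linarith)).1 h1.2⟩

lemma _root_.MemSchatten.add {p : ℝ} (hp : 1 ≤ p) {S T : H →L[ℝ] H} (hS : MemSchatten p S)
    (hT : MemSchatten p T) :
    MemSchatten p (S + T) ∧ schattenNorm p (S + T) ≤ schattenNorm p S + schattenNorm p T :=
  schattenNorm_le_of_hasSchattenBound hp
    (add_nonneg (schattenNorm_nonneg _ _) (schattenNorm_nonneg _ _)) (hS.1.add hT.1)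
    ((hS.hasSchattenBound hp).add hp (schattenNorm_nonneg _ _) (schattenNorm_nonneg _ _)
      (hT.hasSchattenBound hp))

lemma _root_.MemSchatten.smul_le {p : ℝ} (hp : 1 ≤ p) {T : H →L[ℝ] H} (hT : MemSchatten p T)
    (c : ℝ) : MemSchatten p (c • T) ∧ schattenNorm p (c • T) ≤ |c| * schattenNorm p T := by
  refine schattenNorm_le_of_hasSchattenBound hp
    (mul_nonneg (abs_nonneg _) (schattenNorm_nonneg _ _)) (hT.1.smul c) ?_
  rw [Real.mul_rpow (abs_nonneg _) (schattenNorm_nonneg _ _)]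
  exact (hT.hasSchattenBound hp).smul c

lemma _root_.MemSchatten.norm_smul {p : ℝ} (hp : 1 ≤ p) {T : H →L[ℝ] H} (hT : MemSchatten p T)
    (c : ℝ) : schattenNorm p (c • T) = |c| * schattenNorm p T := by
  obtain ⟨h1, h2⟩ := hT.smul_le hp c
  refine le_antisymm h2 ?_
  rcases eq_or_ne c 0 with rfl | hc
  · rw [abs_zero, zero_mul]; exact schattenNorm_nonneg _ _
  · have h3 := (h1.smul_le hp c⁻¹).2
    rw [smul_smul, inv_mul_cancel₀ hc, one_smul, abs_inv] at h3
    rwa [← le_inv_mul_iff₀ (abs_pos.2 hc)]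

lemma _root_.MemSchatten.sub {p : ℝ} (hp : 1 ≤ p) {S T : H →L[ℝ] H} (hS : MemSchatten p S)
    (hT : MemSchatten p T) : MemSchatten p (S - T) := by
  have h := (hS.add hp (hT.smul_le hp (-1)).1).1
  rwa [neg_one_smul, ← sub_eq_add_neg] at h

lemma _root_.MemSchatten.eq_zero {p : ℝ} (hp : 1 ≤ p) {T : H →L[ℝ] H} (hT : MemSchatten p T)
    (h : schattenNorm p T = 0) : T = 0 := by
  have hb := hT.hasSchattenBound hp
  rw [h, Real.zero_rpow (by linarith)] at hb
  have hunit : ∀ v : H, ‖v‖ ≤ 1 → IsBessel fun _ : PUnit.{u + 1} => v := fun v hv =>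
    isBessel_of_orthogonal (fun _ => hv) fun i j hij => (hij (Subsingleton.elim i j)).elim
  have hkey : ∀ v w : H, ‖v‖ ≤ 1 → ‖w‖ ≤ 1 → inner ℝ v (T w) = 0 := fun v w hv hw => by
    have h1 := hb PUnit {PUnit.unit} _ _ (hunit v hv) (hunit w hw)
    rw [Finset.sum_singleton] at h1
    have h2 := le_antisymm h1 (Real.rpow_nonneg (abs_nonneg _) _)
    exact abs_eq_zero.1 ((Real.rpow_eq_zero (abs_nonneg _) (by linarith)).1 h2)
  have hn : ∀ v : H, ‖‖v‖⁻¹ • v‖ ≤ 1 := fun v => by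
    rw [_root_.norm_smul, norm_inv, norm_norm]; exact inv_mul_le_one
  ext w
  by_contra hw
  have h1 := hkey _ _ (hn (T w)) (hn w)
  rw [map_smul, inner_smul_left, inner_smul_right, real_inner_self_eq_norm_sq] at h1
  have hTw : ‖T w‖ ≠ 0 := norm_ne_zero_iff.2 hw
  have hw0 : ‖w‖ ≠ 0 := norm_ne_zero_iff.2 fun h0 => hw (by rw [h0, map_zero]; rfl)
  simp [hTw, hw0] at h1

end Operators

/-! ### Corner operators -/

section Corner

/-- The standard unit vectors of `ℓ₂`. -/
noncomputable def unitVec (i : ℕ) : Ell2 := lp.single 2 i (1 : ℝ)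

lemma inner_unitVec (i : ℕ) (x : Ell2) : inner ℝ (unitVec i) x = x i := by
  rw [unitVec, lp.inner_single_left]; simp

lemma orthonormal_unitVec : Orthonormal ℝ unitVec := by
  rw [orthonormal_iff_ite]
  intro i j
  rw [inner_unitVec, unitVec, lp.single_apply]
  simp [Pi.single_apply]

variable {m : ℕ}

local notation "Mat" => Matrix (Fin m) (Fin m) ℝ

/-- The first `m` coordinates of a sequence. -/
noncomputable def coords (m : ℕ) (x : Ell2) : Fin m → ℝ := fun i => inner ℝ (unitVec i) x

/-- The finitely supported sequence with given first `m` coordinates. -/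
noncomputable def extend (v : Fin m → ℝ) : Ell2 := ∑ i, v i • unitVec i

lemma inner_extend (v : Fin m → ℝ) (x : Ell2) : inner ℝ (extend v) x = v ⬝ᵥ coords m x := by
  simp [extend, sum_inner, inner_smul_left, coords, dotProduct]

lemma coords_extend (v : Fin m → ℝ) : coords m (extend v) = v := by
  ext i
  rw [coords, extend, inner_sum, Finset.sum_eq_single i]
  · rw [inner_smul_right, orthonormal_iff_ite.1 orthonormal_unitVec]; simp
  · intro j _ hj
    rw [inner_smul_right, orthonormal_iff_ite.1 orthonormal_unitVec, if_neg, mul_zero]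
    exact fun h => hj (Fin.ext h.symm)
  · simp

lemma coords_dotProduct_le (x : Ell2) : coords m x ⬝ᵥ coords m x ≤ ‖x‖ ^ 2 := by
  have := (orthonormal_unitVec.comp (fun i : Fin m => (i : ℕ)) Fin.val_injective).isBessel
    Finset.univ x
  simpa [coords, dotProduct, sq] using this

lemma inner_cornerOp (A : Mat) (x y : Ell2) :
    inner ℝ x (cornerOp A y) = coords m x ⬝ᵥ (A *ᵥ coords m y) := by
  have h1 : cornerOp A y = ∑ i : Fin m, ∑ j : Fin m,
      A i j • (inner ℝ (unitVec j) y • unitVec i) := by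
    simp [cornerOp, unitVec, InnerProductSpace.rankOne_apply]
  rw [h1]
  simp only [inner_sum, inner_smul_right, dotProduct, Matrix.mulVec, coords, Finset.mul_sum]
  refine Finset.sum_congr rfl fun i _ => Finset.sum_congr rfl fun j _ => ?_
  rw [real_inner_comm x]; ring

lemma cornerOp_add (A B : Mat) : cornerOp (A + B) = cornerOp A + cornerOp B := by
  ext1 y
  refine ext_inner_left ℝ fun x => ?_
  rw [add_apply, inner_add_right, inner_cornerOp, inner_cornerOp,
    inner_cornerOp, Matrix.add_mulVec, dotProduct_add]

lemma cornerOp_smul (c : ℝ) (A : Mat) : cornerOp (c • A) = c • cornerOp A := by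
  ext1 y
  refine ext_inner_left ℝ fun x => ?_
  rw [smul_apply, inner_smul_right, inner_cornerOp, inner_cornerOp,
    Matrix.smul_mulVec, dotProduct_smul, smul_eq_mul]

lemma isCompactOperator_rankOne (x y : Ell2) :
    IsCompactOperator (InnerProductSpace.rankOne ℝ x y : Ell2 →L[ℝ] Ell2) := by
  rw [InnerProductSpace.rankOne_def']
  have h : IsCompactOperator (ContinuousLinearMap.toSpanSingleton ℝ x : ℝ →L[ℝ] Ell2) :=
    isCompactOperator_of_locallyCompactSpace_rng _
  exact h.comp_clm _

lemma isCompactOperator_cornerOp (A : Mat) : IsCompactOperator (cornerOp A) := by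
  have hmem : cornerOp A ∈ compactOperator (RingHom.id ℝ) Ell2 Ell2 :=
    Submodule.sum_mem _ fun i _ => Submodule.sum_mem _ fun j _ =>
      Submodule.smul_mem _ _ (isCompactOperator_rankOne _ _)
  exact hmem

lemma isBessel_extend_col {V : Mat} (hV : IsContraction V) :
    IsBessel fun j => extend (V.col j) := fun s x => by
  have h1 : ∑ j, inner ℝ (extend (V.col j)) x ^ 2 ≤ ‖x‖ ^ 2 := by
    have e : ∀ j, inner ℝ (extend (V.col j)) x = (Vᵀ *ᵥ coords m x) j := fun j => by
      rw [inner_extend]; rfl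
    simp only [e]
    have := (hV.transpose (coords m x)).trans (coords_dotProduct_le x)
    simpa only [dotProduct, ← sq] using this
  exact (Finset.sum_le_sum_of_subset_of_nonneg (Finset.subset_univ s) fun _ _ _ =>
    sq_nonneg _).trans h1

/-- The Schatten norm of a corner operator is that of its matrix. -/
theorem cornerOp_schatten {p : ℝ} (hp : 1 ≤ p) (A : Mat) :
    MemSchatten p (cornerOp A) ∧ schattenNorm p (cornerOp A) = matSchatten p A := by
  have p0 : 0 < p := by linarith
  obtain ⟨F, E, s, hE, hF, hs, hA, hd, hT⟩ := exists_svd A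
  have htr : tracePow (p / 2) (Aᵀ * A) = ∑ j, s j ^ p := by
    rw [hT]
    refine Finset.sum_congr rfl fun j _ => ?_
    rw [← Real.rpow_natCast, ← Real.rpow_mul (hs j)]
    congr 1; push_cast; ring
  have hF' := isBessel_extend_col hF
  have hE' := isBessel_extend_col (isContraction_of_transpose_mul_self hE)
  have hup : HasSchattenBound p (∑ j, s j ^ p) (cornerOp A) := by
    intro ι u x y hx hy
    refine le_trans (le_of_eq (Finset.sum_congr rfl fun i _ => ?_))
      (sum_abs_pairing_rpow_le hx hy hE' hF' hs hp u Finset.univ)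
    congr 2
    rw [inner_cornerOp, hA, ← Matrix.mulVec_mulVec, ← Matrix.mulVec_mulVec,
      Matrix.dotProduct_mulVec, ← Matrix.mulVec_transpose]
    simp only [dotProduct, Matrix.mulVec_diagonal]
    refine Finset.sum_congr rfl fun j _ => ?_
    rw [inner_extend, inner_extend]
    have e1 : (Fᵀ *ᵥ coords m (x i)) j = F.col j ⬝ᵥ coords m (x i) := rfl
    have e2 : (Eᵀ *ᵥ coords m (y i)) j = E.col j ⬝ᵥ coords m (y i) := rfl
    rw [e1, e2]; ring
  obtain ⟨hmem, hle⟩ := hup.memSchatten hp (isCompactOperator_cornerOp A)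
  refine ⟨hmem, ?_⟩
  have hlow := hmem.hasSchattenBound hp (Fin m) Finset.univ _ _ hF' hE'
  have e : ∀ j, inner ℝ (extend (F.col j)) (cornerOp A (extend (E.col j))) = s j := fun j => by
    rw [inner_cornerOp, coords_extend, coords_extend]
    have h1 : (Fᵀ * A * E) j j = s j := by rw [hd, Matrix.diagonal_apply_eq]
    rw [← h1, Matrix.mul_assoc]
    rfl
  simp only [e, abs_of_nonneg (hs _)] at hlow
  rw [matSchatten, htr, ← le_antisymm hle hlow, ← Real.rpow_mul (schattenNorm_nonneg _ _),
    mul_one_div_cancel p0.ne', Real.rpow_one]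

/-- The top left `m × m` corner of an operator. -/
noncomputable def corner (m : ℕ) : (Ell2 →L[ℝ] Ell2) →ₗ[ℝ] Matrix (Fin m) (Fin m) ℝ where
  toFun T := Matrix.of fun i j => inner ℝ (unitVec i) (T (unitVec j))
  map_add' S T := by ext i j; simp [inner_add_right]
  map_smul' c T := by ext i j; simp [inner_smul_right]

/-- The projection onto the first `m` coordinates. -/
noncomputable def trunc (m : ℕ) (x : Ell2) : Ell2 := extend (coords m x)

lemma inner_trunc_left (x y : Ell2) : inner ℝ (trunc m x) y = coords m x ⬝ᵥ coords m y :=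
  inner_extend _ _

lemma inner_trunc (x y : Ell2) : inner ℝ (trunc m x) y = inner ℝ x (trunc m y) := by
  rw [inner_trunc_left, real_inner_comm, inner_trunc_left, dotProduct_comm]

lemma norm_trunc_le (x : Ell2) : ‖trunc m x‖ ≤ ‖x‖ := by
  refine (sq_le_sq₀ (norm_nonneg _) (norm_nonneg _)).1 ?_
  rw [← real_inner_self_eq_norm_sq, inner_trunc_left, trunc, coords_extend]
  exact coords_dotProduct_le x

lemma inner_cornerOp_corner (T : Ell2 →L[ℝ] Ell2) (x y : Ell2) :
    inner ℝ x (cornerOp (corner m T) y) = inner ℝ (trunc m x) (T (trunc m y)) := by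
  rw [inner_cornerOp, trunc, trunc, extend, extend]
  simp only [corner, LinearMap.coe_mk, AddHom.coe_mk, dotProduct, Matrix.mulVec, Matrix.of_apply,
    map_sum, map_smul, sum_inner, inner_sum, inner_smul_left, inner_smul_right, conj_trivial,
    Finset.mul_sum]
  rw [Finset.sum_comm]
  exact Finset.sum_congr rfl fun i _ => Finset.sum_congr rfl fun j _ => by ring

lemma tendsto_trunc (x : Ell2) :
    Filter.Tendsto (fun m => trunc m x) Filter.atTop (nhds x) := by
  have h := (lp.hasSum_single (p := 2) (by norm_num) x).tendsto_sum_nat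
  convert h using 2 with m
  rw [trunc, extend, Finset.sum_range]
  refine Finset.sum_congr rfl fun i _ => ?_
  rw [coords, inner_unitVec, unitVec, ← lp.single_smul]
  simp

lemma tendsto_inner_corner (T : Ell2 →L[ℝ] Ell2) (x y : Ell2) :
    Filter.Tendsto (fun m => inner ℝ x (cornerOp (corner m T) y)) Filter.atTop
      (nhds (inner ℝ x (T y))) := by
  simp only [inner_cornerOp_corner]
  exact (tendsto_trunc x).inner ((T.continuous.tendsto y).comp (tendsto_trunc y))

lemma schattenNorm_corner_le {p : ℝ} (hp : 1 ≤ p) {T : Ell2 →L[ℝ] Ell2} (hT : MemSchatten p T)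
    (m : ℕ) : schattenNorm p (cornerOp (corner m T)) ≤ schattenNorm p T :=
  (schattenNorm_le_of_hasSchattenBound hp (schattenNorm_nonneg _ _) (isCompactOperator_cornerOp _)
    ((hT.hasSchattenBound hp).compress inner_trunc norm_trunc_le (inner_cornerOp_corner T))).2

/-- Increasing corners have increasing Schatten norms. -/
lemma schattenNorm_corner_mono {p : ℝ} (hp : 1 ≤ p) (T : Ell2 →L[ℝ] Ell2) :
    Monotone fun m => schattenNorm p (cornerOp (corner m T)) := by
  intro m n hmn
  have e : corner m (cornerOp (corner n T)) = corner m T := by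
    have hu : ∀ i : Fin m, trunc n (unitVec i) = unitVec i := fun i => by
      rw [trunc, extend, Finset.sum_eq_single (⟨i, i.2.trans_le hmn⟩ : Fin n)]
      · rw [coords, orthonormal_iff_ite.1 orthonormal_unitVec]; simp
      · intro j _ hj
        rw [coords, orthonormal_iff_ite.1 orthonormal_unitVec, if_neg, zero_smul]
        exact fun h => hj (Fin.ext h)
      · simp
    ext i j
    simp only [corner, LinearMap.coe_mk, AddHom.coe_mk, Matrix.of_apply]
    have := inner_cornerOp_corner (m := n) T (unitVec i) (unitVec j)
    rw [hu, hu] at this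
    exact this
  simpa only [e] using
    schattenNorm_corner_le hp (cornerOp_schatten hp (corner n T)).1 m

lemma memSchatten_of_corner_le {p C : ℝ} (hp : 1 ≤ p) (hC : 0 ≤ C) {T : Ell2 →L[ℝ] Ell2}
    (hT : IsCompactOperator T) (h : ∀ m, schattenNorm p (cornerOp (corner m T)) ≤ C) :
    MemSchatten p T ∧ schattenNorm p T ≤ C :=
  schattenNorm_le_of_hasSchattenBound hp hC hT (HasSchattenBound.of_tendsto (by linarith)
    (fun m => ((cornerOp_schatten hp _).1.hasSchattenBound hp).mono
      (Real.rpow_le_rpow (schattenNorm_nonneg _ _) (h m) (by linarith)))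
    (tendsto_inner_corner T))

lemma tendsto_schattenNorm_corner {p : ℝ} (hp : 1 ≤ p) {T : Ell2 →L[ℝ] Ell2}
    (hT : MemSchatten p T) : Filter.Tendsto (fun m => schattenNorm p (cornerOp (corner m T)))
      Filter.atTop (nhds (schattenNorm p T)) := by
  have hbdd : BddAbove (Set.range fun m => schattenNorm p (cornerOp (corner m T))) :=
    ⟨_, by rintro _ ⟨m, rfl⟩; exact schattenNorm_corner_le hp hT m⟩
  convert tendsto_atTop_ciSup (schattenNorm_corner_mono hp T) hbdd using 2
  refine le_antisymm ?_ (ciSup_le fun m => schattenNorm_corner_le hp hT m)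
  exact (memSchatten_of_corner_le hp ((schattenNorm_nonneg _ _).trans (le_ciSup hbdd 0)) hT.1
    fun m => le_ciSup hbdd m).2

end Corner

/-! ### Finite-dimensional subspaces of the Schatten class -/

section Subspaces

/-- On a finite-dimensional space, an increasing sequence of seminorms converging pointwise to a
norm is eventually almost as large as that norm, by compactness of the sphere. -/
lemma exists_le_seminorm {E : Type*} [NormedAddCommGroup E] [NormedSpace ℝ E]
    [FiniteDimensional ℝ E] {N : Seminorm ℝ E} {S : ℕ → Seminorm ℝ E}
    (hmono : ∀ x, Monotone fun m => S m x)
    (hlim : ∀ x, Filter.Tendsto (fun m => S m x) Filter.atTop (nhds (N x)))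
    (hN : ∀ x, x ≠ 0 → 0 < N x) {c : ℝ} (hc : c < 1) : ∃ m, ∀ x, c * N x ≤ S m x := by
  have hcont : ∀ P : Seminorm ℝ E, Continuous P := fun P => P.convexOn.locallyLipschitz.continuous
  have : ProperSpace E := FiniteDimensional.proper ℝ E
  obtain ⟨m, hm⟩ := (isCompact_sphere (0 : E) 1).elim_directed_cover
    (fun m => {x | c * N x < S m x})
    (fun m => isOpen_lt (continuous_const.mul (hcont N)) (hcont (S m)))
    (fun x hx => by
      have hx0 : x ≠ 0 := fun h => by simp [h] at hx
      have h1 : c * N x < N x := by nlinarith [hN x hx0]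
      obtain ⟨m, hm⟩ := ((hlim x).eventually (lt_mem_nhds h1)).exists
      exact Set.mem_iUnion.2 ⟨m, hm⟩)
    (directed_of_isDirected_le fun m n hmn x hx => lt_of_lt_of_le hx (hmono x hmn))
  refine ⟨m, fun x => ?_⟩
  rcases eq_or_ne x 0 with rfl | hx0
  · simp
  have hx : 0 < ‖x‖ := norm_pos_iff.2 hx0
  have h1 : c * N (‖x‖⁻¹ • x) < S m (‖x‖⁻¹ • x) :=
    hm (by simp [norm_smul, hx.ne'])
  rw [map_smul_eq_mul, map_smul_eq_mul, norm_inv, norm_norm] at h1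
  have h2 : ‖x‖⁻¹ * (c * N x) < ‖x‖⁻¹ * S m x := by linarith
  exact (lt_of_mul_lt_mul_left h2 (inv_nonneg.2 hx.le)).le

/-- The Schatten norm, pulled back along a linear map into the Schatten class. -/
noncomputable def schattenSeminorm {E : Type*} [AddCommGroup E] [Module ℝ E] {p : ℝ} (hp : 1 ≤ p)
    (L : E →ₗ[ℝ] Ell2 →L[ℝ] Ell2) (hL : ∀ x, MemSchatten p (L x)) : Seminorm ℝ E :=
  Seminorm.of (fun x => schattenNorm p (L x))
    (fun x y => by rw [map_add]; exact ((hL x).add hp (hL y)).2)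
    (fun c x => by rw [map_smul, (hL x).norm_smul hp, Real.norm_eq_abs])

/-- `cornerOp` as a linear map. -/
noncomputable def cornerMap (m : ℕ) :
    Matrix (Fin m) (Fin m) ℝ →ₗ[ℝ] Ell2 →L[ℝ] Ell2 where
  toFun := cornerOp
  map_add' := cornerOp_add
  map_smul' := cornerOp_smul

lemma exists_le_schattenNorm_corner {p : ℝ} (hp : 1 ≤ p) {X : Submodule ℝ (Ell2 →L[ℝ] Ell2)}
    [FiniteDimensional ℝ X] (hX : ∀ B ∈ X, MemSchatten p B) {c : ℝ} (hc : c < 1) :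
    ∃ m, ∀ B ∈ X, c * schattenNorm p B ≤ schattenNorm p (cornerOp (corner m B)) := by
  have hN : ∀ B : X, MemSchatten p (X.subtype B) := fun B => hX B.1 B.2
  have hS : ∀ m (B : X), MemSchatten p ((cornerMap m ∘ₗ corner m ∘ₗ X.subtype) B) :=
    fun m B => (cornerOp_schatten hp (corner m B.1)).1
  obtain ⟨N, hN'⟩ : ∃ N : Seminorm ℝ X, ∀ B : X, N B = schattenNorm p B.1 :=
    ⟨schattenSeminorm hp X.subtype hN, fun B => rfl⟩
  obtain ⟨S, hS'⟩ : ∃ S : ℕ → Seminorm ℝ X,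
      ∀ m (B : X), S m B = schattenNorm p (cornerOp (corner m B.1)) :=
    ⟨fun m => schattenSeminorm hp (cornerMap m ∘ₗ corner m ∘ₗ X.subtype) (hS m), fun m B => rfl⟩
  obtain ⟨m, hm⟩ := exists_le_seminorm (E := X) (N := N) (S := S)
    (fun B => by
      simp only [hS']
      exact schattenNorm_corner_mono hp B.1)
    (fun B => by
      simp only [hS', hN']
      exact tendsto_schattenNorm_corner hp (hN B))
    (fun B hB => by
      rw [hN']
      exact lt_of_le_of_ne (schattenNorm_nonneg _ _) fun h =>
        hB (Subtype.ext ((hN B).eq_zero hp h.symm))) hc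
  refine ⟨m, fun B hB => ?_⟩
  have h := hm ⟨B, hB⟩
  rwa [hN', hS'] at h

lemma one_le_distortionBound {p q : ℝ} (hp : 1 ≤ p) (hpq : p < q) {k : ℕ} (hk : k ≠ 0) :
    1 ≤ distortionBound p q k := by
  have k1 : (1 : ℝ) ≤ k := by exact_mod_cast Nat.one_le_iff_ne_zero.2 hk
  have h : 0 ≤ 1 / p - 1 / q := sub_nonneg.2 (one_div_le_one_div_of_le (by linarith) hpq.le)
  rw [distortionBound]
  split_ifs
  · exact Real.one_le_rpow k1 h
  · exact Real.one_le_rpow k1 (mul_nonneg (by linarith) h)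

/-- A linear embedding with two-sided bounds bounds the distortion. -/
lemma distortionInSchatten_le_of_linear {p q : ℝ} {X : Submodule ℝ (Ell2 →L[ℝ] Ell2)}
    {a b D : ℝ} (ha : 0 < a) (ha1 : a ≤ 1) (hb : 0 < b) (hD : 1 ≤ D)
    (Φ : X →ₗ[ℝ] Ell2 →L[ℝ] Ell2) (hΦ : ∀ B, MemSchatten q (Φ B))
    (h1 : ∀ B : X, a * schattenNorm p B.1 ≤ b * schattenNorm q (Φ B))
    (h2 : ∀ B : X, b * schattenNorm q (Φ B) ≤ D * schattenNorm p B.1) :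
    distortionInSchatten q (fun A B : X => schattenDist p A.1 B.1) ≤ ENNReal.ofReal (D / a) := by
  have D0 : 0 < D := by linarith
  refine sInf_le ⟨?_, fun B => ⟨Φ B, hΦ B⟩, b / D, by positivity, fun A B => ?_⟩
  · rw [ENNReal.one_le_ofReal, le_div_iff₀ ha]; linarith
  · have e : schattenDist q (Φ A) (Φ B) = schattenNorm q (Φ (A - B)) := by
      rw [schattenDist, map_sub]
    have e' : schattenDist p A.1 B.1 = schattenNorm p (A - B).1 := rfl
    dsimp only
    rw [e, e']
    constructor
    · rw [div_mul_eq_mul_div, div_le_iff₀ D0]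
      linarith [h2 (A - B)]
    · rw [← ENNReal.ofReal_mul (by positivity)]
      refine ENNReal.ofReal_le_ofReal ?_
      have e3 : D / a * (b / D * schattenNorm q (Φ (A - B))) =
          b * schattenNorm q (Φ (A - B)) / a := by field_simp
      rw [e3, le_div_iff₀ ha]
      linarith [h1 (A - B)]

/-- The truncation to a corner followed by the change of density along a Lewis basis. -/
theorem exists_lewis_embedding {p q : ℝ} (hp : 1 ≤ p) (hpq : p < q)
    (X : Submodule ℝ (Ell2 →L[ℝ] Ell2)) [FiniteDimensional ℝ X] (hX0 : X ≠ ⊥)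
    (hX : ∀ B ∈ X, MemSchatten p B) {ε : ℝ} (hε0 : 0 < ε) (hε1 : ε < 1) :
    ∃ (m : ℕ) (J : X →ₗ[ℝ] Matrix (Fin m) (Fin m) ℝ)
      (T : Fin (Module.finrank ℝ X) → Matrix (Fin m) (Fin m) ℝ),
      (∀ B : X, (1 - ε) * schattenNorm p B.1 ≤ schattenNorm p (cornerOp (J B)) ∧
        schattenNorm p (cornerOp (J B)) ≤ schattenNorm p B.1) ∧
      IsLewisBasis p (LinearMap.range J) T ∧
      ∃ Φ : X →ₗ[ℝ] (Ell2 →L[ℝ] Ell2),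
        (∀ B : X, Φ B = cornerOp (J B * psdPow (gramSum T) ((p - q) / (2 * q)))) ∧
        ∀ B : X, MemSchatten q (Φ B) ∧
          (1 - ε) * schattenNorm p B.1 ≤
            (Module.finrank ℝ X : ℝ) ^ (1 / p - 1 / q) * schattenNorm q (Φ B) ∧
          (Module.finrank ℝ X : ℝ) ^ (1 / p - 1 / q) * schattenNorm q (Φ B) ≤
            distortionBound p q (Module.finrank ℝ X) * schattenNorm p B.1 := by
  have hq : 1 ≤ q := by linarith
  have hk : Module.finrank ℝ X ≠ 0 := fun h => hX0 (Submodule.finrank_eq_zero.1 h)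
  obtain ⟨m, hm⟩ := exists_le_schattenNorm_corner hp hX (show 1 - ε < 1 by linarith)
  set J : X →ₗ[ℝ] Matrix (Fin m) (Fin m) ℝ := corner m ∘ₗ X.subtype with hJ
  have hlow : ∀ B : X, (1 - ε) * schattenNorm p B.1 ≤ schattenNorm p (cornerOp (J B)) :=
    fun B => hm B.1 B.2
  have hup : ∀ B : X, schattenNorm p (cornerOp (J B)) ≤ schattenNorm p B.1 :=
    fun B => schattenNorm_corner_le hp (hX B.1 B.2) m
  have hinj : Function.Injective J := by
    refine (injective_iff_map_eq_zero J).2 fun B hB => Subtype.ext ((hX B.1 B.2).eq_zero hp ?_)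
    have h1 := hlow B
    rw [hB, show cornerOp (0 : Matrix (Fin m) (Fin m) ℝ) = 0 from (cornerMap m).map_zero] at h1
    have h2 : schattenNorm p (0 : Ell2 →L[ℝ] Ell2) = 0 := by
      have := (hX B.1 B.2).norm_smul hp 0
      simpa using this
    rw [h2] at h1
    nlinarith [schattenNorm_nonneg p B.1]
  obtain ⟨T, hT⟩ := exists_lewisBasis hp hk (LinearMap.range J)
    (LinearMap.finrank_range_of_inj hinj)
  refine ⟨m, J, T, fun B => ⟨hlow B, hup B⟩, hT,
    cornerMap m ∘ₗ LinearMap.mulRight ℝ (psdPow (gramSum T) ((p - q) / (2 * q))) ∘ₗ J,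
    fun B => rfl, fun B => ?_⟩
  have hmem : J B ∈ LinearMap.range J := ⟨B, rfl⟩
  have e1 := (cornerOp_schatten hp (J B)).2
  obtain ⟨e2, e3⟩ := cornerOp_schatten hq (changeDensity p q T (J B))
  have h1 := hT.le_changeDensity hp hpq hmem
  have h2 := hT.changeDensity_le hp hpq hk hmem
  rw [← e1, ← e3] at h1 h2
  exact ⟨e2, (hlow B).trans h1, h2.trans (mul_le_mul_of_nonneg_left (hup B)
    (zero_le_one.trans (one_le_distortionBound hp hpq hk)))⟩

theorem distortionInSchatten_le_distortionBound {p q : ℝ} (hp : 1 ≤ p) (hpq : p < q)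
    (X : Submodule ℝ (Ell2 →L[ℝ] Ell2)) [FiniteDimensional ℝ X] (hX0 : X ≠ ⊥)
    (hX : ∀ B ∈ X, MemSchatten p B) :
    distortionInSchatten q (fun A B : X => schattenDist p A.1 B.1) ≤
      ENNReal.ofReal (distortionBound p q (Module.finrank ℝ X)) := by
  have hk : Module.finrank ℝ X ≠ 0 := fun h => hX0 (Submodule.finrank_eq_zero.1 h)
  have hlim : Filter.Tendsto
      (fun a : ℝ => ENNReal.ofReal (distortionBound p q (Module.finrank ℝ X) / a))
      (nhdsWithin 1 (Set.Iio 1))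
      (nhds (ENNReal.ofReal (distortionBound p q (Module.finrank ℝ X) / 1))) :=
    (ENNReal.tendsto_ofReal (tendsto_const_nhds.div Filter.tendsto_id one_ne_zero)).mono_left
      nhdsWithin_le_nhds
  rw [div_one] at hlim
  refine ge_of_tendsto hlim ?_
  filter_upwards [Ioo_mem_nhdsLT (show (0 : ℝ) < 1 by norm_num)] with a ha
  obtain ⟨m, J, T, -, -, Φ, -, hΦ⟩ := exists_lewis_embedding hp hpq X hX0 hX
    (sub_pos.2 ha.2) (sub_lt_self 1 ha.1)
  rw [sub_sub_cancel] at hΦ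
  exact distortionInSchatten_le_of_linear ha.1 ha.2.le
    (Real.rpow_pos_of_pos (by exact_mod_cast Nat.pos_of_ne_zero hk) _)
    (one_le_distortionBound hp hpq hk) Φ (fun B => (hΦ B).1) (fun B => (hΦ B).2.1)
    fun B => (hΦ B).2.2

end Subspaces

/-! ### Roundness of the Schatten class and distortion of the cube -/

section Roundness

lemma add_rpow_le_two_rpow_mul {q s t : ℝ} (hq : 1 ≤ q) (hs : 0 ≤ s) (ht : 0 ≤ t) :
    (s + t) ^ q ≤ 2 ^ (q - 1) * (s ^ q + t ^ q) := by
  have h := NNReal.rpow_add_le_mul_rpow_add_rpow ⟨s, hs⟩ ⟨t, ht⟩ hq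
  exact_mod_cast h

/-- McCarthy's inequality for operators. -/
lemma schattenNorm_add_sub_le {q : ℝ} (hq : 1 ≤ q) (hq2 : q ≤ 2) {S T : Ell2 →L[ℝ] Ell2}
    (hS : MemSchatten q S) (hT : MemSchatten q T) :
    schattenNorm q (S + T) ^ q + schattenNorm q (S - T) ^ q ≤
      2 * (schattenNorm q S ^ q + schattenNorm q T ^ q) := by
  have q0 : 0 < q := by linarith
  have hlim : ∀ {R : Ell2 →L[ℝ] Ell2}, MemSchatten q R →
      Filter.Tendsto (fun m => schattenNorm q (cornerOp (corner m R)) ^ q) Filter.atTop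
        (nhds (schattenNorm q R ^ q)) :=
    fun hR => (tendsto_schattenNorm_corner hq hR).rpow_const (Or.inr q0.le)
  refine le_of_tendsto_of_tendsto' ((hlim (hS.add hq hT).1).add (hlim (hS.sub hq hT)))
    (((hlim hS).add (hlim hT)).const_mul 2) fun m => ?_
  simp only [(cornerOp_schatten hq _).2, matSchatten_rpow q0.ne', map_add, map_sub]
  exact tracePow_add_sub_le _ _ (by linarith) (by linarith)

/-- For `1 ≤ q ≤ 2` the Schatten class `S_q` has roundness `q`: in a quadrilateral, the sum of
the `q`-th powers of the diagonals is at most that of the sides. -/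
theorem schattenDist_roundness {q : ℝ} (hq : 1 ≤ q) (hq2 : q ≤ 2) (x y z w : SchattenClass q) :
    schattenDist q x.1 z.1 ^ q + schattenDist q y.1 w.1 ^ q ≤
      schattenDist q x.1 y.1 ^ q + schattenDist q y.1 z.1 ^ q + schattenDist q z.1 w.1 ^ q +
        schattenDist q w.1 x.1 ^ q := by
  obtain ⟨x, hx⟩ := x
  obtain ⟨y, hy⟩ := y
  obtain ⟨z, hz⟩ := z
  obtain ⟨w, hw⟩ := w
  have q0 : 0 < q := by linarith
  simp only [schattenDist]
  have ha := hx.sub hq hy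
  have hb := hy.sub hq hz
  have hc := hz.sub hq hw
  have hd := hw.sub hq hx
  have h1 := schattenNorm_add_sub_le hq hq2 (ha.sub hq hc) (hb.sub hq hd)
  have e1 : x - y - (z - w) + (y - z - (w - x)) = (2 : ℝ) • (x - z) := by module
  have e2 : x - y - (z - w) - (y - z - (w - x)) = (-2 : ℝ) • (y - w) := by module
  rw [e1, e2, (hx.sub hq hz).norm_smul hq, (hy.sub hq hw).norm_smul hq,
    Real.mul_rpow (abs_nonneg _) (schattenNorm_nonneg _ _),
    Real.mul_rpow (abs_nonneg _) (schattenNorm_nonneg _ _), abs_neg, abs_two] at h1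
  -- the crude bound `‖a - c‖ ^ q ≤ 2 ^ (q - 1) * (‖a‖ ^ q + ‖c‖ ^ q)` loses exactly what the
  -- homogeneity factor `2 ^ q` on the left gains
  have h2 : ∀ {a c : Ell2 →L[ℝ] Ell2}, MemSchatten q a → MemSchatten q c →
      schattenNorm q (a - c) ^ q ≤ 2 ^ (q - 1) * (schattenNorm q a ^ q + schattenNorm q c ^ q) := by
    intro a c ha hc
    have h3 := (ha.add hq (hc.smul_le hq (-1)).1).2
    rw [hc.norm_smul hq, abs_neg, abs_one, one_mul, neg_one_smul, ← sub_eq_add_neg] at h3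
    exact (Real.rpow_le_rpow (schattenNorm_nonneg _ _) h3 q0.le).trans
      (add_rpow_le_two_rpow_mul hq (schattenNorm_nonneg _ _) (schattenNorm_nonneg _ _))
  have h4 := h2 ha hc
  have h5 := h2 hb hd
  have e3 : (2 : ℝ) ^ q = 2 * 2 ^ (q - 1) := by
    rw [Real.rpow_sub_one two_ne_zero]; ring
  rw [e3] at h1
  have pos : (0 : ℝ) < 2 * 2 ^ (q - 1) := by positivity
  refine le_of_mul_le_mul_left ?_ pos
  linarith

/-- Enflo's inequality: roundness controls the long diagonals of a cube by its edges. -/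
lemma sum_diagonal_le_sum_edge {α : Type*} {ρ : α → α → ℝ} (h0 : ∀ x, ρ x x = 0)
    (hsymm : ∀ x y, ρ x y = ρ y x)
    (hround : ∀ x y z w, ρ x z + ρ y w ≤ ρ x y + ρ y z + ρ z w + ρ w x) (k : ℕ)
    (f : (Fin k → Bool) → α) :
    ∑ v, ρ (f v) (f fun i => !v i) ≤
      ∑ v : Fin k → Bool, ∑ i, ρ (f v) (f (Function.update v i (!v i))) := by
  induction k with
  | zero =>
    refine Finset.sum_le_sum fun v _ => ?_
    rw [Subsingleton.elim (fun i => !v i) v, h0]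
    simp
  | succ k ih =>
    have hsum : ∀ g : (Fin (k + 1) → Bool) → ℝ, ∑ v, g v =
        ∑ u : Fin k → Bool, (g (Fin.cons false u) + g (Fin.cons true u)) := fun g => by
      rw [← (Fin.consEquiv fun _ : Fin (k + 1) => Bool).sum_comp g, Fintype.sum_prod_type,
        Finset.sum_add_distrib, Fintype.sum_bool, add_comm]
      rfl
    have hneg : ∀ g : (Fin k → Bool) → ℝ, ∑ u, g u = ∑ u : Fin k → Bool, g fun i => !u i :=
      fun g => ((Equiv.piCongrRight fun _ : Fin k => Equiv.boolNot).sum_comp g).symm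
    have hnot : ∀ (b : Bool) (u : Fin k → Bool),
        (fun i => !(Fin.cons b u : Fin (k + 1) → Bool) i) = Fin.cons (!b) fun i => !u i :=
      fun b u => funext fun i => by refine Fin.cases ?_ (fun j => ?_) i <;> simp
    rw [hsum, hsum]
    simp only [hnot, Fin.sum_univ_succ, Fin.cons_zero, Fin.cons_succ, Fin.update_cons_zero,
      ← Fin.cons_update, Bool.not_false, Bool.not_true]
    have i0 := ih fun u => f (Fin.cons false u)
    have i1 := ih fun u => f (Fin.cons true u)
    have r := Finset.sum_le_sum fun (u : Fin k → Bool) (_ : u ∈ Finset.univ) =>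
      hround (f (Fin.cons false u)) (f (Fin.cons true u)) (f (Fin.cons true fun i => !u i))
        (f (Fin.cons false fun i => !u i))
    have n1 := hneg fun u => ρ (f (Fin.cons true u)) (f (Fin.cons false u))
    simp only [Finset.sum_add_distrib, hsymm (f (Fin.cons false fun i => !_)) _] at r i0 i1 n1 ⊢
    linarith

end Roundness

section Cube

/-- The vertices of the cube `{-1, 1}ᵏ` in `ℓ_p^k`. -/
noncomputable def cubeVertex (p : ℝ) {k : ℕ} (v : Fin k → Bool) : EllPK p k :=
  WithLp.toLp _ fun i => if v i then 1 else -1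

lemma ellPK_dist {p : ℝ} (hp : 1 ≤ p) {k : ℕ} (x y : EllPK p k) :
    dist x y = (∑ i, |x i - y i| ^ p) ^ (1 / p) := by
  have e : (ENNReal.ofReal p).toReal = p := ENNReal.toReal_ofReal (by linarith)
  rw [PiLp.dist_eq_sum (by rw [e]; linarith), e]
  simp only [Real.dist_eq]

lemma ellPK_norm {p : ℝ} (hp : 1 ≤ p) {k : ℕ} (x : EllPK p k) :
    ‖x‖ = (∑ i, |x i| ^ p) ^ (1 / p) := by
  have e : (ENNReal.ofReal p).toReal = p := ENNReal.toReal_ofReal (by linarith)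
  rw [PiLp.norm_eq_sum (by rw [e]; linarith), e]
  simp only [Real.norm_eq_abs]

lemma dist_cubeVertex_not {p : ℝ} (hp : 1 ≤ p) {k : ℕ} (v : Fin k → Bool) :
    dist (cubeVertex p v) (cubeVertex p fun i => !v i) = 2 * (k : ℝ) ^ (1 / p) := by
  have e : ∀ i, |(cubeVertex p v) i - (cubeVertex p fun i => !v i) i| = 2 := fun i => by
    simp only [cubeVertex]
    cases v i <;> norm_num
  rw [ellPK_dist hp]
  simp only [e, Finset.sum_const, Finset.card_univ, Fintype.card_fin, nsmul_eq_mul]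
  rw [Real.mul_rpow (by positivity) (by positivity), ← Real.rpow_mul (by norm_num),
    mul_one_div_cancel (by linarith), Real.rpow_one, mul_comm]

lemma dist_cubeVertex_update {p : ℝ} (hp : 1 ≤ p) {k : ℕ} (v : Fin k → Bool) (i : Fin k) :
    dist (cubeVertex p v) (cubeVertex p (Function.update v i (!v i))) = 2 := by
  have p0 : p ≠ 0 := by linarith
  have e : ∀ j, |(cubeVertex p v) j - (cubeVertex p (Function.update v i (!v i))) j| ^ p =
      if j = i then 2 ^ p else 0 := fun j => by
    simp only [cubeVertex, Function.update_apply]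
    split_ifs with h1 h2 h3 h4 <;> simp_all <;> norm_num
  rw [ellPK_dist hp]
  simp only [e, Finset.sum_ite_eq', Finset.mem_univ, if_true]
  rw [← Real.rpow_mul (by norm_num), mul_one_div_cancel p0, Real.rpow_one]

lemma schattenDist_comm {q : ℝ} (hq : 1 ≤ q) (x y : SchattenClass q) :
    schattenDist q x.1 y.1 = schattenDist q y.1 x.1 := by
  have h := (x.2.sub hq y.2).norm_smul hq (-1)
  rw [abs_neg, abs_one, one_mul, neg_one_smul, neg_sub] at h
  exact h.symm

lemma schattenDist_self {q : ℝ} (hq : 1 ≤ q) (x : SchattenClass q) :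
    schattenDist q x.1 x.1 = 0 := by
  have h := x.2.norm_smul hq 0
  rw [zero_smul, abs_zero, zero_mul] at h
  rw [schattenDist, sub_self, h]

/-- The cube forces the distortion of `ℓ_p^k` in `S_q` to be large. -/
theorem le_distortionInSchatten_ellPK {p q : ℝ} (hp : 1 ≤ p) (hpq : p < q) (hq2 : q ≤ 2) {k : ℕ}
    (hk : 1 ≤ k) : ENNReal.ofReal ((k : ℝ) ^ (1 / p - 1 / q)) ≤
      distortionInSchatten q (fun x y : EllPK p k => dist x y) := by
  have hq : 1 ≤ q := by linarith
  have q0 : 0 < q := by linarith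
  have k0 : (0 : ℝ) < k := by exact_mod_cast hk
  refine le_sInf ?_
  rintro α ⟨-, f, l, hl, hf⟩
  rcases eq_or_ne α ⊤ with rfl | hα
  · exact le_top
  rw [← ENNReal.ofReal_toReal hα]
  refine ENNReal.ofReal_le_ofReal ?_
  set a := α.toReal with ha
  have a0 : 0 ≤ a := ENNReal.toReal_nonneg
  have hnn : ∀ S T : SchattenClass q, 0 ≤ schattenDist q S.1 T.1 :=
    fun S T => schattenNorm_nonneg _ _
  have hlow : ∀ x y, l * schattenDist q (f x).1 (f y).1 ≤ dist x y := fun x y => (hf x y).1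
  have hup : ∀ x y, dist x y ≤ a * (l * schattenDist q (f x).1 (f y).1) := fun x y => by
    have h1 := (hf x y).2
    have h2 : 0 ≤ l * schattenDist q (f x).1 (f y).1 := mul_nonneg hl.le (hnn _ _)
    rw [← ENNReal.ofReal_toReal hα, ← ENNReal.ofReal_mul a0,
      ENNReal.ofReal_le_ofReal_iff (mul_nonneg a0 h2)] at h1
    exact h1
  have enflo := sum_diagonal_le_sum_edge
    (ρ := fun x y : SchattenClass q => schattenDist q x.1 y.1 ^ q)
    (fun x => by rw [schattenDist_self hq, Real.zero_rpow q0.ne'])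
    (fun x y => by rw [schattenDist_comm hq])
    (schattenDist_roundness hq hq2) k fun v => f (cubeVertex p v)
  have h1 : ∀ v : Fin k → Bool, (2 * (k : ℝ) ^ (1 / p)) ^ q ≤ (a * l) ^ q *
      schattenDist q (f (cubeVertex p v)).1 (f (cubeVertex p fun i => !v i)).1 ^ q := fun v => by
    rw [← Real.mul_rpow (by positivity) (hnn _ _)]
    refine Real.rpow_le_rpow (by positivity) ?_ q0.le
    rw [← dist_cubeVertex_not hp v, mul_assoc]
    exact hup _ _
  have h2 : ∀ (v : Fin k → Bool) (i : Fin k), l ^ q * schattenDist q (f (cubeVertex p v)).1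
      (f (cubeVertex p (Function.update v i (!v i)))).1 ^ q ≤ 2 ^ q := fun v i => by
    rw [← Real.mul_rpow hl.le (hnn _ _)]
    refine Real.rpow_le_rpow (mul_nonneg hl.le (hnn _ _)) ?_ q0.le
    rw [← dist_cubeVertex_update hp v i]
    exact hlow _ _
  have h3 := Finset.sum_le_sum fun (v : Fin k → Bool) (_ : v ∈ Finset.univ) => h1 v
  have h4 := Finset.sum_le_sum fun (v : Fin k → Bool) (_ : v ∈ Finset.univ) =>
    Finset.sum_le_sum fun (i : Fin k) (_ : i ∈ Finset.univ) => h2 v i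
  simp only [← Finset.mul_sum, Finset.sum_const, Finset.card_univ, Fintype.card_fin,
    nsmul_eq_mul] at h3 h4
  have N0 : (0 : ℝ) < (Fintype.card (Fin k → Bool) : ℕ) := by exact_mod_cast Fintype.card_pos
  have h5 : (Fintype.card (Fin k → Bool) : ℝ) * (2 * (k : ℝ) ^ (1 / p)) ^ q ≤
      a ^ q * ((Fintype.card (Fin k → Bool) : ℝ) * (k * 2 ^ q)) := by
    refine h3.trans ?_
    rw [Real.mul_rpow a0 hl.le, mul_assoc]
    exact mul_le_mul_of_nonneg_left
      ((mul_le_mul_of_nonneg_left enflo (by positivity)).trans (h4.trans_eq (by ring)))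
      (by positivity)
  have h6 : ((k : ℝ) ^ (1 / p)) ^ q ≤ a ^ q * k := by
    rw [Real.mul_rpow (by norm_num) (by positivity)] at h5
    have h7 : (Fintype.card (Fin k → Bool) * (2 : ℝ) ^ q) * ((k : ℝ) ^ (1 / p)) ^ q ≤
        (Fintype.card (Fin k → Bool) * (2 : ℝ) ^ q) * (a ^ q * k) := by linarith
    exact le_of_mul_le_mul_left h7 (by positivity)
  refine (Real.rpow_le_rpow_iff (by positivity) a0 q0).1 ?_
  rw [← Real.rpow_mul k0.le, sub_mul, one_div_mul_cancel q0.ne', Real.rpow_sub_one k0.ne',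
    Real.rpow_mul k0.le]
  exact (div_le_iff₀ k0).2 h6

end Cube

/-! ### Diagonal operators -/

section Diagonal

lemma psdPow_diagonal {m : ℕ} {c : Fin m → ℝ} (hc : ∀ i, 0 ≤ c i) (β : ℝ) :
    psdPow (Matrix.diagonal c) β = Matrix.diagonal fun i => c i ^ β := by
  obtain ⟨U, d, hU, hU', -, hM, hf⟩ := exists_diag (Matrix.PosSemidef.diagonal hc)
  have h1 : Matrix.diagonal c * U = U * Matrix.diagonal d := by
    conv_lhs => rw [hM]
    rw [Matrix.mul_assoc, hU, Matrix.mul_one]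
  have h2 : U * Matrix.diagonal (fun i => d i ^ β) = Matrix.diagonal (fun i => c i ^ β) * U := by
    ext i j
    have h3 := congrFun (congrFun h1 i) j
    rw [Matrix.diagonal_mul, Matrix.mul_diagonal] at h3
    rw [Matrix.diagonal_mul, Matrix.mul_diagonal]
    rcases eq_or_ne (U i j) 0 with h0 | h0
    · rw [h0, zero_mul, mul_zero]
    · have h4 : c i = d j := mul_right_cancel₀ h0 (by rw [h3, mul_comm])
      rw [h4, mul_comm]
  rw [psdPow, hf, h2, Matrix.mul_assoc, hU', Matrix.mul_one]

lemma matSchatten_diagonal {p : ℝ} {m : ℕ} (x : Fin m → ℝ) :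
    matSchatten p (Matrix.diagonal x) = (∑ i, |x i| ^ p) ^ (1 / p) := by
  rw [matSchatten, tracePow, Matrix.diagonal_transpose, Matrix.diagonal_mul_diagonal,
    psdPow_diagonal fun i => mul_self_nonneg _, Matrix.trace_diagonal]
  congr 1
  refine Finset.sum_congr rfl fun i _ => ?_
  rw [← abs_mul_abs_self, ← sq, ← Real.rpow_natCast, ← Real.rpow_mul (abs_nonneg _)]
  congr 1; push_cast; ring

/-- The diagonal operators with `k` prescribed entries, an isometric copy of `ℓ_p^k`. -/
noncomputable def diagonalOp (p : ℝ) (k : ℕ) : EllPK p k →ₗ[ℝ] Ell2 →L[ℝ] Ell2 :=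
  cornerMap k ∘ₗ Matrix.diagonalLinearMap (Fin k) ℝ ℝ ∘ₗ
    (WithLp.linearEquiv (ENNReal.ofReal p) ℝ (Fin k → ℝ)).toLinearMap

lemma diagonalOp_schatten {p : ℝ} (hp : 1 ≤ p) {k : ℕ} (x : EllPK p k) :
    MemSchatten p (diagonalOp p k x) ∧ schattenNorm p (diagonalOp p k x) = ‖x‖ := by
  have h := cornerOp_schatten hp (Matrix.diagonal (WithLp.ofLp x))
  rw [matSchatten_diagonal, ← ellPK_norm hp] at h
  exact h

lemma diagonalOp_injective {p : ℝ} (hp : 1 ≤ p) (k : ℕ) : Function.Injective (diagonalOp p k) := by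
  have : Fact (1 ≤ ENNReal.ofReal p) := ⟨ENNReal.one_le_ofReal.2 hp⟩
  refine (injective_iff_map_eq_zero _).2 fun x hx => ?_
  obtain ⟨h1, h2⟩ := diagonalOp_schatten hp x
  have h3 := h1.norm_smul hp 0
  rw [zero_smul, abs_zero, zero_mul] at h3
  rw [hx, h3] at h2
  exact norm_eq_zero.1 h2.symm

/-- Distortion does not increase under passage to a subspace. -/
lemma distortion_le_of_isometry {α β γ : Type*} {dα : α → α → ℝ} {dβ : β → β → ℝ}
    {dγ : γ → γ → ℝ} (e : α → β) (he : ∀ x y, dβ (e x) (e y) = dα x y) :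
    distortion dα dγ ≤ distortion dβ dγ := by
  refine le_sInf ?_
  rintro D ⟨h1, f, l, hl, hf⟩
  refine sInf_le ⟨h1, f ∘ e, l, hl, fun x y => ?_⟩
  rw [← he]
  exact hf _ _

theorem exists_subspace_isometric_ellPK {p q : ℝ} (hp : 1 ≤ p) (hpq : p < q) (hq2 : q ≤ 2) {k : ℕ}
    (hk : 1 ≤ k) :
    distortionInSchatten q (fun x y : EllPK p k => dist x y) =
        ENNReal.ofReal ((k : ℝ) ^ (1 / p - 1 / q)) ∧
      ∃ X : Submodule ℝ (Ell2 →L[ℝ] Ell2),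
        (∀ B ∈ X, MemSchatten p B) ∧ Module.finrank ℝ X = k ∧
        (∃ e : EllPK p k ≃ₗ[ℝ] X, ∀ x, schattenNorm p (e x).1 = ‖x‖) ∧
        distortionInSchatten q (fun A B : X => schattenDist p A.1 B.1) =
          ENNReal.ofReal ((k : ℝ) ^ (1 / p - 1 / q)) := by
  set X := LinearMap.range (diagonalOp p k) with hXdef
  let e : EllPK p k ≃ₗ[ℝ] X := LinearEquiv.ofInjective _ (diagonalOp_injective hp k)
  have hX : ∀ B ∈ X, MemSchatten p B := by
    rintro _ ⟨x, rfl⟩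
    exact (diagonalOp_schatten hp x).1
  have hrank : Module.finrank ℝ X = k := by
    rw [← e.finrank_eq]
    exact (WithLp.linearEquiv (ENNReal.ofReal p) ℝ (Fin k → ℝ)).finrank_eq.trans (by simp)
  have he : ∀ x, schattenNorm p (e x).1 = ‖x‖ := fun x => (diagonalOp_schatten hp x).2
  have hdist : ∀ x y, schattenDist p (e x).1 (e y).1 = dist x y := fun x y => by
    rw [ellPK_dist hp]
    have h1 := he (x - y)
    rw [map_sub, ellPK_norm hp] at h1
    exact h1
  have : FiniteDimensional ℝ X := Module.finite_of_finrank_pos (by omega)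
  have hX0 : X ≠ ⊥ := fun h => by
    rw [h, finrank_bot] at hrank
    omega
  have hle := distortionInSchatten_le_distortionBound hp hpq X hX0 hX
  rw [hrank, distortionBound, if_pos (by linarith)] at hle
  have hlow := le_distortionInSchatten_ellPK hp hpq hq2 hk
  have h1 : distortionInSchatten q (fun x y : EllPK p k => dist x y) ≤
      distortionInSchatten q (fun A B : X => schattenDist p A.1 B.1) :=
    distortion_le_of_isometry e hdist
  exact ⟨le_antisymm (h1.trans hle) hlow, X, hX, hrank, ⟨e, he⟩,
    le_antisymm hle (hlow.trans h1)⟩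

end Diagonal

end SchattenLewis

theorem mainTheorem4 (p q : ℝ) (hp : 1 ≤ p) (hpq : p < q) :
    (∀ X : Submodule ℝ (Ell2 →L[ℝ] Ell2), FiniteDimensional ℝ X → X ≠ ⊥ →
      (∀ B ∈ X, MemSchatten p B) →
        distortionInSchatten q (fun A B : X => schattenDist p A.1 B.1) ≤
            ENNReal.ofReal (distortionBound p q (Module.finrank ℝ X)) ∧
        ∀ ε : ℝ, 0 < ε → ε < 1 →
          ∃ (m : ℕ) (J : X →ₗ[ℝ] Matrix (Fin m) (Fin m) ℝ)
            (T : Fin (Module.finrank ℝ X) → Matrix (Fin m) (Fin m) ℝ),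
            (∀ B : X, (1 - ε) * schattenNorm p B.1 ≤ schattenNorm p (cornerOp (J B)) ∧
              schattenNorm p (cornerOp (J B)) ≤ schattenNorm p B.1) ∧
            IsLewisBasis p (LinearMap.range J) T ∧
            ∃ Φ : X →ₗ[ℝ] (Ell2 →L[ℝ] Ell2),
              (∀ B : X, Φ B = cornerOp (J B * psdPow (gramSum T) ((p - q) / (2 * q)))) ∧
              ∀ B : X, MemSchatten q (Φ B) ∧
                (1 - ε) * schattenNorm p B.1 ≤
                  (Module.finrank ℝ X : ℝ) ^ (1 / p - 1 / q) * schattenNorm q (Φ B) ∧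
                (Module.finrank ℝ X : ℝ) ^ (1 / p - 1 / q) * schattenNorm q (Φ B) ≤
                  distortionBound p q (Module.finrank ℝ X) * schattenNorm p B.1) ∧
    (q ≤ 2 → ∀ k : ℕ, 1 ≤ k →
      distortionInSchatten q (fun x y : EllPK p k => dist x y) =
          ENNReal.ofReal ((k : ℝ) ^ (1 / p - 1 / q)) ∧
      ∃ X : Submodule ℝ (Ell2 →L[ℝ] Ell2),
        (∀ B ∈ X, MemSchatten p B) ∧ Module.finrank ℝ X = k ∧
        (∃ e : EllPK p k ≃ₗ[ℝ] X, ∀ x, schattenNorm p (e x).1 = ‖x‖) ∧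
        distortionInSchatten q (fun A B : X => schattenDist p A.1 B.1) =
          ENNReal.ofReal ((k : ℝ) ^ (1 / p - 1 / q))) := by
  refine ⟨fun X hfin hX0 hX => ⟨?_, fun ε hε0 hε1 => ?_⟩, fun hq2 k hk => ?_⟩
  · exact SchattenLewis.distortionInSchatten_le_distortionBound hp hpq X hX0 hX
  · exact SchattenLewis.exists_lewis_embedding hp hpq X hX0 hX hε0 hε1
  · exact SchattenLewis.exists_subspace_isometric_ellPK hp hpq hq2 hk
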